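/- Let $\langle x\rangle=(1+|x|^2)^{1/2}$ and $m(x)=|x|\,(1-\chi(x))+\chi(x)$ for $x\in\mathbb{R}^2$, where $\chi\in C^\infty(\mathbb{R}^2,[0,1])$ is a radial cut-off function with $\chi(x)=0$ for $|x|<1$ and $\chi(x)=1$ for $|x|>2$. For an integer $s\ge 0$ and $\gamma,\sigma\in\mathbb{R}$, let $H^s_{\gamma,\sigma}(\mathbb{R}^2)$ be the completion of the set of real-valued functions $u \in C_0^\infty(\mathbb{R}^2)$ of finite norm with respect to $$\|u\|_{H^s_{\gamma,\sigma}}=\sum_{|\alpha|\le s}\big\|\,m(x)^{\sigma+|\alpha|}\,D^\alpha u(x)\,\langle x\rangle^{\gamma}\big\|_{L^2(\mathbb{R}^2)},$$ and let $H^s_{r,\gamma,\sigma}(\mathbb{R}^2)$ be its subspace of radially symmetric functions $u=u(r)$, $r=|x|$, with the same norm. Proposition. Let $\gamma\in\mathbb{R}$, $\sigma\in(-2,0)$, and let $s\ge 2$ be an integer. Then the operator $$\Delta_1-\mathrm{Id}:\ H^s_{r,\gamma,\sigma}(\mathbb{R}^2)\longrightarrow H^{s-2}_{r,\gamma,\sigma+2}(\mathbb{R}^2),\qquad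 (\Delta_1-\mathrm{Id})u=\partial_{rr}u+\frac1r\,\partial_r u-\frac1{r^2}\,u-u,$$ is well defined, bounded and invertible: it is a linear bijection with a bounded inverse. -/

import Mathlib

open MeasureTheory
open scoped ContDiff ENNReal

noncomputable section

namespace DoublyWeighted

/-- The plane `ℝ²` with its Euclidean norm. -/
abbrev Plane : Type := EuclideanSpace ℝ (Fin 2)

/-- A smooth radial cut-off function on the plane, vanishing for `|x| < 1` and equal to one
for `|x| > 2`. -/
structure IsCutoff (χ : Plane → ℝ) : Prop where
  smooth : ContDiff ℝ ∞ χ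
  radial : ∀ x y : Plane, ‖x‖ = ‖y‖ → χ x = χ y
  mem_Icc : ∀ x : Plane, χ x ∈ Set.Icc (0 : ℝ) 1
  eq_zero : ∀ x : Plane, ‖x‖ < 1 → χ x = 0
  eq_one : ∀ x : Plane, 2 < ‖x‖ → χ x = 1

/-- The weight `m(x) = |x| (1 - χ(x)) + χ(x)`: it is `|x|` in the unit ball and `1` for
`|x| > 2`. -/
def m (χ : Plane → ℝ) (x : Plane) : ℝ := ‖x‖ * (1 - χ x) + χ x

/-- The bracket `⟨x⟩ = (1 + |x|²)^{1/2}`. -/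
def bracket (x : Plane) : ℝ := Real.sqrt (1 + ‖x‖ ^ 2)

/-- The measure `(m(x)^τ ⟨x⟩^γ)² dx`. The norm of `f` in `Lp ℝ 2 (weighted χ γ τ)` is the
`L²(ℝ²)` norm of `m(x)^τ f(x) ⟨x⟩^γ`. -/
def weighted (χ : Plane → ℝ) (γ τ : ℝ) : Measure Plane :=
  (volume : Measure Plane).withDensity
    fun x => ENNReal.ofReal ((m χ x ^ τ * bracket x ^ γ) ^ 2)

/-- The multi-indices `α = (α₁, α₂)` with `|α| = α₁ + α₂ ≤ s`. -/
abbrev MultiIndex (s : ℕ) : Type := {α : ℕ × ℕ // α.1 + α.2 ≤ s}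

instance (s : ℕ) : Fintype (MultiIndex s) :=
  Fintype.subtype
    ((Finset.range (s + 1) ×ˢ Finset.range (s + 1)).filter fun α => α.1 + α.2 ≤ s) (by
      intro α
      simp only [Finset.mem_filter, Finset.mem_product, Finset.mem_range]
      omega)

/-- The order `|α|`. -/
def MultiIndex.order {s : ℕ} (α : MultiIndex s) : ℕ := α.1.1 + α.1.2

/-- The `i`-th partial derivative of a function on the plane. -/
def pderiv (i : Fin 2) (φ : Plane → ℝ) : Plane → ℝ :=
  fun x => fderiv ℝ φ x (EuclideanSpace.single i 1)

/-- The classical derivative `D^α φ = ∂₁^{α₁} ∂₂^{α₂} φ`. -/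
def multiDeriv (α : ℕ × ℕ) (φ : Plane → ℝ) : Plane → ℝ :=
  (pderiv 0)^[α.1] ((pderiv 1)^[α.2] φ)

theorem pderiv_smooth (i : Fin 2) {φ : Plane → ℝ} (h : ContDiff ℝ ∞ φ) :
    ContDiff ℝ ∞ (pderiv i φ) :=
  (h.fderiv_right (m := ∞) le_rfl).clm_apply contDiff_const

theorem iter_smooth (i : Fin 2) (n : ℕ) {φ : Plane → ℝ} (h : ContDiff ℝ ∞ φ) :
    ContDiff ℝ ∞ ((pderiv i)^[n] φ) := by
  induction n generalizing φ with
  | zero => exact h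
  | succ n ih => exact ih (pderiv_smooth i h)

theorem pderiv_add (i : Fin 2) {φ ψ : Plane → ℝ} (h : ContDiff ℝ ∞ φ) (k : ContDiff ℝ ∞ ψ) :
    pderiv i (φ + ψ) = pderiv i φ + pderiv i ψ := by
  funext x
  have h1 := (h.differentiable (by simp)) x
  have k1 := (k.differentiable (by simp)) x
  simp [pderiv, fderiv_add h1 k1]

theorem pderiv_smul (i : Fin 2) (c : ℝ) {φ : Plane → ℝ} (h : ContDiff ℝ ∞ φ) :
    pderiv i (c • φ) = c • pderiv i φ := by
  funext x
  have h1 := (h.differentiable (by simp)) x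
  simp [pderiv, fderiv_const_smul h1 c]

theorem iter_add (i : Fin 2) (n : ℕ) {φ ψ : Plane → ℝ} (h : ContDiff ℝ ∞ φ)
    (k : ContDiff ℝ ∞ ψ) :
    (pderiv i)^[n] (φ + ψ) = (pderiv i)^[n] φ + (pderiv i)^[n] ψ := by
  induction n generalizing φ ψ with
  | zero => rfl
  | succ n ih =>
    simp only [Function.iterate_succ, Function.comp_apply]
    rw [pderiv_add i h k, ih (pderiv_smooth i h) (pderiv_smooth i k)]

theorem iter_smul (i : Fin 2) (n : ℕ) (c : ℝ) {φ : Plane → ℝ} (h : ContDiff ℝ ∞ φ) :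
    (pderiv i)^[n] (c • φ) = c • (pderiv i)^[n] φ := by
  induction n generalizing φ with
  | zero => rfl
  | succ n ih =>
    simp only [Function.iterate_succ, Function.comp_apply]
    rw [pderiv_smul i c h, ih (pderiv_smooth i h)]

theorem multiDeriv_add (α : ℕ × ℕ) {φ ψ : Plane → ℝ} (h : ContDiff ℝ ∞ φ)
    (k : ContDiff ℝ ∞ ψ) :
    multiDeriv α (φ + ψ) = multiDeriv α φ + multiDeriv α ψ := by
  unfold multiDeriv
  rw [iter_add 1 _ h k, iter_add 0 _ (iter_smooth 1 _ h) (iter_smooth 1 _ k)]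

theorem multiDeriv_smul (α : ℕ × ℕ) (c : ℝ) {φ : Plane → ℝ} (h : ContDiff ℝ ∞ φ) :
    multiDeriv α (c • φ) = c • multiDeriv α φ := by
  unfold multiDeriv
  rw [iter_smul 1 _ c h, iter_smul 0 _ c (iter_smooth 1 _ h)]

/-- Families `(u_α)_{|α| ≤ s}` of functions with `m^{σ+|α|} u_α ⟨x⟩^γ ∈ L²(ℝ²)`, normed by
`∑_{|α| ≤ s} ‖m^{σ+|α|} u_α ⟨x⟩^γ‖_{L²(ℝ²)}`. -/
abbrev Jets (χ : Plane → ℝ) (s : ℕ) (γ σ : ℝ) : Type :=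
  PiLp 1 fun α : MultiIndex s => Lp ℝ 2 (weighted χ γ (σ + (α.order : ℝ)))

/-- The families `(D^α φ)_{|α| ≤ s}` of the real-valued `φ ∈ C₀^∞(ℝ²)` whose doubly weighted
norm is finite. -/
def testJets (χ : Plane → ℝ) (s : ℕ) (γ σ : ℝ) : Submodule ℝ (Jets χ s γ σ) where
  carrier := {U | ∃ φ : Plane → ℝ, ContDiff ℝ ∞ φ ∧ HasCompactSupport φ ∧
    ∀ α : MultiIndex s,
      (U α : Plane → ℝ) =ᵐ[weighted χ γ (σ + (α.order : ℝ))] multiDeriv α.1 φ}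
  add_mem' := by
    rintro U V ⟨φ, hφ, cφ, hU⟩ ⟨ψ, hψ, cψ, hV⟩
    refine ⟨φ + ψ, hφ.add hψ, cφ.add cψ, fun α => ?_⟩
    rw [multiDeriv_add _ hφ hψ]
    exact (Lp.coeFn_add (U α) (V α)).trans ((hU α).add (hV α))
  zero_mem' := by
    refine ⟨0, contDiff_const, HasCompactSupport.zero, fun α => ?_⟩
    have h0 : multiDeriv α.1 (0 : Plane → ℝ) = 0 := by
      have := multiDeriv_smul α.1 0 (φ := (0 : Plane → ℝ)) contDiff_const
      simpa using this
    rw [h0]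
    exact Lp.coeFn_zero _ _ _
  smul_mem' := by
    rintro c U ⟨φ, hφ, cφ, hU⟩
    refine ⟨c • φ, contDiff_const.smul hφ, cφ.smul_left (f := fun _ => c), fun α => ?_⟩
    rw [multiDeriv_smul _ c hφ]
    exact (Lp.coeFn_smul c (U α)).trans ((hU α).const_smul c)

/-- The doubly weighted Sobolev space `H^s_{γ,σ}(ℝ²)`: the completion of `C₀^∞(ℝ²)` in the
norm `∑_{|α| ≤ s} ‖m^{σ+|α|} D^α u ⟨x⟩^γ‖_{L²(ℝ²)}`, realized as a closure in the Banach space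
`Jets`. A function `u` of the space is stored together with its derivatives `D^α u`. -/
def H (χ : Plane → ℝ) (s : ℕ) (γ σ : ℝ) : Submodule ℝ (Jets χ s γ σ) :=
  (testJets χ s γ σ).topologicalClosure

/-- The derivative `∂₁^a ∂₂^b u`; in particular `wderiv U 0 0` is the function `u` itself. -/
def wderiv {χ : Plane → ℝ} {s : ℕ} {γ σ : ℝ} (U : Jets χ s γ σ) (a b : ℕ) (h : a + b ≤ s) :
    Plane → ℝ :=
  (U ⟨(a, b), h⟩ : Plane → ℝ)

/-- The function `u` underlying an element of the space. -/
def toFun {χ : Plane → ℝ} {s : ℕ} {γ σ : ℝ} (U : Jets χ s γ σ) : Plane → ℝ :=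
  wderiv U 0 0 (Nat.zero_le s)

/-- The subspace `H^s_{r,γ,σ}(ℝ²)` of the radially symmetric functions `u(x) = v(|x|)` in
`H^s_{γ,σ}(ℝ²)`, with the same norm. -/
def Hr (χ : Plane → ℝ) (s : ℕ) (γ σ : ℝ) : Submodule ℝ (Jets χ s γ σ) where
  carrier := {U | U ∈ H χ s γ σ ∧
    ∃ v : ℝ → ℝ, toFun U =ᵐ[weighted χ γ (σ + ((0 : ℕ) : ℝ))] fun x => v ‖x‖}
  add_mem' := by
    rintro U V ⟨hU, v, hv⟩ ⟨hV, w, hw⟩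
    exact ⟨add_mem hU hV, fun r => v r + w r, (Lp.coeFn_add _ _).trans (hv.add hw)⟩
  zero_mem' := ⟨zero_mem _, fun _ => 0, Lp.coeFn_zero _ _ _⟩
  smul_mem' := by
    rintro c U ⟨hU, v, hv⟩
    exact ⟨Submodule.smul_mem _ c hU, fun r => c * v r,
      (Lp.coeFn_smul c _).trans (hv.const_smul c)⟩

/-- The radial derivative `∂_r u = ∑ᵢ (xᵢ/r) ∂ᵢ u`, with `r = |x|`. -/
def dr {χ : Plane → ℝ} {s : ℕ} {γ σ : ℝ} (hs : 2 ≤ s) (U : Jets χ s γ σ) (x : Plane) : ℝ :=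
  (x 0 / ‖x‖) * wderiv U 1 0 (by omega) x + (x 1 / ‖x‖) * wderiv U 0 1 (by omega) x

/-- The second radial derivative `∂_rr u = ∑ᵢⱼ (xᵢ xⱼ/r²) ∂ᵢ ∂ⱼ u`, with `r = |x|`. -/
def drr {χ : Plane → ℝ} {s : ℕ} {γ σ : ℝ} (hs : 2 ≤ s) (U : Jets χ s γ σ) (x : Plane) : ℝ :=
  (x 0 ^ 2 / ‖x‖ ^ 2) * wderiv U 2 0 (by omega) x
    + 2 * (x 0 * x 1 / ‖x‖ ^ 2) * wderiv U 1 1 (by omega) x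
    + (x 1 ^ 2 / ‖x‖ ^ 2) * wderiv U 0 2 (by omega) x

/-- The function `(Δ₁ - Id) u = ∂_rr u + (1/r) ∂_r u - (1/r²) u - u`, with `r = |x|`. -/
def deltaOneSubId {χ : Plane → ℝ} {s : ℕ} {γ σ : ℝ} (hs : 2 ≤ s) (U : Jets χ s γ σ)
    (x : Plane) : ℝ :=
  drr hs U x + (1 / ‖x‖) * dr hs U x - (1 / ‖x‖ ^ 2) * toFun U x - toFun U x

end DoublyWeighted

end

open scoped NNReal

noncomputable section

namespace DoublyWeighted

/-! For a radial function u(x) = V(log |x|), the substitution t = log r turns Δ₁ - Id into `bessel`,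
V ↦ e^{-2t}(V'' - V) - V, and the doubly weighted norm becomes equivalent to `sobNorm`, a sum of
weighted L²(dt) norms of the derivatives of V. In these terms boundedness (`sobNorm_bessel_le`) is
the Leibniz rule together with M ≤ r and M ≤ 2, and it holds for every σ.

Invertibility rests on an energy estimate and on explicit solutions. The equation `bessel V = F`
reads V'' - wV = e^{2t}F with w = 1 + e^{2t}. Testing it with p²V, where p is comparable to
M^{σ+1}⟨r⟩^γ, gives a coercive form as soon as (p'/p)² ≤ (1-c)w for some c > 0 (`weighted_energy`).
Near the origin p'/p tends to σ+1 and w tends to 1, so the condition there is |σ+1| < 1, that is σ ∈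
(-2,0) (`nrm_le_bessel`). Higher derivatives follow by solving the equation for V''
(`sobNorm_le_bessel`). For a test function F, variation of constants with multiples of I₁(e^t) and
K₁(e^t) yields a solution that is O(r) at the origin and decays faster than any power at infinity
(`exists_bessel_eq`). It has finite norm and is a limit of its truncations
(`exists_tendsto_sobNorm`), so the operator has dense range on compactly supported V.

To return to the plane, derivatives of V(log |x|) are bounded by those of V
(`exists_multiDeriv_lift_le`). Conversely, the circle mean of any test function is controlled by the
norm of that function (`sobNorm_circMean_le`), because ∂_t acts on circle means through the Euler
operator x·∇. Together with truncation this shows that the lifts of compactly supported V are dense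
in `Hr` (`Hr_le_closure_radJets`); the limit is identified by its underlying function, which
determines all the derivatives stored with it (`eq_zero_of_toFun_eq_zero`).

Finally, the pairs formed by a lift and its image span `besselGraph`, on which the two norms control
each other. Its closure is therefore the graph of a continuous linear equivalence between the
closures of the two projections (`exists_equiv_of_graph`), and these closures are the two radial
spaces. The differential expression survives the closure by almost everywhere convergence along a
subsequence (`toFun_ae_eq_deltaOneSubId`). -/

theorem contDiffAt_of_contDiff_infty {V : ℝ → ℝ} (hV : ContDiff ℝ ∞ V) (k : ℕ) (t : ℝ) :
    ContDiffAt ℝ k V t :=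
  hV.contDiffAt.of_le (by exact_mod_cast le_top)

/-- Minkowski's inequality: this reduces the comparison of weighted norms to pointwise inequalities
between integrands. -/
theorem eLpNorm_le_mul_sum {α ι : Type*} [MeasurableSpace α] {μ : Measure α} (S : Finset ι)
    (C : ℝ≥0) {F : α → ℝ} {G : ι → α → ℝ} (hG : ∀ i ∈ S, AEStronglyMeasurable (G i) μ)
    (h : ∀ᵐ x ∂μ, |F x| ≤ C * ∑ i ∈ S, |G i x|) :
    eLpNorm F 2 μ ≤ C * ∑ i ∈ S, eLpNorm (G i) 2 μ := by
  have h1 : eLpNorm F 2 μ ≤ ENNReal.ofReal C * eLpNorm (∑ i ∈ S, fun x => |G i x|) 2 μ := by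
    refine eLpNorm_le_mul_eLpNorm_of_ae_le_mul ?_ 2
    filter_upwards [h] with x hx
    rw [Real.norm_eq_abs, Real.norm_eq_abs, Finset.sum_apply]
    exact hx.trans (mul_le_mul_of_nonneg_left (le_abs_self _) C.2)
  refine h1.trans ?_
  rw [ENNReal.ofReal_coe_nnreal]
  gcongr
  refine (eLpNorm_sum_le (fun i hi => ?_) (by norm_num)).trans ?_
  · exact (hG i hi).norm
  · exact Finset.sum_le_sum fun i hi => (eLpNorm_norm (G i)).le

/-! ### Weights and Sobolev norms in the variable t = log r -/

/-- The properties of the weight `m` in the variable `t = log r`. -/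
structure LogWeight (M : ℝ → ℝ) : Prop where
  meas : Measurable M
  le_exp : ∀ t, M t ≤ Real.exp t
  le_two : ∀ t, M t ≤ 2
  min_le : ∀ t, min 1 (Real.exp t) ≤ M t

theorem LogWeight.pos {M : ℝ → ℝ} (hM : LogWeight M) (t : ℝ) : 0 < M t :=
  lt_of_lt_of_le (lt_min one_pos (Real.exp_pos t)) (hM.min_le t)

/-- The full weight `M^τ ⟨r⟩^γ r` in the variable `t = log r`. -/
def wt (M : ℝ → ℝ) (γ τ t : ℝ) : ℝ := M t ^ τ * Real.sqrt (1 + Real.exp t ^ 2) ^ γ * Real.exp t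

theorem wt_pos {M : ℝ → ℝ} (hM : LogWeight M) (γ τ t : ℝ) : 0 < wt M γ τ t := by
  have := hM.pos t
  unfold wt
  positivity

theorem wt_measurable {M : ℝ → ℝ} (hM : LogWeight M) (γ τ : ℝ) : Measurable (wt M γ τ) := by
  have := hM.meas
  unfold wt
  fun_prop

/-- The weighted `L²` norm in the variable `t = log r`. -/
def nrm (M : ℝ → ℝ) (γ τ : ℝ) (f : ℝ → ℝ) : ℝ≥0∞ :=
  eLpNorm (fun t => wt M γ τ t * f t) 2 volume

/-- The factors ⟨r⟩^γ and r are common to both sides, so only the powers of M have to be compared.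
-/
theorem nrm_le_mul_sum {M : ℝ → ℝ} (hM : LogWeight M) {γ τ : ℝ} {ι : Type*} (S : Finset ι)
    (C : ℝ≥0) {f : ℝ → ℝ} {g : ι → ℝ → ℝ} {τ' : ι → ℝ} (hg : ∀ i ∈ S, Measurable (g i))
    (h : ∀ t, M t ^ τ * |f t| ≤ C * ∑ i ∈ S, M t ^ τ' i * |g i t|) :
    nrm M γ τ f ≤ C * ∑ i ∈ S, nrm M γ (τ' i) (g i) := by
  refine eLpNorm_le_mul_sum S C
    (fun i hi => ((wt_measurable hM γ (τ' i)).mul (hg i hi)).aestronglyMeasurable)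
    (Filter.Eventually.of_forall fun t => ?_)
  have hb : 0 ≤ Real.sqrt (1 + Real.exp t ^ 2) ^ γ * Real.exp t := by positivity
  have e : ∀ (κ y : ℝ), |wt M γ κ t * y|
      = (M t ^ κ * |y|) * (Real.sqrt (1 + Real.exp t ^ 2) ^ γ * Real.exp t) := by
    intro κ y
    rw [abs_mul, abs_of_pos (wt_pos hM γ κ t), wt]
    ring
  simp only [e]
  rw [← Finset.sum_mul, ← mul_assoc (C : ℝ)]
  exact mul_le_mul_of_nonneg_right (h t) hb

theorem nrm_add_le {M : ℝ → ℝ} (hM : LogWeight M) {γ τ : ℝ} {f g : ℝ → ℝ} (hf : Measurable f)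
    (hg : Measurable g) : nrm M γ τ (fun t => f t + g t) ≤ nrm M γ τ f + nrm M γ τ g := by
  have := nrm_le_mul_sum hM (γ := γ) (τ := τ) Finset.univ 1 (f := fun t => f t + g t)
    (g := ![f, g]) (τ' := fun _ => τ) (by simp [Fin.forall_fin_two, hf, hg]) (fun t => by
      have := Real.rpow_nonneg (hM.pos t).le τ
      simp only [NNReal.coe_one, one_mul, Fin.sum_univ_two, Matrix.cons_val_zero,
        Matrix.cons_val_one, ← mul_add]
      exact mul_le_mul_of_nonneg_left (abs_add_le _ _) this)
  simpa [Fin.sum_univ_two] using this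

/-- The norm `∑_{k ≤ s} ‖M^{σ+k} r^{-k} ∂_t^k V‖`, equivalent to the doubly weighted Sobolev
norm of `V(log |x|)`. -/
def sobNorm (M : ℝ → ℝ) (γ : ℝ) (s : ℕ) (σ : ℝ) (V : ℝ → ℝ) : ℝ≥0∞ :=
  ∑ k ∈ Finset.range (s + 1),
    nrm M γ (σ + k) (fun t => Real.exp (-(k * t)) * iteratedDeriv k V t)

theorem iteratedDeriv_measurable {V : ℝ → ℝ} (hV : ContDiff ℝ ∞ V) (k : ℕ) :
    Measurable (iteratedDeriv k V) :=
  (hV.continuous_iteratedDeriv k (by exact_mod_cast le_top)).measurable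

theorem sobTerm_measurable {V : ℝ → ℝ} (hV : ContDiff ℝ ∞ V) (k : ℕ) :
    Measurable fun t => Real.exp (-(k * t)) * iteratedDeriv k V t := by
  have := iteratedDeriv_measurable hV k
  fun_prop

theorem nrm_le_sobNorm {M : ℝ → ℝ} {γ σ : ℝ} {s k : ℕ} (hk : k ≤ s) (V : ℝ → ℝ) :
    nrm M γ (σ + k) (fun t => Real.exp (-(k * t)) * iteratedDeriv k V t)
      ≤ sobNorm M γ s σ V :=
  Finset.single_le_sum
    (f := fun k : ℕ => nrm M γ (σ + k) (fun t => Real.exp (-(k * t)) * iteratedDeriv k V t))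
    (fun _ _ => bot_le) (Finset.mem_range.2 (by omega))

theorem sobNorm_add_le {M : ℝ → ℝ} (hM : LogWeight M) {γ σ : ℝ} {s : ℕ} {V W : ℝ → ℝ}
    (hV : ContDiff ℝ ∞ V) (hW : ContDiff ℝ ∞ W) :
    sobNorm M γ s σ (V + W) ≤ sobNorm M γ s σ V + sobNorm M γ s σ W := by
  unfold sobNorm
  rw [← Finset.sum_add_distrib]
  refine Finset.sum_le_sum fun k _ => ?_
  refine le_trans (le_of_eq ?_)
    (nrm_add_le hM (sobTerm_measurable hV k) (sobTerm_measurable hW k))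
  congr 1
  funext t
  rw [iteratedDeriv_add (hV.contDiffAt.of_le (by exact_mod_cast le_top))
    (hW.contDiffAt.of_le (by exact_mod_cast le_top))]
  ring

theorem sobNorm_neg {M : ℝ → ℝ} {γ σ : ℝ} {s : ℕ} (V : ℝ → ℝ) :
    sobNorm M γ s σ (-V) = sobNorm M γ s σ V := by
  unfold sobNorm nrm
  refine Finset.sum_congr rfl fun k _ => ?_
  rw [← eLpNorm_neg]
  congr 1
  funext t
  simp [iteratedDeriv_neg]

/-- `M^{τ+k} r^{-k}` decreases in `k`, as `M ≤ r`. -/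
theorem LogWeight.shift_le {M : ℝ → ℝ} (hM : LogWeight M) (τ t : ℝ) {j k : ℕ} (h : j ≤ k) :
    M t ^ (τ + k) * Real.exp (-(k * t)) ≤ M t ^ (τ + j) * Real.exp (-(j * t)) := by
  have hp := hM.pos t
  obtain ⟨d, rfl⟩ := Nat.exists_eq_add_of_le h
  have e1 : M t ^ (τ + ((j + d : ℕ) : ℝ)) = M t ^ (τ + j) * M t ^ d := by
    rw [Nat.cast_add, ← add_assoc, Real.rpow_add hp, Real.rpow_natCast]
  have e2 : Real.exp (-(((j + d : ℕ) : ℝ) * t)) = Real.exp (-(j * t)) * (Real.exp t ^ d)⁻¹ := by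
    rw [← Real.exp_nat_mul, ← Real.exp_neg, ← Real.exp_add]
    congr 1; push_cast; ring
  rw [e1, e2]
  have h3 : M t ^ d * (Real.exp t ^ d)⁻¹ ≤ 1 := by
    rw [← div_eq_mul_inv, div_le_one (by positivity)]
    exact pow_le_pow_left₀ hp.le (hM.le_exp t) d
  calc M t ^ (τ + j) * M t ^ d * (Real.exp (-(j * t)) * (Real.exp t ^ d)⁻¹)
      = M t ^ (τ + j) * Real.exp (-(j * t)) * (M t ^ d * (Real.exp t ^ d)⁻¹) := by ring
    _ ≤ M t ^ (τ + j) * Real.exp (-(j * t)) * 1 := by gcongr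
    _ = _ := mul_one _

/-- Because 0 < M ≤ 2, two surplus powers of M cost a factor 4. This absorbs the zeroth-order term
-u, which carries no r^{-2} to pair with them. -/
theorem LogWeight.add_two_le {M : ℝ → ℝ} (hM : LogWeight M) (τ t : ℝ) :
    M t ^ (τ + 2) ≤ 4 * M t ^ τ := by
  have hp := hM.pos t
  rw [Real.rpow_add hp, mul_comm]
  gcongr
  have : M t ^ (2 : ℝ) = M t ^ 2 := by exact_mod_cast Real.rpow_natCast (M t) 2
  rw [this]
  nlinarith [hM.le_two t]

/-- Leibniz bound for the product with an exponential. -/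
theorem exists_abs_iteratedDeriv_exp_mul_le (k : ℕ) (c : ℝ) :
    ∃ C : ℝ≥0, ∀ f : ℝ → ℝ, ContDiff ℝ ∞ f → ∀ t,
      |iteratedDeriv k (fun t => Real.exp (c * t) * f t) t|
        ≤ C * Real.exp (c * t) * ∑ j ∈ Finset.range (k + 1), |iteratedDeriv j f t| := by
  refine ⟨∑ j ∈ Finset.range (k + 1), (k.choose j : ℝ≥0) * ‖c‖₊ ^ j, fun f hf t => ?_⟩
  have he : ContDiff ℝ ∞ fun t : ℝ => Real.exp (c * t) := by fun_prop
  rw [iteratedDeriv_fun_mul (he.contDiffAt.of_le (by exact_mod_cast le_top))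
    (hf.contDiffAt.of_le (by exact_mod_cast le_top))]
  refine (Finset.abs_sum_le_sum_abs _ _).trans ?_
  push_cast
  rw [Finset.sum_mul, Finset.sum_mul]
  refine Finset.sum_le_sum fun j hj => ?_
  rw [iteratedDeriv_exp_const_mul, abs_mul, abs_mul, abs_mul, Nat.abs_cast, abs_pow, Real.abs_exp,
    Real.norm_eq_abs, ← mul_assoc]
  gcongr
  exact Finset.single_le_sum (f := fun j => |iteratedDeriv j f t|) (fun _ _ => abs_nonneg _)
    (Finset.mem_range.2 (by omega))

/-! ### The operator in the variable t and its boundedness -/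

/-- The operator `Δ₁ - 1` in the variable `t = log r`. -/
def bessel (V : ℝ → ℝ) (t : ℝ) : ℝ :=
  Real.exp (-2 * t) * (iteratedDeriv 2 V t - V t) - V t

theorem contDiff_iteratedDeriv_infty {V : ℝ → ℝ} (hV : ContDiff ℝ ∞ V) (k : ℕ) :
    ContDiff ℝ ∞ (iteratedDeriv k V) := by
  induction k with
  | zero => simpa using hV
  | succ k ih => rw [iteratedDeriv_succ]; exact (contDiff_infty_iff_deriv.1 ih).2

theorem iteratedDeriv_iteratedDeriv (V : ℝ → ℝ) (k j : ℕ) :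
    iteratedDeriv k (iteratedDeriv j V) = iteratedDeriv (k + j) V := by
  simp only [iteratedDeriv_eq_iterate, Function.iterate_add_apply]

theorem bessel_contDiff {V : ℝ → ℝ} (hV : ContDiff ℝ ∞ V) : ContDiff ℝ ∞ (bessel V) := by
  have := contDiff_iteratedDeriv_infty hV 2
  unfold bessel
  fun_prop

theorem bessel_add {V W : ℝ → ℝ} (hV : ContDiff ℝ ∞ V) (hW : ContDiff ℝ ∞ W) :
    bessel (V + W) = bessel V + bessel W := by
  funext t
  simp only [bessel, Pi.add_apply]
  rw [iteratedDeriv_add (contDiffAt_of_contDiff_infty hV 2 t)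
    (contDiffAt_of_contDiff_infty hW 2 t)]
  ring

theorem bessel_neg (V : ℝ → ℝ) : bessel (-V) = -bessel V := by
  funext t
  simp only [bessel, Pi.neg_apply, iteratedDeriv_neg]
  ring

theorem iteratedDeriv_hasCompactSupport {V : ℝ → ℝ} (hV : HasCompactSupport V) (k : ℕ) :
    HasCompactSupport (iteratedDeriv k V) := by
  induction k with
  | zero => simpa using hV
  | succ k ih => rw [iteratedDeriv_succ]; exact ih.deriv

theorem bessel_hasCompactSupport {V : ℝ → ℝ} (cV : HasCompactSupport V) :
    HasCompactSupport (bessel V) := by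
  have h2 := iteratedDeriv_hasCompactSupport cV 2
  exact ((h2.sub cV).mul_left (f := fun t => Real.exp (-2 * t))).sub cV

/-- In the k-th derivative, e^{-2t} times the outer factor e^{-kt} is e^{-(k+2)t}, which together
with M^{σ+2+k} is the weight of order k+2. By `shift_le` this weight is dominated by every weight of
lower order, so all Leibniz terms are covered. The term -V is handled by `add_two_le`. -/
theorem sobNorm_bessel_le {M : ℝ → ℝ} (hM : LogWeight M) (γ σ : ℝ) (s : ℕ) :
    ∃ C : ℝ≥0, ∀ V : ℝ → ℝ, ContDiff ℝ ∞ V →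
      sobNorm M γ s (σ + 2) (bessel V) ≤ C * sobNorm M γ (s + 2) σ V := by
  have key : ∀ k ≤ s, ∃ C : ℝ≥0, ∀ V : ℝ → ℝ, ContDiff ℝ ∞ V →
      nrm M γ (σ + 2 + k) (fun t => Real.exp (-(k * t)) * iteratedDeriv k (bessel V) t)
        ≤ C * sobNorm M γ (s + 2) σ V := by
    intro k hk
    obtain ⟨C, hC⟩ := exists_abs_iteratedDeriv_exp_mul_le k (-2)
    -- The Leibniz constant counts twice, for V'' and for V inside the bracket; the 4 comes from
    -- `add_two_le`.
    refine ⟨2 * C + 4, fun V hV => ?_⟩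
    have h1 := nrm_le_mul_sum hM (γ := γ) (τ := σ + 2 + k) (Finset.range (s + 2 + 1)) (2 * C + 4)
      (f := fun t => Real.exp (-(k * t)) * iteratedDeriv k (bessel V) t)
      (g := fun j t => Real.exp (-(j * t)) * iteratedDeriv j V t) (τ' := fun j => σ + j)
      (fun j _ => sobTerm_measurable hV j) (fun t => ?_)
    · exact h1
    have hp := hM.pos t
    set A : ℕ → ℝ := fun j => M t ^ (σ + j) * |Real.exp (-(j * t)) * iteratedDeriv j V t| with hA
    have hA0 : ∀ j, 0 ≤ A j := fun j => by positivity
    have hAS : ∀ j ≤ s + 2, A j ≤ ∑ j ∈ Finset.range (s + 2 + 1), A j := fun j hj =>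
      Finset.single_le_sum (fun i _ => hA0 i) (Finset.mem_range.2 (by omega))
    have hdiff : ContDiff ℝ ∞ fun t => iteratedDeriv 2 V t - V t :=
      (contDiff_iteratedDeriv_infty hV 2).sub hV
    have e0 : iteratedDeriv k (bessel V) t
        = iteratedDeriv k (fun t => Real.exp (-2 * t) * (iteratedDeriv 2 V t - V t)) t
          - iteratedDeriv k V t := by
      have : bessel V = (fun t => Real.exp (-2 * t) * (iteratedDeriv 2 V t - V t)) - V := rfl
      rw [this, iteratedDeriv_sub]
      · exact contDiffAt_of_contDiff_infty (by fun_prop) k t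
      · exact hV.contDiffAt.of_le (by exact_mod_cast le_top)
    have e1 : ∀ j ≤ k, |iteratedDeriv j (fun t => iteratedDeriv 2 V t - V t) t|
        ≤ |iteratedDeriv (j + 2) V t| + |iteratedDeriv j V t| := by
      intro j _
      have : iteratedDeriv j (fun t => iteratedDeriv 2 V t - V t) t
          = iteratedDeriv (j + 2) V t - iteratedDeriv j V t := by
        rw [← iteratedDeriv_iteratedDeriv V j 2]
        exact iteratedDeriv_sub
          ((contDiff_iteratedDeriv_infty hV 2).contDiffAt.of_le (by exact_mod_cast le_top))
          (hV.contDiffAt.of_le (by exact_mod_cast le_top))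
      rw [this]
      exact abs_sub _ _
    have e2 : |iteratedDeriv k (bessel V) t| ≤ C * Real.exp (-2 * t)
        * ∑ j ∈ Finset.range (k + 1), (|iteratedDeriv (j + 2) V t| + |iteratedDeriv j V t|)
        + |iteratedDeriv k V t| := by
      rw [e0]
      refine (abs_sub _ _).trans (add_le_add ((hC _ hdiff t).trans ?_) le_rfl)
      gcongr with j hj
      exact e1 j (by simpa [Nat.lt_succ_iff] using hj)
    have e3 : ∀ j ≤ k + 2, M t ^ (σ + 2 + k) * Real.exp (-(k * t)) * Real.exp (-2 * t)
        * |iteratedDeriv j V t| ≤ A j := by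
      intro j hj
      have h := hM.shift_le σ t hj
      have : Real.exp (-(k * t)) * Real.exp (-2 * t) = Real.exp (-(((k + 2 : ℕ) : ℝ) * t)) := by
        rw [← Real.exp_add]; congr 1; push_cast; ring
      rw [mul_assoc (M t ^ _), this, hA]
      simp only
      rw [abs_mul, Real.abs_exp, ← mul_assoc]
      refine mul_le_mul_of_nonneg_right (le_trans (le_of_eq ?_) h) (abs_nonneg _)
      congr 2; push_cast; ring
    have e4 : M t ^ (σ + 2 + k) * Real.exp (-(k * t)) * |iteratedDeriv k V t| ≤ 4 * A k := by
      have h := hM.add_two_le (σ + k) t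
      rw [hA]
      simp only
      rw [abs_mul, Real.abs_exp, ← mul_assoc, ← mul_assoc]
      gcongr
      refine le_trans (le_of_eq ?_) h
      congr 1; ring
    rw [abs_mul, Real.abs_exp, ← mul_assoc]
    calc M t ^ (σ + 2 + k) * Real.exp (-(k * t)) * |iteratedDeriv k (bessel V) t|
        ≤ M t ^ (σ + 2 + k) * Real.exp (-(k * t)) * (C * Real.exp (-2 * t)
          * ∑ j ∈ Finset.range (k + 1), (|iteratedDeriv (j + 2) V t| + |iteratedDeriv j V t|)
          + |iteratedDeriv k V t|) := by gcongr
      _ = C * (∑ j ∈ Finset.range (k + 1), M t ^ (σ + 2 + k) * Real.exp (-(k * t))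
            * Real.exp (-2 * t) * |iteratedDeriv (j + 2) V t|
          + ∑ j ∈ Finset.range (k + 1), M t ^ (σ + 2 + k) * Real.exp (-(k * t))
            * Real.exp (-2 * t) * |iteratedDeriv j V t|)
          + M t ^ (σ + 2 + k) * Real.exp (-(k * t)) * |iteratedDeriv k V t| := by
          rw [← Finset.mul_sum, ← Finset.mul_sum, Finset.sum_add_distrib]; ring
      _ ≤ C * (∑ j ∈ Finset.range (s + 2 + 1), A j + ∑ j ∈ Finset.range (s + 2 + 1), A j)
          + 4 * ∑ j ∈ Finset.range (s + 2 + 1), A j := by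
          refine add_le_add (mul_le_mul_of_nonneg_left (add_le_add ?_ ?_) C.2) ?_
          · calc _ ≤ ∑ j ∈ Finset.range (k + 1), A (j + 2) :=
                  Finset.sum_le_sum fun j hj => e3 _ (by have := Finset.mem_range.1 hj; omega)
              _ = ∑ j ∈ Finset.Ico 2 (k + 1 + 2), A j := by
                  rw [Finset.sum_Ico_eq_sum_range]
                  exact Finset.sum_congr (by simp) fun j _ => by rw [add_comm]
              _ ≤ _ := Finset.sum_le_sum_of_subset_of_nonneg
                  (fun j hj => by
                    have := Finset.mem_Ico.1 hj
                    exact Finset.mem_range.2 (by omega)) fun j _ _ => hA0 j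
          · exact (Finset.sum_le_sum fun j hj =>
              e3 _ (by have := Finset.mem_range.1 hj; omega)).trans
              (Finset.sum_le_sum_of_subset_of_nonneg
                (fun j hj => by
                  have := Finset.mem_range.1 hj
                  exact Finset.mem_range.2 (by omega)) fun j _ _ => hA0 j)
          · exact e4.trans (by gcongr; exact hAS k (by omega))
      _ = _ := by push_cast; ring
  choose! C hC using key
  refine ⟨∑ k ∈ Finset.range (s + 1), C k, fun V hV => ?_⟩
  push_cast
  rw [Finset.sum_mul]
  exact Finset.sum_le_sum fun k hk =>
    hC k (by simpa [Nat.lt_succ_iff] using hk) V hV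

/-! ### The a priori estimate -/

/-- The sign of τ decides which of the two comparison bounds is used; both are needed because the
exponents σ+1 and γ may have either sign. -/
theorem rpow_le_mul_rpow {x y K : ℝ} (hx : 0 < x) (hy : 0 < y) (hK : 0 < K) (h1 : x ≤ K * y)
    (h2 : y ≤ K * x) (τ : ℝ) : x ^ τ ≤ K ^ |τ| * y ^ τ := by
  rcases le_total 0 τ with h | h
  · rw [abs_of_nonneg h, ← Real.mul_rpow hK.le hy.le]
    exact Real.rpow_le_rpow hx.le h1 h
  · rw [abs_of_nonpos h, Real.rpow_neg hK.le, ← Real.inv_rpow hK.le,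
      ← Real.mul_rpow (by positivity) hy.le]
    refine Real.rpow_le_rpow_of_nonpos (by positivity) ?_ h
    rw [inv_mul_le_iff₀ hK]
    exact h2

theorem eLpNorm_le_of_integral_sq_le {f g : ℝ → ℝ} (hf : MemLp f 2 volume)
    (hg : MemLp g 2 volume) {K : ℝ≥0} (h : ∫ t, f t ^ 2 ≤ K * ∫ t, g t ^ 2) :
    eLpNorm f 2 volume ≤ NNReal.sqrt K * eLpNorm g 2 volume := by
  have e : ∀ u : ℝ → ℝ, MemLp u 2 volume →
      eLpNorm u 2 volume = ENNReal.ofReal (Real.sqrt (∫ t, u t ^ 2)) := by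
    intro u hu
    rw [hu.eLpNorm_eq_integral_rpow_norm (by norm_num) (by norm_num), Real.sqrt_eq_rpow]
    simp
  rw [e f hf, e g hg, ← ENNReal.ofReal_coe_nnreal, ← ENNReal.ofReal_mul (by positivity)]
  refine ENNReal.ofReal_le_ofReal ?_
  rw [Real.coe_sqrt, ← Real.sqrt_mul K.coe_nonneg]
  exact Real.sqrt_le_sqrt h

/-- With g = V'' - wV and q = p'/p, the derivative of p²VV' equals p²((V' + qV)² + (w - q²)V² + Vg),
and its integral vanishes. The bound on q² leaves at least c·wV² in the quadratic form, and half of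
it absorbs Vg. -/
theorem weighted_energy {p q w V : ℝ → ℝ} {c : ℝ} (hc : 0 < c) (hc1 : c ≤ 1)
    (hp : ∀ t, HasDerivAt p (q t * p t) t) (hq : Continuous q)
    (hw : Continuous w) (hw0 : ∀ t, 0 < w t) (hqw : ∀ t, q t ^ 2 ≤ (1 - c) * w t)
    (hV : ContDiff ℝ ∞ V) (cV : HasCompactSupport V) :
    ∫ t, p t ^ 2 * (iteratedDeriv 1 V t ^ 2 + w t * V t ^ 2)
      ≤ 3 / c ^ 2 * ∫ t, p t ^ 2 * (iteratedDeriv 2 V t - w t * V t) ^ 2 / w t := by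
  have hpc : Continuous p := continuous_iff_continuousAt.2 fun t => (hp t).continuousAt
  have c1 := (contDiff_iteratedDeriv_infty hV 1).continuous
  have c2 := (contDiff_iteratedDeriv_infty hV 2).continuous
  have c0 := hV.continuous
  have s1 := iteratedDeriv_hasCompactSupport cV 1
  have s2 := iteratedDeriv_hasCompactSupport cV 2
  have hd0 : ∀ t, HasDerivAt V (iteratedDeriv 1 V t) t := fun t => by
    rw [iteratedDeriv_one]
    exact (hV.differentiable (by simp) t).hasDerivAt
  have hd1 : ∀ t, HasDerivAt (iteratedDeriv 1 V) (iteratedDeriv 2 V t) t := fun t => by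
    rw [show iteratedDeriv 2 V = deriv (iteratedDeriv 1 V) from iteratedDeriv_succ]
    exact ((contDiff_iteratedDeriv_infty hV 1).differentiable (by simp) t).hasDerivAt
  set D : ℝ → ℝ := fun t => 2 * (p t * (q t * p t)) * (V t * iteratedDeriv 1 V t)
    + p t ^ 2 * (iteratedDeriv 1 V t * iteratedDeriv 1 V t + V t * iteratedDeriv 2 V t) with hD
  have hDd : ∀ t, HasDerivAt (fun t => p t ^ 2 * (V t * iteratedDeriv 1 V t)) (D t) t := by
    intro t
    have h := ((hp t).pow 2).mul ((hd0 t).mul (hd1 t))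
    refine h.congr_deriv ?_
    simp only [hD, Pi.mul_apply, Pi.pow_apply]
    push_cast
    ring
  have iD : Integrable D volume := by
    refine Continuous.integrable_of_hasCompactSupport (by fun_prop) ?_
    exact (cV.mul_right.mul_left).add ((s1.mul_right.add cV.mul_right).mul_left)
  have iG : Integrable (fun t => p t ^ 2 * (V t * iteratedDeriv 1 V t)) volume :=
    Continuous.integrable_of_hasCompactSupport (by fun_prop) cV.mul_right.mul_left
  have hD0 : ∫ t, D t = 0 := integral_eq_zero_of_hasDerivAt_of_integrable hDd iD iG
  have iR : Integrable (fun t => p t ^ 2 * (iteratedDeriv 2 V t - w t * V t) ^ 2 / w t)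
      volume := by
    refine Continuous.integrable_of_hasCompactSupport
      (Continuous.div (by fun_prop) hw fun t => (hw0 t).ne') ?_
    have : HasCompactSupport fun t => iteratedDeriv 2 V t - w t * V t := s2.sub cV.mul_left
    have h2 : HasCompactSupport fun t => (iteratedDeriv 2 V t - w t * V t) *
      (p t ^ 2 * (iteratedDeriv 2 V t - w t * V t) / w t) := this.mul_right
    have e : (fun t => p t ^ 2 * (iteratedDeriv 2 V t - w t * V t) ^ 2 / w t)
        = fun t => (iteratedDeriv 2 V t - w t * V t) *
          (p t ^ 2 * (iteratedDeriv 2 V t - w t * V t) / w t) := by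
      funext t; ring
    rw [e]
    exact h2
  have iL : Integrable (fun t => p t ^ 2 * (iteratedDeriv 1 V t ^ 2 + w t * V t ^ 2)) volume := by
    refine Continuous.integrable_of_hasCompactSupport (by fun_prop) ?_
    refine HasCompactSupport.mul_left (HasCompactSupport.add ?_ (HasCompactSupport.mul_left ?_))
    · exact s1.comp_left (g := fun x => x ^ 2) (by simp)
    · exact cV.comp_left (g := fun x => x ^ 2) (by simp)
  -- The estimate holds pointwise up to a multiple of D, a total derivative with zero integral.
  have pt : ∀ t, p t ^ 2 * (iteratedDeriv 1 V t ^ 2 + w t * V t ^ 2)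
      ≤ 3 / c ^ 2 * (p t ^ 2 * (iteratedDeriv 2 V t - w t * V t) ^ 2 / w t) + 6 / c * D t := by
    intro t
    set P := p t
    set Q := q t
    set W := w t
    set v := V t
    set v1 := iteratedDeriv 1 V t
    set v2 := iteratedDeriv 2 V t
    have hW : 0 < W := hw0 t
    have hQ : Q ^ 2 ≤ (1 - c) * W := hqw t
    set g := v2 - W * v with hg
    have e1 : D t = P ^ 2 * ((v1 + Q * v) ^ 2 + (W - Q ^ 2) * v ^ 2 + v * g) := by
      simp only [hD, hg]; ring
    -- Young's inequality, with weights chosen so that only half of the coercive term c·W·v² is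
    -- spent.
    have e2 : -(v * g) ≤ c / 2 * W * v ^ 2 + g ^ 2 / (2 * c * W) := by
      have h : 0 ≤ (c * W * v + g) ^ 2 / (2 * c * W) := by positivity
      have : (c * W * v + g) ^ 2 / (2 * c * W)
          = c / 2 * W * v ^ 2 + g ^ 2 / (2 * c * W) + v * g := by
        field_simp; ring
      linarith
    -- V' is recovered from V' + qV by means of q² ≤ w.
    have e3 : v1 ^ 2 ≤ 2 * (v1 + Q * v) ^ 2 + 2 * W * v ^ 2 := by
      have h1 : v1 ^ 2 ≤ 2 * (v1 + Q * v) ^ 2 + 2 * (Q ^ 2 * v ^ 2) := by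
        nlinarith [sq_nonneg (v1 + 2 * Q * v)]
      have h2 : Q ^ 2 * v ^ 2 ≤ W * v ^ 2 := by
        gcongr
        nlinarith
      linarith
    have e4 : c * W * v ^ 2 ≤ (W - Q ^ 2) * v ^ 2 := by
      gcongr
      linarith
    have e5 : v1 ^ 2 + W * v ^ 2
        ≤ 6 / c * ((v1 + Q * v) ^ 2 + c / 2 * W * v ^ 2) := by
      have h6 : 6 / c * ((v1 + Q * v) ^ 2 + c / 2 * W * v ^ 2)
          = 6 / c * (v1 + Q * v) ^ 2 + 3 * W * v ^ 2 := by field_simp; ring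
      have h7 : 2 * (v1 + Q * v) ^ 2 ≤ 6 / c * (v1 + Q * v) ^ 2 := by
        gcongr
        rw [le_div_iff₀ hc]; linarith
      rw [h6]; linarith
    have e6 : (v1 + Q * v) ^ 2 + c / 2 * W * v ^ 2 ≤ g ^ 2 / (2 * c * W)
        + ((v1 + Q * v) ^ 2 + (W - Q ^ 2) * v ^ 2 + v * g) := by linarith
    have e7 : v1 ^ 2 + W * v ^ 2 ≤ 6 / c * (g ^ 2 / (2 * c * W)
        + ((v1 + Q * v) ^ 2 + (W - Q ^ 2) * v ^ 2 + v * g)) :=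
      e5.trans (mul_le_mul_of_nonneg_left e6 (by positivity))
    calc P ^ 2 * (v1 ^ 2 + W * v ^ 2) ≤ P ^ 2 * (6 / c * (g ^ 2 / (2 * c * W)
        + ((v1 + Q * v) ^ 2 + (W - Q ^ 2) * v ^ 2 + v * g))) :=
          mul_le_mul_of_nonneg_left e7 (by positivity)
      _ = _ := by rw [e1]; field_simp; ring
  calc _ ≤ ∫ t, (3 / c ^ 2 * (p t ^ 2 * (iteratedDeriv 2 V t - w t * V t) ^ 2 / w t)
        + 6 / c * D t) := integral_mono iL ((iR.const_mul _).add (iD.const_mul _)) pt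
    _ = _ := by
      rw [integral_add (iR.const_mul _) (iD.const_mul _), integral_const_mul, integral_const_mul,
        hD0, mul_zero, add_zero]

/-- The logarithmic derivative of `r^a (1 + ε r²)^{b/2}` is dominated by `(1 + r²)^{1/2}`. -/
theorem sq_logDeriv_le {a b X : ℝ} (ha : a ^ 2 < 1) :
    (a + b * ((1 - a ^ 2) / (1 + b ^ 2)) * X ^ 2 / (1 + (1 - a ^ 2) / (1 + b ^ 2) * X ^ 2)) ^ 2
      ≤ (1 - (1 - a ^ 2) / 2) * (1 + X ^ 2) := by
  set ε := (1 - a ^ 2) / (1 + b ^ 2) with hε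
  have ε0 : 0 < ε := div_pos (by linarith) (by positivity)
  have hden : 0 < 1 + ε * X ^ 2 := by positivity
  -- The logarithmic derivative becomes a + eX, to which Cauchy–Schwarz applies in the form (a +
  -- eX)² ≤ (a² + e²)(1 + X²). The choice of ε gives b²ε ≤ 1 - a², hence e² ≤ (1 - a²)/4.
  set e := b * ε * X / (1 + ε * X ^ 2) with he
  have h1 : a + b * ε * X ^ 2 / (1 + ε * X ^ 2) = a + e * X := by rw [he]; ring
  have h2 : e ^ 2 ≤ (1 - a ^ 2) / 4 := by
    have : e ^ 2 ≤ b ^ 2 * ε / 4 := by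
      rw [he, div_pow, div_le_iff₀ (by positivity)]
      have : 4 * (ε * X ^ 2) ≤ (1 + ε * X ^ 2) ^ 2 := by nlinarith [sq_nonneg (1 - ε * X ^ 2)]
      have := mul_le_mul_of_nonneg_left this (show 0 ≤ b ^ 2 * ε / 4 by positivity)
      nlinarith
    have h3 : b ^ 2 * ε ≤ 1 - a ^ 2 := by
      rw [hε, mul_div_assoc', div_le_iff₀ (by positivity)]
      nlinarith
    linarith
  rw [h1]
  have h4 : (a + e * X) ^ 2 ≤ (a ^ 2 + e ^ 2) * (1 + X ^ 2) := by nlinarith [sq_nonneg (a * X - e)]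
  refine h4.trans (mul_le_mul_of_nonneg_right ?_ (by positivity))
  linarith

/-- With the reverse bound `le_div_sqrt`, this makes M comparable to r/⟨r⟩. The energy estimate
needs a weight that can be differentiated, whereas M is only known to be measurable. -/
theorem LogWeight.div_sqrt_le {M : ℝ → ℝ} (hM : LogWeight M) (t : ℝ) :
    Real.exp t / Real.sqrt (1 + Real.exp t ^ 2) ≤ M t := by
  refine le_trans ?_ (hM.min_le t)
  have hX := Real.exp_pos t
  rw [div_le_iff₀ (by positivity)]
  have h1 : Real.exp t ≤ Real.sqrt (1 + Real.exp t ^ 2) := Real.le_sqrt_of_sq_le (by linarith)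
  have h2 : 1 ≤ Real.sqrt (1 + Real.exp t ^ 2) := Real.one_le_sqrt.2 (by nlinarith)
  rcases min_cases 1 (Real.exp t) with h | h <;> rw [h.1] <;> nlinarith

theorem LogWeight.le_div_sqrt {M : ℝ → ℝ} (hM : LogWeight M) (t : ℝ) :
    M t ≤ 3 * (Real.exp t / Real.sqrt (1 + Real.exp t ^ 2)) := by
  have hX := Real.exp_pos t
  rw [mul_div_assoc', le_div_iff₀ (by positivity)]
  have h3 := hM.pos t
  have h4 := hM.le_two t
  have h5 := hM.le_exp t
  refine abs_le_of_sq_le_sq' ?_ (by positivity) |>.2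
  rw [mul_pow, Real.sq_sqrt (by positivity)]
  have h6 : M t ^ 2 ≤ Real.exp t ^ 2 := by gcongr
  have h7 : M t ^ 2 ≤ 4 := by nlinarith
  nlinarith [mul_le_mul_of_nonneg_right h7 (sq_nonneg (Real.exp t))]

/-- The energy estimate is applied to a differentiable p comparable to M^{σ+1}⟨r⟩^γ. The interval
for σ is used exactly to obtain (σ+1)² < 1. -/
theorem nrm_le_bessel {M : ℝ → ℝ} (hM : LogWeight M) (γ : ℝ) {σ : ℝ}
    (hσ : σ ∈ Set.Ioo (-2 : ℝ) 0) :
    ∃ C : ℝ≥0, ∀ V : ℝ → ℝ, ContDiff ℝ ∞ V → HasCompactSupport V →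
      sobNorm M γ 1 σ V ≤ C * sobNorm M γ 0 (σ + 2) (bessel V) := by
  set a := σ + 1 with ha
  have ha2 : a ^ 2 < 1 := by
    have h1 : -1 < a := by linarith [hσ.1]
    have h2 : a < 1 := by linarith [hσ.2]
    nlinarith
  -- Replacing M by r/⟨r⟩ turns M^a⟨r⟩^γ into r^a⟨r⟩^{γ-a}. The small ε in p damps the logarithmic
  -- derivative of the second factor and changes p only by a bounded factor.
  set b := γ - a with hb
  set ε := (1 - a ^ 2) / (1 + b ^ 2) with hε
  have ε0 : 0 < ε := div_pos (by linarith) (by positivity)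
  have ε1 : ε ≤ 1 := by
    rw [hε, div_le_one (by positivity)]; nlinarith [sq_nonneg a, sq_nonneg b]
  set p : ℝ → ℝ := fun t => Real.exp (a * t) * (1 + ε * Real.exp t ^ 2) ^ (b / 2) with hp
  set q : ℝ → ℝ := fun t => a + b * ε * Real.exp t ^ 2 / (1 + ε * Real.exp t ^ 2) with hq
  set w : ℝ → ℝ := fun t => 1 + Real.exp t ^ 2 with hw
  have hw0 : ∀ t, 0 < w t := fun t => by positivity
  have hden : ∀ t, 0 < 1 + ε * Real.exp t ^ 2 := fun t => by positivity
  have hp0 : ∀ t, 0 < p t := fun t => by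
    have := hden t
    positivity
  have hqc : Continuous q := by
    simp only [hq]
    exact continuous_const.add (Continuous.div (by fun_prop) (by fun_prop) fun t => (hden t).ne')
  have hwc : Continuous w := by fun_prop
  have hpd : ∀ t, HasDerivAt p (q t * p t) t := by
    intro t
    have h1 : HasDerivAt (fun t => Real.exp (a * t)) (Real.exp (a * t) * a) t := by
      simpa using ((hasDerivAt_id t).const_mul a).exp
    have h2 : HasDerivAt (fun t => 1 + ε * Real.exp t ^ 2) (ε * (2 * Real.exp t ^ 2)) t := by
      have := (((Real.hasDerivAt_exp t).pow 2).const_mul ε).const_add 1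
      refine this.congr_deriv ?_
      push_cast; ring
    have h3 := h1.mul (h2.rpow_const (p := b / 2) (Or.inl (hden t).ne'))
    refine h3.congr_deriv ?_
    have h4 : (1 + ε * Real.exp t ^ 2) ^ (b / 2 - 1)
        = (1 + ε * Real.exp t ^ 2) ^ (b / 2) / (1 + ε * Real.exp t ^ 2) := by
      rw [Real.rpow_sub_one (hden t).ne']
    have := (hden t).ne'
    simp only [hq, hp]
    rw [h4]
    field_simp
  have hpc : Continuous p := continuous_iff_continuousAt.2 fun t => (hpd t).continuousAt
  -- comparison of `p` with the weight
  obtain ⟨K, hK⟩ : ∃ K : ℝ≥0, ∀ t,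
      M t ^ a * Real.sqrt (w t) ^ γ ≤ K * p t ∧ p t ≤ K * (M t ^ a * Real.sqrt (w t) ^ γ) := by
    have hε2 : 0 < ε⁻¹ := by positivity
    have hε1 : 1 ≤ ε⁻¹ := (one_le_inv₀ ε0).2 ε1
    obtain ⟨K, hK⟩ : ∃ K : ℝ≥0, (K : ℝ) = 3 ^ |a| * ε⁻¹ ^ |b / 2| := ⟨⟨_, by positivity⟩, rfl⟩
    refine ⟨K, fun t => ?_⟩
    have hX := Real.exp_pos t
    have hMp := hM.pos t
    have hb0 : 0 < Real.sqrt (w t) := Real.sqrt_pos.2 (hw0 t)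
    have hu : 0 < Real.exp t / Real.sqrt (w t) := by positivity
    have ep : p t = Real.exp t ^ a * (1 + ε * Real.exp t ^ 2) ^ (b / 2) := by
      simp only [hp]; rw [← Real.exp_mul, mul_comm a t]
    have ew : (Real.exp t / Real.sqrt (w t)) ^ a * Real.sqrt (w t) ^ γ
        = Real.exp t ^ a * w t ^ (b / 2) := by
      rw [Real.div_rpow hX.le hb0.le]
      have : Real.sqrt (w t) ^ γ = Real.sqrt (w t) ^ a * w t ^ (b / 2) := by
        rw [Real.sqrt_eq_rpow, ← Real.rpow_mul (hw0 t).le, ← Real.rpow_mul (hw0 t).le,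
          ← Real.rpow_add (hw0 t)]
        congr 1; rw [hb]; ring
      rw [this]
      have : Real.sqrt (w t) ^ a ≠ 0 := by positivity
      field_simp
    have m1 := hM.div_sqrt_le t
    have m2 := hM.le_div_sqrt t
    have r1 : M t ^ a ≤ 3 ^ |a| * (Real.exp t / Real.sqrt (w t)) ^ a :=
      rpow_le_mul_rpow hMp hu (by norm_num) m2 (m1.trans (by linarith)) a
    have r2 : (Real.exp t / Real.sqrt (w t)) ^ a ≤ 3 ^ |a| * M t ^ a :=
      rpow_le_mul_rpow hu hMp (by norm_num) (m1.trans (by linarith)) m2 a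
    have hle : 1 + ε * Real.exp t ^ 2 ≤ w t := by
      simp only [hw]; nlinarith [sq_nonneg (Real.exp t)]
    have hge : w t ≤ ε⁻¹ * (1 + ε * Real.exp t ^ 2) := by
      have : ε⁻¹ * (1 + ε * Real.exp t ^ 2) = ε⁻¹ + Real.exp t ^ 2 := by field_simp
      rw [this]; simp only [hw]; linarith
    have r3 : w t ^ (b / 2) ≤ ε⁻¹ ^ |b / 2| * (1 + ε * Real.exp t ^ 2) ^ (b / 2) :=
      rpow_le_mul_rpow (hw0 t) (hden t) hε2 hge
        (hle.trans (le_mul_of_one_le_left (hw0 t).le hε1)) _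
    have r4 : (1 + ε * Real.exp t ^ 2) ^ (b / 2) ≤ ε⁻¹ ^ |b / 2| * w t ^ (b / 2) :=
      rpow_le_mul_rpow (hden t) (hw0 t) hε2
        (hle.trans (le_mul_of_one_le_left (hw0 t).le hε1)) hge _
    have hg0 : 0 ≤ Real.sqrt (w t) ^ γ := by positivity
    constructor
    · calc M t ^ a * Real.sqrt (w t) ^ γ
          ≤ 3 ^ |a| * (Real.exp t / Real.sqrt (w t)) ^ a * Real.sqrt (w t) ^ γ := by gcongr
        _ = 3 ^ |a| * (Real.exp t ^ a * w t ^ (b / 2)) := by rw [mul_assoc, ew]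
        _ ≤ 3 ^ |a| * (Real.exp t ^ a
            * (ε⁻¹ ^ |b / 2| * (1 + ε * Real.exp t ^ 2) ^ (b / 2))) := by gcongr
        _ = _ := by rw [ep, hK]; ring
    · calc p t ≤ Real.exp t ^ a * (ε⁻¹ ^ |b / 2| * w t ^ (b / 2)) := by rw [ep]; gcongr
        _ = ε⁻¹ ^ |b / 2| * ((Real.exp t / Real.sqrt (w t)) ^ a * Real.sqrt (w t) ^ γ) := by
            rw [ew]; ring
        _ ≤ ε⁻¹ ^ |b / 2| * ((3 ^ |a| * M t ^ a) * Real.sqrt (w t) ^ γ) := by gcongr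
        _ = _ := by rw [hK]; ring
  set c := (1 - a ^ 2) / 2 with hc
  have c0 : 0 < c := by rw [hc]; linarith
  have c1 : c ≤ 1 := by rw [hc]; nlinarith [sq_nonneg a]
  obtain ⟨E, hE⟩ : ∃ E : ℝ≥0, (E : ℝ) = 3 / c ^ 2 := ⟨⟨_, by positivity⟩, rfl⟩
  refine ⟨2 * (K * NNReal.sqrt E * K), fun V hV cV => ?_⟩
  have hen := weighted_energy c0 c1 hpd hqc hwc hw0 (fun t => sq_logDeriv_le ha2) hV cV
  rw [← hE] at hen
  have v1c := (contDiff_iteratedDeriv_infty hV 1).continuous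
  have v2c := (contDiff_iteratedDeriv_infty hV 2).continuous
  have v0c := hV.continuous
  have s1 := iteratedDeriv_hasCompactSupport cV 1
  have s2 := iteratedDeriv_hasCompactSupport cV 2
  set g : ℝ → ℝ := fun t => iteratedDeriv 2 V t - w t * V t with hg
  have gc : Continuous g := by fun_prop
  have sg : HasCompactSupport g := s2.sub cV.mul_left
  have hsq : ∀ t, Real.sqrt (w t) ^ 2 = w t := fun t => Real.sq_sqrt (hw0 t).le
  have hsp : ∀ t, 0 < Real.sqrt (w t) := fun t => Real.sqrt_pos.2 (hw0 t)
  have swc : Continuous fun t => Real.sqrt (w t) := hwc.sqrt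
  have mG : MemLp (fun t => p t / Real.sqrt (w t) * g t) 2 volume :=
    Continuous.memLp_of_hasCompactSupport
      ((hpc.div swc fun t => (hsp t).ne').mul gc) sg.mul_left
  have m0 : MemLp (fun t => p t * Real.sqrt (w t) * V t) 2 volume :=
    Continuous.memLp_of_hasCompactSupport (by fun_prop) cV.mul_left
  have m1 : MemLp (fun t => p t * iteratedDeriv 1 V t) 2 volume :=
    Continuous.memLp_of_hasCompactSupport (by fun_prop) s1.mul_left
  have eG : ∀ t, (p t / Real.sqrt (w t) * g t) ^ 2 = p t ^ 2 * g t ^ 2 / w t := fun t => by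
    rw [mul_pow, div_pow, hsq]; ring
  have e0 : ∀ t, (p t * Real.sqrt (w t) * V t) ^ 2 = p t ^ 2 * (w t * V t ^ 2) := fun t => by
    rw [mul_pow, mul_pow, hsq]; ring
  have iL : Integrable (fun t => p t ^ 2 * (iteratedDeriv 1 V t ^ 2 + w t * V t ^ 2)) volume := by
    have := m0.integrable_sq.add m1.integrable_sq
    refine this.congr (Filter.Eventually.of_forall fun t => ?_)
    simp only [Pi.add_apply, e0]
    ring
  have b0 := eLpNorm_le_of_integral_sq_le (K := E) m0 mG (by
    simp only [eG, e0]
    refine le_trans (integral_mono_of_nonneg (Filter.Eventually.of_forall fun t => ?_) iL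
      (Filter.Eventually.of_forall fun t => ?_)) hen
    · have := hw0 t
      simp only [Pi.zero_apply]; positivity
    · simp only
      gcongr
      nlinarith [sq_nonneg (iteratedDeriv 1 V t)])
  have b1 := eLpNorm_le_of_integral_sq_le (K := E) m1 mG (by
    simp only [eG]
    refine le_trans (integral_mono_of_nonneg (Filter.Eventually.of_forall fun t => ?_) iL
      (Filter.Eventually.of_forall fun t => ?_)) hen
    · simp only [Pi.zero_apply]; positivity
    · simp only [mul_pow]
      gcongr
      have := hw0 t
      nlinarith [mul_nonneg this.le (sq_nonneg (V t))])
  have hX : ∀ t, 0 < Real.exp t := Real.exp_pos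
  have hMa : ∀ t, M t ^ (σ + 1) = M t ^ a := fun t => by rw [ha]
  -- The term wV² of the energy controls ⟨r⟩V, which dominates the required weight since r/⟨r⟩ ≤ M.
  have hMσ : ∀ t, M t ^ σ * Real.exp t ≤ M t ^ a * Real.sqrt (w t) := fun t => by
    have := hM.pos t
    have h1 := hM.div_sqrt_le t
    rw [div_le_iff₀ (hsp t)] at h1
    rw [ha, Real.rpow_add_one this.ne', mul_assoc]
    gcongr
  have d0 : nrm M γ σ V ≤ K * eLpNorm (fun t => p t * Real.sqrt (w t) * V t) 2 volume := by
    have := eLpNorm_le_mul_sum (μ := volume) (Finset.univ : Finset Unit) K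
      (F := fun t => wt M γ σ t * V t) (G := fun _ t => p t * Real.sqrt (w t) * V t)
      (fun _ _ => m0.1) (Filter.Eventually.of_forall fun t => ?_)
    · simpa [nrm] using this
    · simp only [Finset.univ_unique, Finset.sum_singleton]
      rw [abs_mul, abs_mul, abs_mul, abs_of_pos (wt_pos hM γ σ t), abs_of_pos (hp0 t),
        abs_of_pos (hsp t), ← mul_assoc]
      refine mul_le_mul_of_nonneg_right ?_ (abs_nonneg _)
      unfold wt
      calc M t ^ σ * Real.sqrt (w t) ^ γ * Real.exp t
          = (M t ^ σ * Real.exp t) * Real.sqrt (w t) ^ γ := by ring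
        _ ≤ (M t ^ a * Real.sqrt (w t)) * Real.sqrt (w t) ^ γ :=
            mul_le_mul_of_nonneg_right (hMσ t) (by positivity)
        _ = (M t ^ a * Real.sqrt (w t) ^ γ) * Real.sqrt (w t) := by ring
        _ ≤ (K * p t) * Real.sqrt (w t) :=
            mul_le_mul_of_nonneg_right (hK t).1 (hsp t).le
        _ = _ := by ring
  have d1 : nrm M γ (σ + 1) (fun t => Real.exp (-t) * iteratedDeriv 1 V t)
      ≤ K * eLpNorm (fun t => p t * iteratedDeriv 1 V t) 2 volume := by
    have := eLpNorm_le_mul_sum (μ := volume) (Finset.univ : Finset Unit) K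
      (F := fun t => wt M γ (σ + 1) t * (Real.exp (-t) * iteratedDeriv 1 V t))
      (G := fun _ t => p t * iteratedDeriv 1 V t)
      (fun _ _ => m1.1) (Filter.Eventually.of_forall fun t => ?_)
    · simpa [nrm] using this
    · simp only [Finset.univ_unique, Finset.sum_singleton]
      rw [abs_mul, abs_mul, abs_mul, abs_of_pos (wt_pos hM γ _ t), abs_of_pos (hp0 t),
        Real.abs_exp, ← mul_assoc, ← mul_assoc]
      refine mul_le_mul_of_nonneg_right ?_ (abs_nonneg _)
      unfold wt
      rw [Real.exp_neg, hMa, mul_inv_cancel_right₀ (hX t).ne']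
      exact (hK t).1
  -- Here g = e^{2t}·`bessel V`, and r/⟨r⟩ ≤ M turns one factor e^t/⟨r⟩ into the additional power of
  -- M in the target weight.
  have dG : eLpNorm (fun t => p t / Real.sqrt (w t) * g t) 2 volume
      ≤ K * nrm M γ (σ + 2) (bessel V) := by
    have := eLpNorm_le_mul_sum (μ := volume) (Finset.univ : Finset Unit) K
      (F := fun t => p t / Real.sqrt (w t) * g t)
      (G := fun _ t => wt M γ (σ + 2) t * bessel V t)
      (fun _ _ => ((wt_measurable hM γ (σ + 2)).mul
        (bessel_contDiff hV).continuous.measurable).aestronglyMeasurable)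
      (Filter.Eventually.of_forall fun t => ?_)
    · simpa [nrm] using this
    · simp only [Finset.univ_unique, Finset.sum_singleton]
      have eb : g t = Real.exp t ^ 2 * bessel V t := by
        have h2 : Real.exp (-2 * t) = (Real.exp t ^ 2)⁻¹ := by
          rw [← Real.exp_nat_mul, ← Real.exp_neg]; congr 1; push_cast; ring
        have := (hX t).ne'
        simp only [hg, hw, bessel, h2]
        field_simp
        ring
      rw [eb, abs_mul, abs_mul, abs_mul, abs_of_pos (wt_pos hM γ _ t),
        abs_of_pos (div_pos (hp0 t) (hsp t)), abs_of_pos (pow_pos (hX t) 2), ← mul_assoc,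
        ← mul_assoc]
      refine mul_le_mul_of_nonneg_right ?_ (abs_nonneg _)
      have h1 := hM.div_sqrt_le t
      have h2 : M t ^ (σ + 2) = M t ^ a * M t := by
        rw [← Real.rpow_add_one (hM.pos t).ne']; congr 1; rw [ha]; ring
      unfold wt
      rw [h2]
      have h3 := hM.pos t
      calc p t / Real.sqrt (w t) * Real.exp t ^ 2
          = p t * (Real.exp t / Real.sqrt (w t)) * Real.exp t := by ring
        _ ≤ (K * (M t ^ a * Real.sqrt (w t) ^ γ)) * M t * Real.exp t := by
            have := (hK t).2
            have := (hX t).le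
            have h4 := div_pos (hX t) (hsp t)
            gcongr
        _ = _ := by ring
  have t0 : nrm M γ σ V ≤ (K * NNReal.sqrt E * K : ℝ≥0) * nrm M γ (σ + 2) (bessel V) := by
    refine d0.trans ?_
    push_cast
    rw [mul_assoc, mul_assoc]
    gcongr
    exact b0.trans (by gcongr)
  have t1 : nrm M γ (σ + 1) (fun t => Real.exp (-t) * iteratedDeriv 1 V t)
      ≤ (K * NNReal.sqrt E * K : ℝ≥0) * nrm M γ (σ + 2) (bessel V) := by
    refine d1.trans ?_
    push_cast
    rw [mul_assoc, mul_assoc]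
    gcongr
    exact b1.trans (by gcongr)
  have hs0 : sobNorm M γ 0 (σ + 2) (bessel V) = nrm M γ (σ + 2) (bessel V) := by
    simp [sobNorm]
  have hs1 : sobNorm M γ 1 σ V = nrm M γ σ V
      + nrm M γ (σ + 1) (fun t => Real.exp (-t) * iteratedDeriv 1 V t) := by
    simp [sobNorm, Finset.sum_range_succ]
  rw [hs0, hs1]
  refine (add_le_add t0 t1).trans (le_of_eq ?_)
  push_cast
  ring

/-- The equation solved for V''; differentiating this form gives control of all higher derivatives.
-/
theorem iteratedDeriv_two_eq_bessel (V : ℝ → ℝ) :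
    iteratedDeriv 2 V = V + fun t => Real.exp (2 * t) * (bessel V t + V t) := by
  funext t
  have h : Real.exp (2 * t) * Real.exp (-2 * t) = 1 := by
    rw [← Real.exp_add]; simp
  simp only [bessel, Pi.add_apply]
  linear_combination (V t - iteratedDeriv 2 V t) * h

/-- Differentiate V'' = V + e^{2t}(F + V) k times. The factor e^{2t} cancels two powers of r^{-1},
leaving M^{σ+2+k}r^{-k}: exactly the weight for F, and two powers of M too many for V, which cost a
constant. -/
theorem top_term_le_bessel {M : ℝ → ℝ} (hM : LogWeight M) (γ σ : ℝ) (k : ℕ) :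
    ∃ C : ℝ≥0, ∀ V : ℝ → ℝ, ContDiff ℝ ∞ V →
      nrm M γ (σ + (k + 2 : ℕ)) (fun t => Real.exp (-((k + 2 : ℕ) * t)) * iteratedDeriv (k + 2) V t)
        ≤ C * (sobNorm M γ (k + 1) σ V + sobNorm M γ k (σ + 2) (bessel V)) := by
  obtain ⟨C, hC⟩ := exists_abs_iteratedDeriv_exp_mul_le k 2
  refine ⟨1 + 4 * C, fun V hV => ?_⟩
  set F := bessel V with hF
  have hFs : ContDiff ℝ ∞ F := bessel_contDiff hV
  have h1 := nrm_le_mul_sum hM (γ := γ) (τ := σ + (k + 2 : ℕ))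
    ((Finset.range (k + 1 + 1)).disjSum (Finset.range (k + 1))) (1 + 4 * C)
    (f := fun t => Real.exp (-((k + 2 : ℕ) * t)) * iteratedDeriv (k + 2) V t)
    (g := Sum.elim (fun j t => Real.exp (-(j * t)) * iteratedDeriv j V t)
      (fun j t => Real.exp (-(j * t)) * iteratedDeriv j F t))
    (τ' := Sum.elim (fun j => σ + j) (fun j => σ + 2 + j)) ?_ (fun t => ?_)
  · rw [Finset.sum_disjSum] at h1
    exact h1
  · rintro (j | j) -
    · exact sobTerm_measurable hV j
    · exact sobTerm_measurable hFs j
  have hp := hM.pos t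
  rw [Finset.sum_disjSum]
  simp only [Sum.elim_inl, Sum.elim_inr]
  set A : ℕ → ℝ := fun j => M t ^ (σ + j) * |Real.exp (-(j * t)) * iteratedDeriv j V t| with hA
  set B : ℕ → ℝ := fun j => M t ^ (σ + 2 + j) * |Real.exp (-(j * t)) * iteratedDeriv j F t| with hB
  have hA0 : ∀ j, 0 ≤ A j := fun j => by positivity
  have hB0 : ∀ j, 0 ≤ B j := fun j => by positivity
  have e0 : iteratedDeriv (k + 2) V t = iteratedDeriv k V t
      + iteratedDeriv k (fun t => Real.exp (2 * t) * (F t + V t)) t := by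
    rw [← iteratedDeriv_iteratedDeriv V k 2, iteratedDeriv_two_eq_bessel, iteratedDeriv_add
      (contDiffAt_of_contDiff_infty hV k t)
      (contDiffAt_of_contDiff_infty ((show ContDiff ℝ ∞ fun t : ℝ => Real.exp (2 * t) by
        fun_prop).mul (hFs.add hV)) k t)]
  have e1 : ∀ j, |iteratedDeriv j (fun t => F t + V t) t|
      ≤ |iteratedDeriv j F t| + |iteratedDeriv j V t| := by
    intro j
    have : iteratedDeriv j (fun t => F t + V t) t = iteratedDeriv j F t + iteratedDeriv j V t :=
      iteratedDeriv_add (contDiffAt_of_contDiff_infty hFs j t)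
        (contDiffAt_of_contDiff_infty hV j t)
    rw [this]
    exact abs_add_le _ _
  have e2 : |iteratedDeriv (k + 2) V t| ≤ |iteratedDeriv k V t| + C * Real.exp (2 * t)
      * ∑ j ∈ Finset.range (k + 1), (|iteratedDeriv j F t| + |iteratedDeriv j V t|) := by
    rw [e0]
    refine (abs_add_le _ _).trans (add_le_add le_rfl ((hC _ (hFs.add hV) t).trans ?_))
    gcongr with j hj
    exact e1 j
  set R := M t ^ (σ + (k + 2 : ℕ)) with hR
  have hR0 : 0 < R := by positivity
  have e3 : R * Real.exp (-((k + 2 : ℕ) * t)) * |iteratedDeriv k V t| ≤ A k := by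
    have h := hM.shift_le σ t (show k ≤ k + 2 by omega)
    simp only [hA]
    rw [abs_mul, Real.abs_exp, ← mul_assoc]
    exact mul_le_mul_of_nonneg_right h (abs_nonneg _)
  have ex : Real.exp (-((k + 2 : ℕ) * t)) * Real.exp (2 * t) = Real.exp (-(k * t)) := by
    rw [← Real.exp_add]; congr 1; push_cast; ring
  have eR : R = M t ^ (σ + 2 + k) := by rw [hR]; congr 1; push_cast; ring
  have e4 : ∀ j ≤ k, R * Real.exp (-(k * t)) * |iteratedDeriv j F t| ≤ B j := by
    intro j hj
    have h := hM.shift_le (σ + 2) t hj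
    simp only [hB]
    rw [abs_mul, Real.abs_exp, ← mul_assoc, eR]
    exact mul_le_mul_of_nonneg_right h (abs_nonneg _)
  have e5 : ∀ j ≤ k, R * Real.exp (-(k * t)) * |iteratedDeriv j V t| ≤ 4 * A j := by
    intro j hj
    have h := hM.shift_le σ t hj
    have h2 := hM.add_two_le (σ + k) t
    have h3 : R ≤ 4 * M t ^ (σ + k) := by
      rw [eR]; refine le_trans (le_of_eq ?_) h2; congr 1; ring
    simp only [hA]
    rw [abs_mul, Real.abs_exp, ← mul_assoc, ← mul_assoc]
    refine mul_le_mul_of_nonneg_right ?_ (abs_nonneg _)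
    calc R * Real.exp (-(k * t)) ≤ 4 * M t ^ (σ + k) * Real.exp (-(k * t)) := by gcongr
      _ = 4 * (M t ^ (σ + k) * Real.exp (-(k * t))) := by ring
      _ ≤ 4 * (M t ^ (σ + j) * Real.exp (-(j * t))) := by gcongr
      _ = _ := by ring
  have SA : ∑ j ∈ Finset.range (k + 1), A j ≤ ∑ j ∈ Finset.range (k + 1 + 1), A j := by
    rw [Finset.sum_range_succ _ (k + 1)]; linarith [hA0 (k + 1)]
  have SA1 : A k ≤ ∑ j ∈ Finset.range (k + 1 + 1), A j :=
    Finset.single_le_sum (fun i _ => hA0 i) (Finset.mem_range.2 (by omega))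
  have SB0 : 0 ≤ ∑ j ∈ Finset.range (k + 1), B j := Finset.sum_nonneg fun j _ => hB0 j
  rw [abs_mul, Real.abs_exp, ← mul_assoc]
  calc R * Real.exp (-((k + 2 : ℕ) * t)) * |iteratedDeriv (k + 2) V t|
      ≤ R * Real.exp (-((k + 2 : ℕ) * t)) * (|iteratedDeriv k V t| + C * Real.exp (2 * t)
      * ∑ j ∈ Finset.range (k + 1), (|iteratedDeriv j F t| + |iteratedDeriv j V t|)) := by gcongr
    _ = R * Real.exp (-((k + 2 : ℕ) * t)) * |iteratedDeriv k V t|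
        + C * (∑ j ∈ Finset.range (k + 1), R * Real.exp (-(k * t)) * |iteratedDeriv j F t|
          + ∑ j ∈ Finset.range (k + 1), R * Real.exp (-(k * t)) * |iteratedDeriv j V t|) := by
        rw [← Finset.mul_sum, ← Finset.mul_sum, ← mul_add, ← Finset.sum_add_distrib, ← ex]; ring
    _ ≤ ∑ j ∈ Finset.range (k + 1 + 1), A j + C * (∑ j ∈ Finset.range (k + 1), B j
          + 4 * ∑ j ∈ Finset.range (k + 1 + 1), A j) := by
        refine add_le_add (e3.trans SA1) (mul_le_mul_of_nonneg_left (add_le_add ?_ ?_) C.2)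
        · exact Finset.sum_le_sum fun j hj => e4 j (by have := Finset.mem_range.1 hj; omega)
        · refine le_trans ?_ (mul_le_mul_of_nonneg_left SA (by norm_num))
          rw [Finset.mul_sum]
          exact Finset.sum_le_sum fun j hj => e5 j (by have := Finset.mem_range.1 hj; omega)
    _ ≤ _ := by
        push_cast
        have := mul_nonneg C.coe_nonneg SB0
        nlinarith

theorem sobNorm_le_bessel {M : ℝ → ℝ} (hM : LogWeight M) (γ : ℝ) {σ : ℝ}
    (hσ : σ ∈ Set.Ioo (-2 : ℝ) 0) (s : ℕ) :
    ∃ C : ℝ≥0, ∀ V : ℝ → ℝ, ContDiff ℝ ∞ V → HasCompactSupport V →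
      sobNorm M γ (s + 2) σ V ≤ C * sobNorm M γ s (σ + 2) (bessel V) := by
  -- With F controlled in order n, control of V in order n+1 improves to order n+2. The induction
  -- starts from the energy estimate, which is order one for V against order zero for F.
  have step : ∀ n : ℕ, (∃ C : ℝ≥0, ∀ V : ℝ → ℝ, ContDiff ℝ ∞ V → HasCompactSupport V →
      sobNorm M γ (n + 1) σ V ≤ C * sobNorm M γ n (σ + 2) (bessel V)) →
      ∃ C : ℝ≥0, ∀ V : ℝ → ℝ, ContDiff ℝ ∞ V → HasCompactSupport V →
      sobNorm M γ (n + 2) σ V ≤ C * sobNorm M γ n (σ + 2) (bessel V) := by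
    rintro n ⟨C, hC⟩
    obtain ⟨C', hC'⟩ := top_term_le_bessel hM γ σ n
    refine ⟨C + C' * (C + 1), fun V hV cV => ?_⟩
    have h1 := hC V hV cV
    have h2 := hC' V hV
    rw [sobNorm, Finset.sum_range_succ]
    change sobNorm M γ (n + 1) σ V + _ ≤ _
    calc _ ≤ (C : ℝ≥0∞) * sobNorm M γ n (σ + 2) (bessel V)
        + C' * (C * sobNorm M γ n (σ + 2) (bessel V) + sobNorm M γ n (σ + 2) (bessel V)) :=
          add_le_add h1 (h2.trans (by gcongr))
      _ = _ := by push_cast; ring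
  have all : ∀ n : ℕ, ∃ C : ℝ≥0, ∀ V : ℝ → ℝ, ContDiff ℝ ∞ V → HasCompactSupport V →
      sobNorm M γ (n + 1) σ V ≤ C * sobNorm M γ n (σ + 2) (bessel V) := by
    intro n
    induction n with
    | zero => exact nrm_le_bessel hM γ hσ
    | succ n ih =>
      obtain ⟨C, hC⟩ := step n ih
      refine ⟨C, fun V hV cV => (hC V hV cV).trans ?_⟩
      gcongr
      rw [sobNorm, sobNorm, Finset.sum_range_succ _ (n + 1)]
      exact le_self_add
  exact step s (all s)

/-! ### The modified Bessel functions of order one -/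

/-- The entire function `∑ z^k / (k! (k+n)!)`. -/
def besselSeries (n : ℕ) (z : ℝ) : ℝ := ∑' k : ℕ, z ^ k / (k.factorial * (k + n).factorial)

theorem besselSeries_summable (n : ℕ) (z : ℝ) :
    Summable fun k : ℕ => z ^ k / ((k.factorial : ℝ) * (k + n).factorial) := by
  refine Summable.of_norm_bounded (Real.summable_pow_div_factorial |z|) fun k => ?_
  rw [norm_div, norm_pow, Real.norm_eq_abs, Real.norm_eq_abs,
    abs_of_nonneg (show (0 : ℝ) ≤ k.factorial * (k + n).factorial by positivity)]
  have : (1 : ℝ) ≤ ((k + n).factorial : ℝ) := by exact_mod_cast Nat.factorial_pos _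
  exact div_le_div_of_nonneg_left (by positivity) (by positivity)
    (le_mul_of_one_le_right (by positivity) this)

/-- Differentiation sends the k-th term to the (k-1)-th term of the series with index n+1, so no new
functions appear. -/
theorem hasDerivAt_besselSeries (n : ℕ) (z : ℝ) :
    HasDerivAt (besselSeries n) (besselSeries (n + 1) z) z := by
  set R := |z| + 1 with hR
  have hR0 : 0 < R := by positivity
  have hz : z ∈ Set.Ioo (-R) R := by
    rw [Set.mem_Ioo, ← abs_lt]; linarith
  -- On (-R, R) the k-th differentiated term is at most k·R^{k-1}/k!, and k ≤ 2^k gives this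
  -- summable majorant.
  have hs : Summable fun k : ℕ => (2 * R) ^ k / (k.factorial : ℝ) / R :=
    (Real.summable_pow_div_factorial (2 * R)).div_const R
  have h := hasDerivAt_tsum_of_isPreconnected hs isOpen_Ioo isPreconnected_Ioo
    (g := fun k z => z ^ k / ((k.factorial : ℝ) * (k + n).factorial))
    (g' := fun k z => (k * z ^ (k - 1)) / ((k.factorial : ℝ) * (k + n).factorial))
    (fun k y _ => (hasDerivAt_pow k y).div_const _) (fun k y hy => ?_) hz
    (besselSeries_summable n z) hz
  · refine h.congr_deriv ?_
    have hsum : Summable fun k : ℕ =>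
        (k * z ^ (k - 1)) / ((k.factorial : ℝ) * (k + n).factorial) := by
      rw [← summable_nat_add_iff 1]
      refine (besselSeries_summable (n + 1) z).congr fun k => ?_
      rw [Nat.factorial_succ k, show k + 1 + n = k + (n + 1) by ring]
      push_cast
      field_simp
    rw [hsum.tsum_eq_zero_add, besselSeries]
    simp only [Nat.cast_zero, zero_mul, zero_div, zero_add]
    refine tsum_congr fun k => ?_
    rw [Nat.factorial_succ k, show k + 1 + n = k + (n + 1) by ring]
    push_cast
    field_simp
  · have hy' : |y| ≤ R := (abs_lt.2 hy).le
    rw [norm_div, norm_mul, norm_pow, Real.norm_eq_abs, Real.norm_eq_abs, Real.norm_eq_abs,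
      abs_of_nonneg (show (0 : ℝ) ≤ k.factorial * (k + n).factorial by positivity), Nat.abs_cast]
    rcases Nat.eq_zero_or_pos k with rfl | hk
    · simp; positivity
    have h1 : (1 : ℝ) ≤ ((k + n).factorial : ℝ) := by
      exact_mod_cast Nat.factorial_pos _
    have h2 : (k : ℝ) ≤ 2 ^ k := by exact_mod_cast Nat.lt_two_pow_self.le
    have h3 : (2 * R) ^ k / (k.factorial : ℝ) / R = 2 ^ k * R ^ (k - 1) / k.factorial := by
      obtain ⟨j, rfl⟩ := Nat.exists_eq_add_of_lt hk
      simp only [zero_add, Nat.add_sub_cancel]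
      rw [mul_pow, pow_succ R]
      field_simp
    rw [h3]
    gcongr
    exact le_mul_of_one_le_right (by positivity) h1

/-- After an index shift the left-hand side has coefficients (k+2)/(k!(k+2)!), and k+2 cancels. As
the indices 2 and 3 are the first two derivatives of index 1, this is Bessel's equation in the
variable z. -/
theorem besselSeries_rec (z : ℝ) :
    z * besselSeries 3 z + 2 * besselSeries 2 z = besselSeries 1 z := by
  have h3 : z * besselSeries 3 z
      = ∑' k : ℕ, (k * z ^ k) / ((k.factorial : ℝ) * (k + 2).factorial) := by
    have hs : Summable fun k : ℕ => (k * z ^ k) / ((k.factorial : ℝ) * (k + 2).factorial) := by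
      rw [← summable_nat_add_iff 1]
      refine ((besselSeries_summable 3 z).mul_left z).congr fun k => ?_
      rw [Nat.factorial_succ k, show k + 1 + 2 = k + 3 by ring]
      push_cast
      field_simp
      ring
    rw [hs.tsum_eq_zero_add, besselSeries, ← tsum_mul_left]
    simp only [Nat.cast_zero, zero_mul, zero_div, zero_add]
    refine tsum_congr fun k => ?_
    rw [Nat.factorial_succ k, show k + 1 + 2 = k + 3 by ring]
    push_cast
    field_simp
    ring
  have hs : Summable fun k : ℕ => (k * z ^ k) / ((k.factorial : ℝ) * (k + 2).factorial) := by
    rw [← summable_nat_add_iff 1]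
    refine ((besselSeries_summable 3 z).mul_left z).congr fun k => ?_
    rw [Nat.factorial_succ k, show k + 1 + 2 = k + 3 by ring]
    push_cast
    field_simp
    ring
  rw [h3, besselSeries, ← tsum_mul_left, ← hs.tsum_add ((besselSeries_summable 2 z).mul_left 2),
    besselSeries]
  refine tsum_congr fun k => ?_
  rw [show k + 2 = (k + 1) + 1 by ring, Nat.factorial_succ (k + 1)]
  push_cast
  field_simp
  ring

theorem besselSeries_nonneg (n : ℕ) {z : ℝ} (hz : 0 ≤ z) : 0 ≤ besselSeries n z :=
  tsum_nonneg fun k => by positivity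

theorem term_le_besselSeries (n k : ℕ) {z : ℝ} (hz : 0 ≤ z) :
    z ^ k / ((k.factorial : ℝ) * (k + n).factorial) ≤ besselSeries n z :=
  (besselSeries_summable n z).le_tsum k fun j _ => by positivity

theorem besselSeries_succ_le (n : ℕ) {z : ℝ} (hz : 0 ≤ z) :
    besselSeries (n + 1) z ≤ besselSeries n z := by
  refine (besselSeries_summable (n + 1) z).tsum_le_tsum (fun k => ?_) (besselSeries_summable n z)
  gcongr
  omega

theorem besselSeries_le_exp (n : ℕ) {z : ℝ} (hz : 0 ≤ z) : besselSeries n z ≤ Real.exp z := by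
  rw [Real.exp_eq_exp_ℝ, NormedSpace.exp_eq_tsum_div]
  refine (besselSeries_summable n z).tsum_le_tsum (fun k => ?_)
    (Real.summable_pow_div_factorial z)
  gcongr
  have : (1 : ℝ) ≤ ((k + n).factorial : ℝ) := by exact_mod_cast Nat.factorial_pos _
  exact le_mul_of_one_le_right (by positivity) this

/-- The solution of `h'' = (1 + e^{2t}) h` decaying at `-∞`, up to a factor `I₁(e^t)`. -/
def besselI (t : ℝ) : ℝ := Real.exp t * besselSeries 1 (Real.exp t ^ 2 / 4)

/-- The derivative of `besselI`. -/
def besselI' (t : ℝ) : ℝ :=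
  Real.exp t * (besselSeries 1 (Real.exp t ^ 2 / 4)
    + Real.exp t ^ 2 / 2 * besselSeries 2 (Real.exp t ^ 2 / 4))

theorem hasDerivAt_exp_sq_div (t : ℝ) (c : ℝ) :
    HasDerivAt (fun t => Real.exp t ^ 2 / c) (2 * Real.exp t ^ 2 / c) t := by
  refine (((Real.hasDerivAt_exp t).pow 2).div_const c).congr_deriv ?_
  push_cast; ring

theorem hasDerivAt_series_exp (n : ℕ) (t : ℝ) :
    HasDerivAt (fun t => besselSeries n (Real.exp t ^ 2 / 4))
      (besselSeries (n + 1) (Real.exp t ^ 2 / 4) * (2 * Real.exp t ^ 2 / 4)) t :=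
  (hasDerivAt_besselSeries n _).comp t (hasDerivAt_exp_sq_div t 4)

theorem hasDerivAt_besselI (t : ℝ) : HasDerivAt besselI (besselI' t) t := by
  refine ((Real.hasDerivAt_exp t).mul (hasDerivAt_series_exp 1 t)).congr_deriv ?_
  rw [besselI']; ring

theorem hasDerivAt_besselI' (t : ℝ) :
    HasDerivAt besselI' ((1 + Real.exp t ^ 2) * besselI t) t := by
  refine ((Real.hasDerivAt_exp t).mul ((hasDerivAt_series_exp 1 t).add
    ((hasDerivAt_exp_sq_div t 2).mul (hasDerivAt_series_exp 2 t)))).congr_deriv ?_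
  have h := besselSeries_rec (Real.exp t ^ 2 / 4)
  simp only [Pi.add_apply, Pi.mul_apply]
  rw [besselI, ← h]; ring

theorem besselI_pos (t : ℝ) : 0 < besselI t := by
  have h := term_le_besselSeries 1 0 (show 0 ≤ Real.exp t ^ 2 / 4 by positivity)
  simp only [pow_zero, Nat.factorial_zero, Nat.cast_one, zero_add, Nat.factorial_one, mul_one,
    div_one] at h
  have := Real.exp_pos t
  unfold besselI
  positivity

/-- One term of a series with nonnegative terms bounds it from below. As n is arbitrary, this is all
the growth at infinity that is needed, and no asymptotics of I₁ enter. -/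
theorem le_besselI (n : ℕ) (t : ℝ) :
    (4 ^ n * ((n.factorial : ℝ) * (n + 1).factorial))⁻¹ * Real.exp ((2 * n + 1) * t)
      ≤ besselI t := by
  have h := term_le_besselSeries 1 n (show 0 ≤ Real.exp t ^ 2 / 4 by positivity)
  unfold besselI
  refine le_trans (le_of_eq ?_) (mul_le_mul_of_nonneg_left h (Real.exp_pos t).le)
  have : Real.exp ((2 * n + 1) * t) = Real.exp t * (Real.exp t ^ 2) ^ n := by
    rw [← pow_mul, ← Real.exp_nat_mul, ← Real.exp_add]; congr 1; push_cast; ring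
  rw [this, div_pow]
  field_simp

theorem besselI'_nonneg (t : ℝ) : 0 ≤ besselI' t := by
  have h1 := besselSeries_nonneg 1 (show 0 ≤ Real.exp t ^ 2 / 4 by positivity)
  have h2 := besselSeries_nonneg 2 (show 0 ≤ Real.exp t ^ 2 / 4 by positivity)
  unfold besselI'
  positivity

theorem besselI'_le (t : ℝ) : besselI' t ≤ (1 + Real.exp t ^ 2) * besselI t := by
  have h0 := besselSeries_nonneg 1 (show 0 ≤ Real.exp t ^ 2 / 4 by positivity)
  have h1 := besselSeries_succ_le 1 (show 0 ≤ Real.exp t ^ 2 / 4 by positivity)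
  have := Real.exp_pos t
  unfold besselI' besselI
  rw [mul_left_comm]
  gcongr
  nlinarith [mul_le_mul_of_nonneg_left h1 (sq_nonneg (Real.exp t)),
    mul_nonneg (sq_nonneg (Real.exp t)) h0]

theorem besselI_mono : Monotone besselI :=
  monotone_of_hasDerivAt_nonneg hasDerivAt_besselI besselI'_nonneg

theorem besselI_le {a t : ℝ} (h : t ≤ a) :
    besselI t ≤ Real.exp (Real.exp a ^ 2 / 4) * Real.exp t := by
  unfold besselI
  rw [mul_comm]
  gcongr
  exact (besselSeries_le_exp 1 (by positivity)).trans (by gcongr)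

theorem besselI_continuous : Continuous besselI :=
  continuous_iff_continuousAt.2 fun t => (hasDerivAt_besselI t).continuousAt

theorem inv_besselI_le (n : ℕ) (t : ℝ) :
    (besselI t)⁻¹ ≤ (4 ^ n * ((n.factorial : ℝ) * (n + 1).factorial))
      * Real.exp (-(2 * n + 1) * t) := by
  have h := inv_anti₀ (by positivity) (le_besselI n t)
  refine h.trans (le_of_eq ?_)
  rw [mul_inv, inv_inv, ← Real.exp_neg]
  ring_nf

theorem integrableOn_inv_besselI_sq (t : ℝ) :
    IntegrableOn (fun s => (besselI s ^ 2)⁻¹) (Set.Ioi t) := by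
  have h1 : IntegrableOn (fun s => Real.exp (-2 * s)) (Set.Ioi t) :=
    integrableOn_exp_mul_Ioi (by norm_num) t
  refine h1.mono' ?_ (Filter.Eventually.of_forall fun s => ?_)
  · exact ((besselI_continuous.pow 2).inv₀ fun s =>
      (pow_pos (besselI_pos s) 2).ne').aestronglyMeasurable
  · have h := inv_besselI_le 0 s
    simp only [pow_zero, Nat.factorial_zero, Nat.cast_one, zero_add, Nat.factorial_one, mul_one,
      Nat.cast_zero, mul_zero, one_mul] at h
    have h0 := inv_pos.2 (besselI_pos s)
    rw [Real.norm_eq_abs, abs_of_nonneg (by positivity), ← inv_pow]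
    have : Real.exp (-2 * s) = Real.exp (-1 * s) ^ 2 := by
      rw [← Real.exp_nat_mul]; congr 1; push_cast; ring
    rw [this]
    gcongr

/-- The tail integral of `1 / besselI²`. -/
def besselTail (t : ℝ) : ℝ := ∫ s in Set.Ioi t, (besselI s ^ 2)⁻¹

theorem hasDerivAt_besselTail (t : ℝ) : HasDerivAt besselTail (-(besselI t ^ 2)⁻¹) t := by
  have hc : Continuous fun s => (besselI s ^ 2)⁻¹ :=
    (besselI_continuous.pow 2).inv₀ fun s => (pow_pos (besselI_pos s) 2).ne'
  have e : besselTail = fun u => besselTail t - ∫ s in t..u, (besselI s ^ 2)⁻¹ := by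
    funext u
    have := intervalIntegral.integral_Ioi_sub_Ioi' (integrableOn_inv_besselI_sq t)
      (integrableOn_inv_besselI_sq u)
    unfold besselTail
    linarith
  rw [e]
  exact (hc.integral_hasStrictDerivAt t t).hasDerivAt.const_sub _

theorem besselTail_nonneg (t : ℝ) : 0 ≤ besselTail t :=
  setIntegral_nonneg measurableSet_Ioi fun s _ => by positivity

/-- The solution of `k'' = (1 + e^{2t}) k` decaying at `+∞`, up to a factor `K₁(e^t)`. -/
def besselK (t : ℝ) : ℝ := besselI t * besselTail t

/-- The derivative of `besselK`. -/
def besselK' (t : ℝ) : ℝ := besselI' t * besselTail t - (besselI t)⁻¹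

theorem hasDerivAt_besselK (t : ℝ) : HasDerivAt besselK (besselK' t) t := by
  refine ((hasDerivAt_besselI t).mul (hasDerivAt_besselTail t)).congr_deriv ?_
  have := (besselI_pos t).ne'
  rw [besselK']
  field_simp
  ring

theorem hasDerivAt_besselK' (t : ℝ) :
    HasDerivAt besselK' ((1 + Real.exp t ^ 2) * besselK t) t := by
  have := (besselI_pos t).ne'
  refine (((hasDerivAt_besselI' t).mul (hasDerivAt_besselTail t)).sub
    ((hasDerivAt_besselI t).inv this)).congr_deriv ?_
  rw [besselK]
  field_simp
  ring

/-- The second solution comes from reduction of order, K = I·∫_t^∞ I^{-2}. With this normalization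
the Wronskian is one, so variation of constants needs no extra factor. -/
theorem bessel_wronskian (t : ℝ) : besselI' t * besselK t - besselI t * besselK' t = 1 := by
  have := (besselI_pos t).ne'
  rw [besselK, besselK']
  field_simp
  ring

theorem besselK_nonneg (t : ℝ) : 0 ≤ besselK t :=
  mul_nonneg (besselI_pos t).le (besselTail_nonneg t)

/-- Since I is increasing, I(t)/I(s)² ≤ 1/I(s) for s > t. Hence K(t) is at most the tail integral of
1/I, which decays at any exponential rate by `inv_besselI_le`. -/
theorem exists_besselK_le (n : ℕ) : ∃ C : ℝ, ∀ t, besselK t ≤ C * Real.exp (-(2 * n + 1) * t) := by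
  set A : ℝ := 4 ^ n * ((n.factorial : ℝ) * (n + 1).factorial) with hA
  have hn : -(2 * (n : ℝ) + 1) < 0 := by linarith [(Nat.cast_nonneg n : (0 : ℝ) ≤ n)]
  refine ⟨A * (2 * (n : ℝ) + 1)⁻¹, fun t => ?_⟩
  have hi : IntegrableOn (fun s => A * Real.exp (-(2 * n + 1) * s)) (Set.Ioi t) :=
    (integrableOn_exp_mul_Ioi hn t).const_mul A
  calc besselK t = ∫ s in Set.Ioi t, besselI t * (besselI s ^ 2)⁻¹ := by
        rw [besselK, besselTail, integral_const_mul]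
    _ ≤ ∫ s in Set.Ioi t, A * Real.exp (-(2 * n + 1) * s) := by
        refine setIntegral_mono_on ((integrableOn_inv_besselI_sq t).const_mul _) hi
          measurableSet_Ioi fun s hs => ?_
        refine le_trans ?_ (inv_besselI_le n s)
        have h0 := besselI_pos s
        have h1 := besselI_mono (le_of_lt hs)
        rw [← div_eq_mul_inv, div_le_iff₀ (by positivity)]
        refine h1.trans (le_of_eq ?_)
        field_simp
    _ = _ := by
        rw [integral_const_mul, integral_exp_mul_Ioi hn]
        have : (2 * (n : ℝ) + 1) ≠ 0 := by positivity
        rw [neg_div_neg_eq]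
        field_simp

/-- The bound I' ≤ (1 + e^{2t})I reduces the first summand of K' to K; the second is 1/I. -/
theorem exists_abs_besselK'_le (n : ℕ) :
    ∃ C : ℝ, ∀ t, |besselK' t| ≤ C * ((1 + Real.exp t ^ 2) * Real.exp (-(2 * n + 1) * t)) := by
  obtain ⟨C, hC⟩ := exists_besselK_le n
  refine ⟨C + 4 ^ n * ((n.factorial : ℝ) * (n + 1).factorial), fun t => ?_⟩
  have h1 : besselI' t * besselTail t ≤ (1 + Real.exp t ^ 2) * besselK t := by
    rw [besselK, ← mul_assoc]
    exact mul_le_mul_of_nonneg_right (besselI'_le t) (besselTail_nonneg t)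
  have h2 := inv_besselI_le n t
  have h3 := mul_nonneg (besselI'_nonneg t) (besselTail_nonneg t)
  have h4 := inv_pos.2 (besselI_pos t)
  have h5 := Real.exp_pos (-(2 * n + 1) * t)
  set A : ℝ := 4 ^ n * ((n.factorial : ℝ) * (n + 1).factorial) with hA
  have hA0 : 0 < A := by positivity
  set X := Real.exp t ^ 2 with hX
  have hX0 : 0 ≤ X := by positivity
  calc |besselK' t| ≤ |besselI' t * besselTail t| + |(besselI t)⁻¹| := abs_sub _ _
    _ = besselI' t * besselTail t + (besselI t)⁻¹ := by rw [abs_of_nonneg h3, abs_of_pos h4]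
    _ ≤ (1 + X) * (C * Real.exp (-(2 * n + 1) * t)) + A * Real.exp (-(2 * n + 1) * t) := by
        refine add_le_add (h1.trans ?_) h2
        exact mul_le_mul_of_nonneg_left (hC t) (by positivity)
    _ ≤ _ := by nlinarith [mul_nonneg (mul_nonneg hA0.le hX0) h5.le]

/-! ### Rapid decay and solvability for test functions -/

/-- Decay like `r` at the origin and faster than any power of `r` at infinity, `r = e^t`. -/
def RapidDecay (f : ℝ → ℝ) : Prop :=
  ∀ n : ℕ, ∃ C : ℝ, ∀ t, |f t| * Real.exp (n * t) ≤ C * Real.exp t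

theorem RapidDecay.of_le_sum {ι : Type*} (S : Finset ι) (C : ℝ) {f : ℝ → ℝ} {g : ι → ℝ → ℝ}
    (hC : 0 ≤ C) (hg : ∀ i ∈ S, RapidDecay (g i)) (h : ∀ t, |f t| ≤ C * ∑ i ∈ S, |g i t|) :
    RapidDecay f := by
  intro n
  have : ∀ i, ∃ K : ℝ, i ∈ S → ∀ t, |g i t| * Real.exp (n * t) ≤ K * Real.exp t := by
    intro i
    by_cases hi : i ∈ S
    · obtain ⟨K, hK⟩ := hg i hi n
      exact ⟨K, fun _ => hK⟩
    · exact ⟨0, fun h => absurd h hi⟩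
  choose K hK using this
  refine ⟨C * ∑ i ∈ S, K i, fun t => ?_⟩
  calc |f t| * Real.exp (n * t) ≤ (C * ∑ i ∈ S, |g i t|) * Real.exp (n * t) := by
        gcongr; exact h t
    _ = C * ∑ i ∈ S, |g i t| * Real.exp (n * t) := by rw [mul_assoc, Finset.sum_mul]
    _ ≤ C * ∑ i ∈ S, K i * Real.exp t := by
        exact mul_le_mul_of_nonneg_left (Finset.sum_le_sum fun i hi => hK i hi t) hC
    _ = _ := by rw [← Finset.sum_mul]; ring

theorem RapidDecay.exp_two_mul {f : ℝ → ℝ} (hf : RapidDecay f) :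
    RapidDecay fun t => Real.exp (2 * t) * f t := by
  intro n
  obtain ⟨C, hC⟩ := hf (n + 2)
  refine ⟨C, fun t => le_trans (le_of_eq ?_) (hC t)⟩
  have : Real.exp (((n + 2 : ℕ) : ℝ) * t) = Real.exp (2 * t) * Real.exp (n * t) := by
    rw [← Real.exp_add]; congr 1; push_cast; ring
  rw [this, abs_mul, Real.abs_exp]; ring

/-- A continuous function decays rapidly if it does so away from an interval. -/
theorem RapidDecay.of_continuous {f : ℝ → ℝ} (hf : Continuous f) {R : ℝ} (hR : 0 ≤ R)
    (h1 : ∃ C, ∀ t ≤ -R, |f t| ≤ C * Real.exp t)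
    (h2 : ∀ n : ℕ, ∃ C, ∀ t, R ≤ t → |f t| * Real.exp (n * t) ≤ C) : RapidDecay f := by
  intro n
  obtain ⟨C1, hC1⟩ := h1
  obtain ⟨C2, hC2⟩ := h2 n
  obtain ⟨C3, hC3⟩ := isCompact_Icc.exists_bound_of_continuousOn (s := Set.Icc (-R) R)
    (f := fun t => f t * Real.exp (n * t) * Real.exp (-t)) (by fun_prop)
  refine ⟨max (|C1|) (max (|C2|) C3), fun t => ?_⟩
  have hX := Real.exp_pos t
  rcases le_total t (-R) with h | h
  · have e1 : Real.exp (n * t) ≤ 1 := by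
      rw [Real.exp_le_one_iff]
      exact mul_nonpos_of_nonneg_of_nonpos (Nat.cast_nonneg n) (by linarith)
    calc |f t| * Real.exp (n * t) ≤ |f t| * 1 := by gcongr
      _ ≤ C1 * Real.exp t := by rw [mul_one]; exact hC1 t h
      _ ≤ _ := by
        gcongr
        exact (le_abs_self _).trans (le_max_left _ _)
  rcases le_total t R with h' | h'
  · have h3 := hC3 t ⟨h, h'⟩
    rw [norm_mul, norm_mul, Real.norm_eq_abs, Real.norm_eq_abs, Real.norm_eq_abs, Real.abs_exp,
      Real.abs_exp, Real.exp_neg, ← div_eq_mul_inv, div_le_iff₀ hX] at h3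
    refine h3.trans ?_
    gcongr
    exact (le_max_right _ _).trans (le_max_right _ _)
  · refine (hC2 t h').trans ?_
    have e1 : 1 ≤ Real.exp t := Real.one_le_exp (by linarith)
    calc C2 ≤ max (|C1|) (max (|C2|) C3) :=
        (le_abs_self _).trans ((le_max_left _ _).trans (le_max_right _ _))
      _ ≤ _ := le_mul_of_one_le_right ((abs_nonneg _).trans (le_max_left _ _)) e1

theorem exists_support_bound {F : ℝ → ℝ} (cF : HasCompactSupport F) :
    ∃ R : ℝ, 0 ≤ R ∧ ∀ t, R ≤ |t| → F t = 0 := by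
  obtain ⟨R, hR⟩ := cF.isBounded.subset_closedBall 0
  refine ⟨|R| + 1, by positivity, fun t ht => ?_⟩
  by_contra h
  have := hR (subset_tsupport F h)
  rw [Metric.mem_closedBall, dist_zero_right, Real.norm_eq_abs] at this
  linarith [le_abs_self R]

theorem RapidDecay.of_hasCompactSupport {f : ℝ → ℝ} (hf : Continuous f)
    (cf : HasCompactSupport f) : RapidDecay f := by
  obtain ⟨R, hR, h⟩ := exists_support_bound cf
  refine RapidDecay.of_continuous hf hR ⟨0, fun t ht => ?_⟩ fun n => ⟨0, fun t ht => ?_⟩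
  · rw [h t (by rw [abs_of_nonpos] <;> linarith)]; simp
  · rw [h t (ht.trans (le_abs_self t))]; simp

theorem besselK_bounds (n : ℕ) {R : ℝ} (hR : 0 ≤ R) : ∃ C, ∀ t, R ≤ t →
    |besselK t| * Real.exp (n * t) ≤ C ∧ |besselK' t| * Real.exp (n * t) ≤ C := by
  -- The shift by 2 leaves at least a factor e^{-2t} after multiplication by e^{nt}, enough to
  -- absorb the factor 1 + e^{2t} in the bound for K'.
  obtain ⟨C1, h1⟩ := exists_besselK_le (n + 2)
  obtain ⟨C2, h2⟩ := exists_abs_besselK'_le (n + 2)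
  refine ⟨max (|C1|) (2 * |C2|), fun t ht => ?_⟩
  have t0 : 0 ≤ t := hR.trans ht
  have n0 : (0 : ℝ) ≤ n := Nat.cast_nonneg n
  have e1 : Real.exp (-(2 * ((n + 2 : ℕ) : ℝ) + 1) * t) * Real.exp (n * t) ≤ Real.exp (-(2 * t)) := by
    rw [← Real.exp_add]
    refine Real.exp_le_exp.2 ?_
    push_cast
    nlinarith [mul_nonneg n0 t0]
  have e2 : Real.exp (-(2 * t)) ≤ 1 := Real.exp_le_one_iff.2 (by linarith)
  have e3 : (1 + Real.exp t ^ 2) * Real.exp (-(2 * t)) ≤ 2 := by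
    have : Real.exp t ^ 2 * Real.exp (-(2 * t)) = 1 := by
      rw [← Real.exp_nat_mul, ← Real.exp_add]; simp
    rw [add_mul, this]; linarith
  constructor
  · rw [abs_of_nonneg (besselK_nonneg t)]
    refine le_trans ?_ (le_max_left _ _)
    calc besselK t * Real.exp (n * t)
        ≤ |C1| * Real.exp (-(2 * ((n + 2 : ℕ) : ℝ) + 1) * t) * Real.exp (n * t) := by
          gcongr
          refine (h1 t).trans ?_
          gcongr
          exact le_abs_self _
      _ = |C1| * (Real.exp (-(2 * ((n + 2 : ℕ) : ℝ) + 1) * t) * Real.exp (n * t)) := by ring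
      _ ≤ |C1| * 1 := by gcongr; exact e1.trans e2
      _ = _ := mul_one _
  · refine le_trans ?_ (le_max_right _ _)
    calc |besselK' t| * Real.exp (n * t)
        ≤ |C2| * ((1 + Real.exp t ^ 2) * Real.exp (-(2 * ((n + 2 : ℕ) : ℝ) + 1) * t))
            * Real.exp (n * t) := by
          gcongr
          refine (h2 t).trans ?_
          gcongr
          exact le_abs_self _
      _ = |C2| * ((1 + Real.exp t ^ 2)
            * (Real.exp (-(2 * ((n + 2 : ℕ) : ℝ) + 1) * t) * Real.exp (n * t))) := by ring
      _ ≤ |C2| * ((1 + Real.exp t ^ 2) * Real.exp (-(2 * t))) := by gcongr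
      _ ≤ |C2| * 2 := by gcongr
      _ = _ := by ring

theorem besselI_bounds {R : ℝ} (hR : 0 ≤ R) : ∃ C, ∀ t ≤ -R,
    |besselI t| ≤ C * Real.exp t ∧ |besselI' t| ≤ C * Real.exp t := by
  refine ⟨2 * Real.exp (Real.exp 0 ^ 2 / 4), fun t ht => ?_⟩
  have t0 : t ≤ 0 := by linarith
  have h1 := besselI_le t0
  have h2 := besselI'_le t
  have h3 : Real.exp t ^ 2 ≤ 1 := by
    have := Real.exp_le_one_iff.2 t0
    have h0 := Real.exp_pos t
    nlinarith
  have h4 := besselI_pos t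
  rw [abs_of_pos h4, abs_of_nonneg (besselI'_nonneg t)]
  have h5 : (1 + Real.exp t ^ 2) * besselI t ≤ 2 * besselI t := by
    gcongr; linarith
  have h6 : 0 < Real.exp (Real.exp 0 ^ 2 / 4) * Real.exp t := by positivity
  constructor <;> nlinarith

/-- V and V' gain one degree of smoothness at a time together, since the equation expresses the
derivative of V' through V. -/
theorem contDiff_of_bessel_ode {V V' w g : ℝ → ℝ} (hw : ContDiff ℝ ∞ w) (hg : ContDiff ℝ ∞ g)
    (h1 : ∀ t, HasDerivAt V (V' t) t) (h2 : ∀ t, HasDerivAt V' (w t * V t + g t) t) :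
    ContDiff ℝ ∞ V := by
  have d1 : deriv V = V' := funext fun t => (h1 t).deriv
  have d2 : deriv V' = fun t => w t * V t + g t := funext fun t => (h2 t).deriv
  have key : ∀ n : ℕ, ContDiff ℝ n V ∧ ContDiff ℝ n V' := by
    intro n
    induction n with
    | zero =>
      simp only [Nat.cast_zero, contDiff_zero]
      exact ⟨continuous_iff_continuousAt.2 fun t => (h1 t).continuousAt,
        continuous_iff_continuousAt.2 fun t => (h2 t).continuousAt⟩
    | succ n ih =>
      push_cast
      rw [contDiff_succ_iff_deriv, contDiff_succ_iff_deriv, d1, d2]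
      exact ⟨⟨fun t => (h1 t).differentiableAt, fun h => absurd h (by simp), ih.2⟩,
        fun t => (h2 t).differentiableAt, fun h => absurd h (by simp),
        ((hw.of_le (by exact_mod_cast le_top)).mul ih.1).add
          (hg.of_le (by exact_mod_cast le_top))⟩
  exact contDiff_infty.2 fun n => (key n).1

/-- Solvability of `Δ₁ V - V = F` for test functions `F`, by variation of constants. -/
theorem exists_bessel_eq {F : ℝ → ℝ} (hF : ContDiff ℝ ∞ F) (cF : HasCompactSupport F) :
    ∃ V : ℝ → ℝ, ContDiff ℝ ∞ V ∧ bessel V = F ∧ ∀ k, RapidDecay (iteratedDeriv k V) := by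
  obtain ⟨R, hR, hFR⟩ := exists_support_bound cF
  set g : ℝ → ℝ := fun t => Real.exp t ^ 2 * F t with hg
  have gs : ContDiff ℝ ∞ g := by fun_prop
  have gc := gs.continuous
  have gR : ∀ t, R ≤ |t| → g t = 0 := fun t ht => by simp [hg, hFR t ht]
  have Kc : Continuous besselK :=
    continuous_iff_continuousAt.2 fun t => (hasDerivAt_besselK t).continuousAt
  have K'c : Continuous besselK' :=
    continuous_iff_continuousAt.2 fun t => (hasDerivAt_besselK' t).continuousAt
  have I'c : Continuous besselI' :=
    continuous_iff_continuousAt.2 fun t => (hasDerivAt_besselI' t).continuousAt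
  have Ic := besselI_continuous
  -- The base points are chosen at the ends of an interval containing the support of g. Then α
  -- vanishes to the right of it, where V is a multiple of K, and β vanishes to the left of it,
  -- where V is a multiple of I.
  set α : ℝ → ℝ := fun t => ∫ s in R..t, besselK s * g s with hα
  set β : ℝ → ℝ := fun t => ∫ s in (-R)..t, besselI s * g s with hβ
  have dα : ∀ t, HasDerivAt α (besselK t * g t) t := fun t =>
    ((Kc.mul gc).integral_hasStrictDerivAt R t).hasDerivAt
  have dβ : ∀ t, HasDerivAt β (besselI t * g t) t := fun t =>
    ((Ic.mul gc).integral_hasStrictDerivAt (-R) t).hasDerivAt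
  have αc : Continuous α := continuous_iff_continuousAt.2 fun t => (dα t).continuousAt
  have βc : Continuous β := continuous_iff_continuousAt.2 fun t => (dβ t).continuousAt
  have α0 : ∀ t, R ≤ t → α t = 0 := fun t ht => by
    refine intervalIntegral.integral_zero_ae (Filter.Eventually.of_forall fun s hs => ?_)
    rw [Set.uIoc_of_le ht] at hs
    rw [gR s (hs.1.le.trans (le_abs_self s)), mul_zero]
  have β0 : ∀ t ≤ -R, β t = 0 := fun t ht => by
    refine intervalIntegral.integral_zero_ae (Filter.Eventually.of_forall fun s hs => ?_)
    rw [Set.uIoc_of_ge ht] at hs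
    rw [gR s (by rw [abs_of_nonpos] <;> linarith [hs.2]), mul_zero]
  have α1 : ∀ t ≤ -R, α t = α (-R) := fun t ht => by
    have : α t - α (-R) = ∫ s in (-R)..t, besselK s * g s :=
      intervalIntegral.integral_interval_sub_left ((Kc.mul gc).intervalIntegrable _ _)
        ((Kc.mul gc).intervalIntegrable _ _)
    have h0 : ∫ s in (-R)..t, besselK s * g s = 0 := by
      refine intervalIntegral.integral_zero_ae (Filter.Eventually.of_forall fun s hs => ?_)
      rw [Set.uIoc_of_ge ht] at hs
      rw [gR s (by rw [abs_of_nonpos] <;> linarith [hs.2]), mul_zero]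
    linarith
  have β1 : ∀ t, R ≤ t → β t = β R := fun t ht => by
    have : β t - β R = ∫ s in R..t, besselI s * g s :=
      intervalIntegral.integral_interval_sub_left ((Ic.mul gc).intervalIntegrable _ _)
        ((Ic.mul gc).intervalIntegrable _ _)
    have h0 : ∫ s in R..t, besselI s * g s = 0 := by
      refine intervalIntegral.integral_zero_ae (Filter.Eventually.of_forall fun s hs => ?_)
      rw [Set.uIoc_of_le ht] at hs
      rw [gR s (hs.1.le.trans (le_abs_self s)), mul_zero]
    linarith
  set V : ℝ → ℝ := fun t => besselI t * α t - besselK t * β t with hV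
  set V' : ℝ → ℝ := fun t => besselI' t * α t - besselK' t * β t with hV'
  have dV : ∀ t, HasDerivAt V (V' t) t := fun t => by
    refine (((hasDerivAt_besselI t).mul (dα t)).sub
      ((hasDerivAt_besselK t).mul (dβ t))).congr_deriv ?_
    simp only [hV']; ring
  have dV' : ∀ t, HasDerivAt V' ((1 + Real.exp t ^ 2) * V t + g t) t := fun t => by
    refine (((hasDerivAt_besselI' t).mul (dα t)).sub
      ((hasDerivAt_besselK' t).mul (dβ t))).congr_deriv ?_
    simp only [hV]
    -- The terms containing α' and β' sum to (I'K - IK')g, which is g by the Wronskian identity.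
    linear_combination g t * bessel_wronskian t
  have hVs : ContDiff ℝ ∞ V := contDiff_of_bessel_ode (by fun_prop) gs dV dV'
  have i1 : iteratedDeriv 1 V = V' := by
    rw [iteratedDeriv_one]; exact funext fun t => (dV t).deriv
  have i2 : iteratedDeriv 2 V = fun t => (1 + Real.exp t ^ 2) * V t + g t := by
    rw [show iteratedDeriv 2 V = deriv (iteratedDeriv 1 V) from iteratedDeriv_succ, i1]
    exact funext fun t => (dV' t).deriv
  have hbV : bessel V = F := by
    funext t
    have h2 : Real.exp (-2 * t) = (Real.exp t ^ 2)⁻¹ := by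
      rw [← Real.exp_nat_mul, ← Real.exp_neg]; congr 1; push_cast; ring
    have := (Real.exp_pos t).ne'
    rw [bessel, i2, h2]
    simp only [hg]
    field_simp
    ring
  have D0 : RapidDecay V := by
    refine RapidDecay.of_continuous hVs.continuous hR ?_ fun n => ?_
    · obtain ⟨C, hC⟩ := besselI_bounds hR
      refine ⟨C * |α (-R)|, fun t ht => ?_⟩
      simp only [hV]
      rw [β0 t ht, α1 t ht, mul_zero, sub_zero, abs_mul]
      nlinarith [mul_le_mul_of_nonneg_right (hC t ht).1 (abs_nonneg (α (-R)))]
    · obtain ⟨C, hC⟩ := besselK_bounds n hR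
      refine ⟨C * |β R|, fun t ht => ?_⟩
      simp only [hV]
      rw [α0 t ht, β1 t ht, mul_zero, zero_sub, abs_neg, abs_mul]
      nlinarith [mul_le_mul_of_nonneg_right (hC t ht).1 (abs_nonneg (β R))]
  have D1 : RapidDecay (iteratedDeriv 1 V) := by
    rw [i1]
    refine RapidDecay.of_continuous (by fun_prop) hR ?_ fun n => ?_
    · obtain ⟨C, hC⟩ := besselI_bounds hR
      refine ⟨C * |α (-R)|, fun t ht => ?_⟩
      simp only [hV']
      rw [β0 t ht, α1 t ht, mul_zero, sub_zero, abs_mul]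
      nlinarith [mul_le_mul_of_nonneg_right (hC t ht).2 (abs_nonneg (α (-R)))]
    · obtain ⟨C, hC⟩ := besselK_bounds n hR
      refine ⟨C * |β R|, fun t ht => ?_⟩
      simp only [hV']
      rw [α0 t ht, β1 t ht, mul_zero, zero_sub, abs_neg, abs_mul]
      nlinarith [mul_le_mul_of_nonneg_right (hC t ht).2 (abs_nonneg (β R))]
  refine ⟨V, hVs, hbV, fun k => ?_⟩
  -- The equation expresses the derivative of order k+2 through derivatives of F and V of order at
  -- most k; multiplication by e^{2t} preserves rapid decay.
  induction k using Nat.strong_induction_on with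
  | _ k ih =>
    match k with
    | 0 => simpa using D0
    | 1 => exact D1
    | k + 2 =>
      obtain ⟨C, hC⟩ := exists_abs_iteratedDeriv_exp_mul_le k 2
      have dF : ∀ j, RapidDecay (iteratedDeriv j F) := fun j =>
        RapidDecay.of_hasCompactSupport (contDiff_iteratedDeriv_infty hF j).continuous
          (iteratedDeriv_hasCompactSupport cF j)
      refine RapidDecay.of_le_sum (({()} : Finset Unit).disjSum
        ((Finset.range (k + 1)).disjSum (Finset.range (k + 1)))) (1 + C)
        (g := Sum.elim (fun _ => iteratedDeriv k V) (Sum.elim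
          (fun j t => Real.exp (2 * t) * iteratedDeriv j F t)
          (fun j t => Real.exp (2 * t) * iteratedDeriv j V t))) (by positivity) ?_ fun t => ?_
      · rintro (_ | j | j) hj
        · exact ih k (by omega)
        · exact (dF j).exp_two_mul
        · have : j < k + 1 := by simpa using hj
          exact (ih j (by omega)).exp_two_mul
      · have e0 : iteratedDeriv (k + 2) V t = iteratedDeriv k V t
            + iteratedDeriv k (fun t => Real.exp (2 * t) * (F t + V t)) t := by
          rw [← iteratedDeriv_iteratedDeriv V k 2, iteratedDeriv_two_eq_bessel, hbV,
            iteratedDeriv_add (contDiffAt_of_contDiff_infty hVs k t)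
            (contDiffAt_of_contDiff_infty (by fun_prop) k t)]
        have e1 : ∀ j, |iteratedDeriv j (fun t => F t + V t) t|
            ≤ |iteratedDeriv j F t| + |iteratedDeriv j V t| := by
          intro j
          have : iteratedDeriv j (fun t => F t + V t) t
              = iteratedDeriv j F t + iteratedDeriv j V t :=
            iteratedDeriv_add (contDiffAt_of_contDiff_infty hF j t)
              (contDiffAt_of_contDiff_infty hVs j t)
          rw [this]
          exact abs_add_le _ _
        rw [Finset.sum_disjSum, Finset.sum_disjSum, e0]
        simp only [Sum.elim_inl, Sum.elim_inr, Finset.sum_singleton, abs_mul, Real.abs_exp]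
        rw [← Finset.mul_sum, ← Finset.mul_sum]
        set SF := ∑ j ∈ Finset.range (k + 1), |iteratedDeriv j F t|
        set SV := ∑ j ∈ Finset.range (k + 1), |iteratedDeriv j V t|
        have e2 : ∑ j ∈ Finset.range (k + 1), |iteratedDeriv j (fun t => F t + V t) t|
            ≤ SF + SV := by
          rw [← Finset.sum_add_distrib]
          exact Finset.sum_le_sum fun j _ => e1 j
        have hSF : 0 ≤ SF := Finset.sum_nonneg fun _ _ => abs_nonneg _
        have hSV : 0 ≤ SV := Finset.sum_nonneg fun _ _ => abs_nonneg _
        have hX := Real.exp_pos (2 * t)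
        calc |iteratedDeriv k V t + iteratedDeriv k (fun t => Real.exp (2 * t) * (F t + V t)) t|
            ≤ |iteratedDeriv k V t| + C * Real.exp (2 * t) * (SF + SV) := by
              refine (abs_add_le _ _).trans (add_le_add le_rfl ((hC _ (hF.add hVs) t).trans ?_))
              gcongr
          _ ≤ _ := by
              have h1 := mul_nonneg C.coe_nonneg (abs_nonneg (iteratedDeriv k V t))
              have h2 : 0 ≤ Real.exp (2 * t) * (SF + SV) := by positivity
              nlinarith

/-! ### Finiteness of the norms and truncation -/

/-- At -∞ the integrand is O(e^{(σ+2)t}), square integrable because σ > -2. At +∞ one has M^σ ≤ 1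
because σ < 0, and the decay of f beats ⟨r⟩^γ. -/
theorem nrm_lt_top_of_rapidDecay {M : ℝ → ℝ} (hM : LogWeight M) (γ : ℝ) {σ : ℝ}
    (hσ : σ ∈ Set.Ioo (-2 : ℝ) 0) (k : ℕ) {f : ℝ → ℝ} (hf : Measurable f) (df : RapidDecay f) :
    nrm M γ (σ + k) (fun t => Real.exp (-(k * t)) * f t) < ⊤ := by
  obtain ⟨C0, hC0⟩ := df 0
  -- The exponent |γ| pays for ⟨r⟩^γ, two units pay for the Jacobian factor and the e^t in the decay
  -- bound, and one unit is left to give e^{-t}.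
  obtain ⟨n, hn⟩ := exists_nat_ge (|γ| + 3)
  obtain ⟨C1, hC1⟩ := df n
  set h : ℝ → ℝ := fun t => wt M γ (σ + k) t * (Real.exp (-(k * t)) * f t) with hh
  have hm : Measurable h := by
    have := wt_measurable hM γ (σ + k)
    fun_prop
  have hb : ∀ t, |h t| ≤ M t ^ σ * Real.sqrt (1 + Real.exp t ^ 2) ^ γ * Real.exp t * |f t| := by
    intro t
    have h1 := hM.shift_le σ t (Nat.zero_le k)
    simp only [Nat.cast_zero, add_zero, zero_mul, neg_zero, Real.exp_zero, mul_one] at h1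
    simp only [hh]
    rw [abs_mul, abs_mul, Real.abs_exp, abs_of_pos (wt_pos hM γ _ t), wt, ← mul_assoc]
    refine mul_le_mul_of_nonneg_right ?_ (abs_nonneg _)
    have hs : 0 ≤ Real.sqrt (1 + Real.exp t ^ 2) ^ γ * Real.exp t := by positivity
    calc _ = M t ^ (σ + k) * Real.exp (-(k * t))
          * (Real.sqrt (1 + Real.exp t ^ 2) ^ γ * Real.exp t) := by ring
      _ ≤ M t ^ σ * (Real.sqrt (1 + Real.exp t ^ 2) ^ γ * Real.exp t) :=
          mul_le_mul_of_nonneg_right h1 hs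
      _ = _ := by ring
  have hneg : ∀ t ≤ 0, |h t| ≤ 2 ^ |γ| * |C0| * Real.exp ((σ + 2) * t) := by
    intro t ht
    have hX := Real.exp_pos t
    have hX1 : Real.exp t ≤ 1 := Real.exp_le_one_iff.2 ht
    have m1 : M t ^ σ ≤ Real.exp (σ * t) := by
      rw [mul_comm, Real.exp_mul]
      refine Real.rpow_le_rpow_of_nonpos hX ?_ hσ.2.le
      have := hM.min_le t
      rwa [min_eq_right hX1] at this
    have b0 : 1 ≤ Real.sqrt (1 + Real.exp t ^ 2) := Real.one_le_sqrt.2 (by nlinarith)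
    have b1 : Real.sqrt (1 + Real.exp t ^ 2) ^ γ ≤ 2 ^ |γ| := by
      have := rpow_le_mul_rpow (K := 2) (lt_of_lt_of_le one_pos b0) one_pos two_pos
        (by rw [mul_one]; exact Real.sqrt_le_iff.2 ⟨by norm_num, by nlinarith⟩) (by linarith) γ
      simpa using this
    have f1 : |f t| ≤ |C0| * Real.exp t := by
      have := hC0 t
      simp only [Nat.cast_zero, zero_mul, Real.exp_zero, mul_one] at this
      exact this.trans (by gcongr; exact le_abs_self _)
    have e : Real.exp ((σ + 2) * t) = Real.exp (σ * t) * Real.exp t * Real.exp t := by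
      rw [← Real.exp_add, ← Real.exp_add]; congr 1; ring
    have := Real.rpow_nonneg (hM.pos t).le σ
    calc |h t| ≤ _ := hb t
      _ ≤ Real.exp (σ * t) * 2 ^ |γ| * Real.exp t * (|C0| * Real.exp t) := by gcongr
      _ = _ := by rw [e]; ring
  have hpos : ∀ t, 0 ≤ t → |h t| ≤ 2 ^ |γ| * |C1| * Real.exp (-1 * t) := by
    intro t ht
    have hX := Real.exp_pos t
    have hX1 : 1 ≤ Real.exp t := Real.one_le_exp ht
    have m1 : M t ^ σ ≤ 1 := by
      refine Real.rpow_le_one_of_one_le_of_nonpos ?_ hσ.2.le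
      have := hM.min_le t
      rwa [min_eq_left hX1] at this
    have b0 : 0 < Real.sqrt (1 + Real.exp t ^ 2) := by positivity
    have b2 : Real.exp t ≤ Real.sqrt (1 + Real.exp t ^ 2) := Real.le_sqrt_of_sq_le (by linarith)
    have b1 : Real.sqrt (1 + Real.exp t ^ 2) ^ γ ≤ 2 ^ |γ| * Real.exp (|γ| * t) := by
      have h1 := rpow_le_mul_rpow (K := 2) b0 hX two_pos
        (Real.sqrt_le_iff.2 ⟨by positivity, by nlinarith⟩)
        (b2.trans (by linarith)) γ
      refine h1.trans ?_
      rw [← Real.exp_mul, mul_comm t γ]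
      gcongr
      exact le_abs_self γ
    have f1 : |f t| ≤ |C1| * Real.exp t * Real.exp (-(n * t)) := by
      have := hC1 t
      rw [Real.exp_neg, ← div_eq_mul_inv, le_div_iff₀ (Real.exp_pos _)]
      exact this.trans (by gcongr; exact le_abs_self _)
    have e : Real.exp (|γ| * t) * Real.exp t * Real.exp t * Real.exp (-(n * t))
        ≤ Real.exp (-1 * t) := by
      rw [← Real.exp_add, ← Real.exp_add, ← Real.exp_add]
      refine Real.exp_le_exp.2 ?_
      nlinarith [mul_le_mul_of_nonneg_right hn ht]
    have := Real.rpow_nonneg (hM.pos t).le σ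
    calc |h t| ≤ _ := hb t
      _ ≤ 1 * (2 ^ |γ| * Real.exp (|γ| * t)) * Real.exp t
          * (|C1| * Real.exp t * Real.exp (-(n * t))) := by gcongr
      _ = 2 ^ |γ| * |C1|
          * (Real.exp (|γ| * t) * Real.exp t * Real.exp t * Real.exp (-(n * t))) := by ring
      _ ≤ _ := by gcongr
  have hsq : Integrable (fun t => h t ^ 2) volume := by
    rw [← integrableOn_univ, ← Set.Iic_union_Ioi (a := (0 : ℝ))]
    refine IntegrableOn.union ?_ ?_
    · have hi : IntegrableOn (fun t => (2 ^ |γ| * |C0|) ^ 2 * Real.exp ((2 * (σ + 2)) * t))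
          (Set.Iic 0) := (integrableOn_exp_mul_Iic (by linarith [hσ.1]) 0).const_mul _
      refine hi.mono' (hm.pow_const 2).aestronglyMeasurable
        ((ae_restrict_iff' measurableSet_Iic).2 (Filter.Eventually.of_forall fun t ht => ?_))
      rw [Real.norm_eq_abs, abs_pow]
      refine (pow_le_pow_left₀ (abs_nonneg _) (hneg t ht) 2).trans (le_of_eq ?_)
      rw [mul_pow, ← Real.exp_nat_mul]; congr 2; push_cast; ring
    · have hi : IntegrableOn (fun t => (2 ^ |γ| * |C1|) ^ 2 * Real.exp ((-2) * t))
          (Set.Ioi 0) := (integrableOn_exp_mul_Ioi (by norm_num) 0).const_mul _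
      refine hi.mono' (hm.pow_const 2).aestronglyMeasurable
        ((ae_restrict_iff' measurableSet_Ioi).2 (Filter.Eventually.of_forall fun t ht => ?_))
      rw [Real.norm_eq_abs, abs_pow]
      refine (pow_le_pow_left₀ (abs_nonneg _) (hpos t (le_of_lt ht)) 2).trans (le_of_eq ?_)
      rw [mul_pow, ← Real.exp_nat_mul]; congr 2; push_cast; ring
  exact ((memLp_two_iff_integrable_sq hm.aestronglyMeasurable).2 hsq).2

theorem sobNorm_lt_top_of_rapidDecay {M : ℝ → ℝ} (hM : LogWeight M) (γ : ℝ) {σ : ℝ}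
    (hσ : σ ∈ Set.Ioo (-2 : ℝ) 0) (s : ℕ) {V : ℝ → ℝ} (hV : ContDiff ℝ ∞ V)
    (dV : ∀ k, RapidDecay (iteratedDeriv k V)) : sobNorm M γ s σ V < ⊤ :=
  ENNReal.sum_lt_top.2 fun k _ =>
    nrm_lt_top_of_rapidDecay hM γ hσ k (iteratedDeriv_measurable hV k) (dV k)

theorem tendsto_eLpNorm_zero_of_dominated {α : Type*} [MeasurableSpace α] {μ : Measure α}
    {f : ℕ → α → ℝ} {G : α → ℝ} (hf : ∀ n, AEStronglyMeasurable (f n) μ) (hG : MemLp G 2 μ)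
    (hb : ∀ n x, |f n x| ≤ |G x|) (hlim : ∀ x, Filter.Tendsto (fun n => f n x) Filter.atTop (nhds 0)) :
    Filter.Tendsto (fun n => eLpNorm (f n) 2 μ) Filter.atTop (nhds 0) := by
  have e : ∀ u : α → ℝ, eLpNorm u 2 μ = (∫⁻ x, ‖u x‖ₑ ^ (2 : ℝ) ∂μ) ^ (1 / 2 : ℝ) := by
    intro u
    rw [eLpNorm_eq_lintegral_rpow_enorm_toReal (by norm_num) (by norm_num)]
    simp
  simp only [e]
  have hfin : ∫⁻ x, ‖G x‖ₑ ^ (2 : ℝ) ∂μ ≠ ⊤ := by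
    have := hG.2
    rw [e] at this
    intro h
    rw [h] at this
    simp at this
  have := tendsto_lintegral_of_dominated_convergence' (μ := μ) (F := fun n x => ‖f n x‖ₑ ^ (2 : ℝ))
    (f := fun _ => 0) (fun x => ‖G x‖ₑ ^ (2 : ℝ)) (fun n => (hf n).enorm.pow_const _)
    (fun n => Filter.Eventually.of_forall fun x => by
      refine ENNReal.rpow_le_rpow ?_ (by norm_num)
      rw [enorm_le_iff_norm_le]
      exact hb n x) hfin (Filter.Eventually.of_forall fun x => by
      have h1 := ((hlim x).enorm).ennrpow_const 2
      simpa using h1)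
  have h2 := this.ennrpow_const (1 / 2)
  simpa using h2

/-- Truncation in the variable `log r` approximates in the weighted Sobolev norm. -/
theorem exists_tendsto_sobNorm {M : ℝ → ℝ} (hM : LogWeight M) (γ σ : ℝ) (s : ℕ) {V : ℝ → ℝ}
    (hV : ContDiff ℝ ∞ V) (fV : sobNorm M γ s σ V < ⊤) :
    ∃ W : ℕ → ℝ → ℝ, (∀ n, ContDiff ℝ ∞ (W n)) ∧ (∀ n, HasCompactSupport (W n)) ∧
      Filter.Tendsto (fun n => sobNorm M γ s σ (W n - V)) Filter.atTop (nhds 0) := by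
  let η : ContDiffBump (0 : ℝ) := ⟨1, 2, one_pos, one_lt_two⟩
  have ηs : ContDiff ℝ ∞ η := η.contDiff
  have ηc : HasCompactSupport η := η.hasCompactSupport
  -- The cut-off is dilated in t rather than in r. As c n ≤ 1, its t-derivatives are bounded
  -- uniformly in n, so the commutator terms have an n-independent majorant.
  set c : ℕ → ℝ := fun n => ((n : ℝ) + 1)⁻¹ with hc
  have c0 : ∀ n, 0 < c n := fun n => by positivity
  have c1 : ∀ n, c n ≤ 1 := fun n => inv_le_one_of_one_le₀ (by linarith [(Nat.cast_nonneg n : (0:ℝ) ≤ n)])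
  have es : ∀ n, ContDiff ℝ ∞ fun t => η (c n * t) := fun n => by fun_prop
  have hB : ∀ k, ∃ B : ℝ, ∀ n t, |iteratedDeriv k (fun t => η (c n * t)) t| ≤ B := by
    intro k
    obtain ⟨B, hB⟩ := (contDiff_iteratedDeriv_infty ηs k).continuous.bounded_above_of_compact_support
      (iteratedDeriv_hasCompactSupport ηc k)
    refine ⟨B, fun n t => ?_⟩
    rw [iteratedDeriv_comp_const_mul (ηs.of_le (by exact_mod_cast le_top)), abs_mul, abs_pow,
      abs_of_pos (c0 n)]
    have h1 := hB (c n * t)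
    rw [Real.norm_eq_abs] at h1
    exact (mul_le_of_le_one_left (abs_nonneg _) (pow_le_one₀ (c0 n).le (c1 n))).trans h1
  choose B hB using hB
  set W : ℕ → ℝ → ℝ := fun n t => η (c n * t) * V t with hW
  have Ws : ∀ n, ContDiff ℝ ∞ (W n) := fun n => (es n).mul hV
  have Wc : ∀ n, HasCompactSupport (W n) := fun n =>
    (ηc.comp_homeomorph (Homeomorph.mulLeft₀ (c n) (c0 n).ne')).mul_right
  -- For each fixed t, the truncation eventually agrees with V on a neighbourhood of t, which gives
  -- pointwise convergence of all derivatives at once.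
  have hloc : ∀ t, ∀ᶠ n in Filter.atTop, ∀ k, iteratedDeriv k (W n - V) t = 0 := by
    intro t
    obtain ⟨N, hN⟩ := exists_nat_gt |t|
    filter_upwards [Filter.eventually_ge_atTop N] with n hn k
    have hev : W n - V =ᶠ[nhds t] fun _ => 0 := by
      have hlt : |c n * t| < 1 := by
        rw [abs_mul, abs_of_pos (c0 n), hc, inv_mul_lt_iff₀ (by positivity), mul_one]
        have : (N : ℝ) ≤ n := by exact_mod_cast hn
        linarith
      have hopen : IsOpen {u : ℝ | |c n * u| < 1} := isOpen_lt (by fun_prop) continuous_const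
      filter_upwards [hopen.mem_nhds hlt] with u hu
      have : η (c n * u) = 1 := η.one_of_mem_closedBall (by
        rw [Metric.mem_closedBall, dist_zero_right]; exact le_of_lt hu)
      simp [hW, this]
    rw [hev.iteratedDeriv_eq k]
    simp
  refine ⟨W, Ws, Wc, ?_⟩
  unfold sobNorm
  rw [show (0 : ℝ≥0∞) = ∑ k ∈ Finset.range (s + 1), 0 by simp]
  refine tendsto_finsetSum _ fun k hk => ?_
  have hks : k ≤ s := by have := Finset.mem_range.1 hk; omega
  set K : ℝ := 1 + ∑ j ∈ Finset.range (k + 1), (k.choose j : ℝ) * |B j| with hK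
  have hK0 : 0 ≤ K := by positivity
  have hpt : ∀ n t, |iteratedDeriv k (W n - V) t|
      ≤ K * ∑ j ∈ Finset.range (k + 1), |iteratedDeriv j V t| := by
    intro n t
    rw [iteratedDeriv_sub (contDiffAt_of_contDiff_infty (Ws n) k t)
      (contDiffAt_of_contDiff_infty hV k t)]
    refine (abs_sub _ _).trans ?_
    have h1 : |iteratedDeriv k V t| ≤ ∑ j ∈ Finset.range (k + 1), |iteratedDeriv j V t| :=
      Finset.single_le_sum (f := fun j => |iteratedDeriv j V t|) (fun _ _ => abs_nonneg _)
        (Finset.mem_range.2 (by omega))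
    have h2 : |iteratedDeriv k (W n) t| ≤ (∑ j ∈ Finset.range (k + 1), (k.choose j : ℝ) * |B j|)
        * ∑ j ∈ Finset.range (k + 1), |iteratedDeriv j V t| := by
      simp only [hW]
      rw [iteratedDeriv_fun_mul (contDiffAt_of_contDiff_infty (es n) k t)
        (contDiffAt_of_contDiff_infty hV k t), Finset.sum_mul]
      refine (Finset.abs_sum_le_sum_abs _ _).trans (Finset.sum_le_sum fun j hj => ?_)
      rw [abs_mul, abs_mul, Nat.abs_cast]
      have h3 : |iteratedDeriv (k - j) V t| ≤ ∑ j ∈ Finset.range (k + 1), |iteratedDeriv j V t| :=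
        Finset.single_le_sum (f := fun j => |iteratedDeriv j V t|) (fun _ _ => abs_nonneg _)
          (Finset.mem_range.2 (by omega))
      refine mul_le_mul (mul_le_mul_of_nonneg_left ?_ (Nat.cast_nonneg _)) h3 (abs_nonneg _)
        (by positivity)
      exact (hB j n t).trans (le_abs_self _)
    rw [hK, add_mul, one_mul]
    linarith
  -- Lower derivatives from the Leibniz rule arrive with the weight of order k; `shift_le` replaces
  -- it by their own weight of order j, for which the norm is finite.
  refine tendsto_eLpNorm_zero_of_dominated (G := fun t => ∑ j ∈ Finset.range (k + 1),
    K * |wt M γ (σ + j) t * (Real.exp (-(j * t)) * iteratedDeriv j V t)|) (fun n => ?_) ?_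
    (fun n t => ?_) fun t => ?_
  · exact ((wt_measurable hM γ _).mul (sobTerm_measurable ((Ws n).sub hV) k)).aestronglyMeasurable
  · refine memLp_finsetSum _ fun j hj => ?_
    have hj' : j ≤ s := by have := Finset.mem_range.1 hj; omega
    have : MemLp (fun t => wt M γ (σ + j) t * (Real.exp (-(j * t)) * iteratedDeriv j V t)) 2 volume :=
      ⟨((wt_measurable hM γ _).mul (sobTerm_measurable hV j)).aestronglyMeasurable,
        (nrm_le_sobNorm hj' V).trans_lt fV⟩
    exact this.abs.const_mul K
  · rw [abs_of_nonneg (show 0 ≤ ∑ j ∈ Finset.range (k + 1),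
      K * |wt M γ (σ + j) t * (Real.exp (-(j * t)) * iteratedDeriv j V t)| by positivity)]
    have hs : 0 ≤ Real.sqrt (1 + Real.exp t ^ 2) ^ γ * Real.exp t := by positivity
    have hw : ∀ j ≤ k, wt M γ (σ + k) t * Real.exp (-(k * t))
        ≤ wt M γ (σ + j) t * Real.exp (-(j * t)) := by
      intro j hj
      have := mul_le_mul_of_nonneg_right (hM.shift_le σ t hj) hs
      unfold wt
      calc _ = M t ^ (σ + k) * Real.exp (-(k * t))
            * (Real.sqrt (1 + Real.exp t ^ 2) ^ γ * Real.exp t) := by ring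
        _ ≤ _ := this
        _ = _ := by ring
    rw [abs_mul, abs_mul, Real.abs_exp, abs_of_pos (wt_pos hM γ _ t), ← mul_assoc]
    have hw0 := wt_pos hM γ (σ + k) t
    calc _ ≤ wt M γ (σ + k) t * Real.exp (-(k * t))
          * (K * ∑ j ∈ Finset.range (k + 1), |iteratedDeriv j V t|) := by
          gcongr; exact hpt n t
      _ = ∑ j ∈ Finset.range (k + 1),
          K * (wt M γ (σ + k) t * Real.exp (-(k * t)) * |iteratedDeriv j V t|) := by
          rw [Finset.mul_sum, Finset.mul_sum]
          exact Finset.sum_congr rfl fun j _ => by ring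
      _ ≤ _ := by
          refine Finset.sum_le_sum fun j hj => mul_le_mul_of_nonneg_left ?_ hK0
          rw [abs_mul, abs_mul, Real.abs_exp, abs_of_pos (wt_pos hM γ _ t), ← mul_assoc]
          exact mul_le_mul_of_nonneg_right (hw j (by have := Finset.mem_range.1 hj; omega))
            (abs_nonneg _)
  · refine tendsto_const_nhds.congr' ?_
    filter_upwards [hloc t] with n hn
    rw [hn k]; simp

/-! ### Lifts to the plane and their partial derivatives -/

/-- The radial function `V(log |x|)`. -/
def lift (V : ℝ → ℝ) (x : Plane) : ℝ := if x = 0 then 0 else V (Real.log ‖x‖)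

theorem lift_apply (V : ℝ → ℝ) {x : Plane} (hx : x ≠ 0) : lift V x = V (Real.log ‖x‖) :=
  if_neg hx

/-- Smoothness on the punctured plane. -/
def SmoothOff (f : Plane → ℝ) : Prop := ∀ x ≠ 0, ContDiffAt ℝ ∞ f x

theorem eventually_ne_zero {x : Plane} (hx : x ≠ 0) : ∀ᶠ y in nhds x, y ≠ 0 :=
  isOpen_ne.mem_nhds hx

theorem SmoothOff.pderiv {f : Plane → ℝ} (hf : SmoothOff f) (i : Fin 2) :
    SmoothOff (pderiv i f) := fun x hx =>
  ((hf x hx).fderiv_right (m := ∞) le_rfl).clm_apply contDiffAt_const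

theorem SmoothOff.differentiableAt {f : Plane → ℝ} (hf : SmoothOff f) {x : Plane} (hx : x ≠ 0) :
    DifferentiableAt ℝ f x := (hf x hx).differentiableAt (by simp)

theorem SmoothOff.mul {f g : Plane → ℝ} (hf : SmoothOff f) (hg : SmoothOff g) :
    SmoothOff fun x => f x * g x := fun x hx => (hf x hx).mul (hg x hx)

theorem SmoothOff.add {f g : Plane → ℝ} (hf : SmoothOff f) (hg : SmoothOff g) :
    SmoothOff fun x => f x + g x := fun x hx => (hf x hx).add (hg x hx)

theorem pderiv_congr_off {f g : Plane → ℝ} (h : ∀ x ≠ 0, f x = g x) (i : Fin 2) :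
    ∀ x ≠ 0, pderiv i f x = pderiv i g x := by
  intro x hx
  have : f =ᶠ[nhds x] g := (eventually_ne_zero hx).mono fun y hy => h y hy
  simp only [pderiv, this.fderiv_eq]

theorem pderiv_mul_of_differentiableAt (i : Fin 2) {f g : Plane → ℝ} {x : Plane}
    (hf : DifferentiableAt ℝ f x) (hg : DifferentiableAt ℝ g x) :
    pderiv i (fun x => f x * g x) x = pderiv i f x * g x + f x * pderiv i g x := by
  simp only [pderiv]
  rw [fderiv_fun_mul hf hg]
  simp
  ring

theorem pderiv_add_of_differentiableAt (i : Fin 2) {f g : Plane → ℝ} {x : Plane}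
    (hf : DifferentiableAt ℝ f x) (hg : DifferentiableAt ℝ g x) :
    pderiv i (fun x => f x + g x) x = pderiv i f x + pderiv i g x := by
  simp only [pderiv]
  rw [fderiv_fun_add hf hg]
  simp

/-- Iterated partial derivatives along a word of indices. -/
def wordDeriv : List (Fin 2) → (Plane → ℝ) → Plane → ℝ
  | [], f => f
  | i :: w, f => wordDeriv w (pderiv i f)

theorem wordDeriv_append (w w' : List (Fin 2)) (f : Plane → ℝ) :
    wordDeriv (w ++ w') f = wordDeriv w' (wordDeriv w f) := by
  induction w generalizing f with
  | nil => rfl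
  | cons i w ih => exact ih _

theorem wordDeriv_replicate (n : ℕ) (i : Fin 2) (f : Plane → ℝ) :
    wordDeriv (List.replicate n i) f = (pderiv i)^[n] f := by
  induction n generalizing f with
  | zero => rfl
  | succ n ih => exact ih _

/-- Words suit induction better than multi-indices: each step removes a single derivative, the first
one applied. -/
theorem multiDeriv_eq_wordDeriv (α : ℕ × ℕ) (f : Plane → ℝ) :
    multiDeriv α f = wordDeriv (List.replicate α.2 1 ++ List.replicate α.1 0) f := by
  rw [wordDeriv_append, wordDeriv_replicate, wordDeriv_replicate, multiDeriv]

theorem wordDeriv_congr_off (w : List (Fin 2)) {f g : Plane → ℝ} (h : ∀ x ≠ 0, f x = g x) :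
    ∀ x ≠ 0, wordDeriv w f x = wordDeriv w g x := by
  induction w generalizing f g with
  | nil => exact h
  | cons i w ih => exact ih (pderiv_congr_off h i)

theorem wordDeriv_add (w : List (Fin 2)) {f g : Plane → ℝ} (hf : SmoothOff f)
    (hg : SmoothOff g) : ∀ x ≠ 0, wordDeriv w (fun x => f x + g x) x
      = wordDeriv w f x + wordDeriv w g x := by
  induction w generalizing f g with
  | nil => exact fun _ _ => rfl
  | cons i w ih =>
    intro x hx
    have h1 : ∀ x ≠ 0, pderiv i (fun x => f x + g x) x = pderiv i f x + pderiv i g x :=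
      fun x hx => pderiv_add_of_differentiableAt i (hf.differentiableAt hx) (hg.differentiableAt hx)
    change wordDeriv w (pderiv i fun x => f x + g x) x = _
    rw [wordDeriv_congr_off w h1 x hx, ih (hf.pderiv i) (hg.pderiv i) x hx]
    rfl

theorem hasFDerivAt_log_norm {x : Plane} (hx : x ≠ 0) :
    HasFDerivAt (fun x : Plane => Real.log ‖x‖) ((‖x‖ ^ 2)⁻¹ • innerSL ℝ x) x := by
  have h1 : HasFDerivAt (fun x : Plane => ‖x‖ ^ 2) (2 • innerSL ℝ x) x :=
    (hasStrictFDerivAt_norm_sq x).hasFDerivAt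
  have hn : ‖x‖ ^ 2 ≠ 0 := by simpa using hx
  have h2 := (h1.log hn).const_mul (1 / 2 : ℝ)
  have e : (fun x : Plane => Real.log ‖x‖) = fun x : Plane => 1 / 2 * Real.log (‖x‖ ^ 2) := by
    funext y
    rw [Real.log_pow]; push_cast; ring
  rw [e]
  refine h2.congr_fderiv ?_
  ext v
  simp
  ring

theorem contDiffAt_log_norm {x : Plane} (hx : x ≠ 0) :
    ContDiffAt ℝ ∞ (fun x : Plane => Real.log ‖x‖) x :=
  (contDiffAt_norm ℝ hx).log (by simpa using hx)

theorem lift_eventuallyEq (V : ℝ → ℝ) {x : Plane} (hx : x ≠ 0) :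
    lift V =ᶠ[nhds x] fun x => V (Real.log ‖x‖) :=
  (eventually_ne_zero hx).mono fun _ hy => lift_apply V hy

theorem lift_smoothOff {V : ℝ → ℝ} (hV : ContDiff ℝ ∞ V) : SmoothOff (lift V) := fun _ hx =>
  (hV.contDiffAt.comp _ (contDiffAt_log_norm hx)).congr_of_eventuallyEq (lift_eventuallyEq V hx)

theorem pderiv_lift {V : ℝ → ℝ} (hV : ContDiff ℝ ∞ V) (i : Fin 2) {x : Plane} (hx : x ≠ 0) :
    pderiv i (lift V) x = x i / ‖x‖ ^ 2 * lift (deriv V) x := by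
  have h1 := ((hV.differentiable (by simp) (Real.log ‖x‖)).hasDerivAt).comp_hasFDerivAt x
    (hasFDerivAt_log_norm hx)
  have h2 := h1.congr_of_eventuallyEq (lift_eventuallyEq V hx)
  rw [pderiv, h2.fderiv, lift_apply _ hx]
  simp [EuclideanSpace.inner_single_right]
  ring

theorem norm_sq_plane (x : Plane) : ‖x‖ ^ 2 = x 0 ^ 2 + x 1 ^ 2 := by
  rw [EuclideanSpace.norm_sq_eq, Fin.sum_univ_two]; simp

theorem abs_coord_le (x : Plane) (i : Fin 2) : |x i| ≤ ‖x‖ := by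
  have := PiLp.norm_apply_le x i
  simpa using this

theorem coord_smoothOff (i : Fin 2) : SmoothOff fun x : Plane => x i / ‖x‖ ^ 2 := fun x hx =>
  ContDiffAt.div (by fun_prop) (contDiff_norm_sq ℝ).contDiffAt (by simpa using hx)

/-- The factor |x|^{-2} is written as a sum of squares of the functions x_i/|x|², so that the
derivative is visibly a polynomial in the generators of `HomCoef`. -/
theorem pderiv_coord (i j : Fin 2) {x : Plane} (hx : x ≠ 0) :
    pderiv j (fun x : Plane => x i / ‖x‖ ^ 2) x
      = (if i = j then 1 else 0) * (x 0 / ‖x‖ ^ 2 * (x 0 / ‖x‖ ^ 2)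
          + x 1 / ‖x‖ ^ 2 * (x 1 / ‖x‖ ^ 2)) + -2 * (x i / ‖x‖ ^ 2 * (x j / ‖x‖ ^ 2)) := by
  have hn : ‖x‖ ^ 2 ≠ 0 := by simpa using hx
  have h1 : HasFDerivAt (fun x : Plane => ‖x‖ ^ 2) (2 • innerSL ℝ x) x :=
    (hasStrictFDerivAt_norm_sq x).hasFDerivAt
  have h0 : HasFDerivAt (fun x : Plane => x i) (EuclideanSpace.proj (𝕜 := ℝ) i) x :=
    (EuclideanSpace.proj (𝕜 := ℝ) i).hasFDerivAt
  have h2 := h0.mul ((hasDerivAt_inv hn).comp_hasFDerivAt x h1)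
  have e : (fun x : Plane => x i / ‖x‖ ^ 2) = (fun x : Plane => x i)
      * ((fun y : ℝ => y⁻¹) ∘ fun x : Plane => ‖x‖ ^ 2) := by
    funext y; rfl
  rw [pderiv, e, h2.fderiv]
  have h3 : x 0 / ‖x‖ ^ 2 * (x 0 / ‖x‖ ^ 2) + x 1 / ‖x‖ ^ 2 * (x 1 / ‖x‖ ^ 2) = (‖x‖ ^ 2)⁻¹ := by
    have := norm_sq_plane x
    field_simp
    linarith
  rw [h3]
  simp [EuclideanSpace.inner_single_right]
  split_ifs with h
  · field_simp
    ring
  · field_simp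
    ring

/-- Homogeneous coefficients of degree `-n`. -/
inductive HomCoef : ℕ → (Plane → ℝ) → Prop
  | const (c : ℝ) : HomCoef 0 fun _ => c
  | coord (i : Fin 2) : HomCoef 1 fun x => x i / ‖x‖ ^ 2
  | mul {n k : ℕ} {f g : Plane → ℝ} : HomCoef n f → HomCoef k g →
      HomCoef (n + k) fun x => f x * g x
  | add {n : ℕ} {f g : Plane → ℝ} : HomCoef n f → HomCoef n g → HomCoef n fun x => f x + g x

theorem HomCoef.smoothOff {n : ℕ} {g : Plane → ℝ} (h : HomCoef n g) : SmoothOff g := by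
  induction h with
  | const c => exact fun _ _ => contDiffAt_const
  | coord i => exact coord_smoothOff i
  | mul _ _ h1 h2 => exact h1.mul h2
  | add _ _ h1 h2 => exact h1.add h2

theorem HomCoef.bound {n : ℕ} {g : Plane → ℝ} (h : HomCoef n g) :
    ∃ C : ℝ≥0, ∀ x ≠ 0, |g x| * ‖x‖ ^ n ≤ C := by
  induction h with
  | const c => exact ⟨‖c‖₊, fun x _ => by simp⟩
  | coord i =>
    refine ⟨1, fun x hx => ?_⟩
    have hn : 0 < ‖x‖ := norm_pos_iff.2 hx
    rw [abs_div, abs_of_pos (pow_pos hn 2), pow_one, div_mul_eq_mul_div, div_le_iff₀ (by positivity)]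
    have := abs_coord_le x i
    push_cast
    nlinarith
  | mul _ _ h1 h2 =>
    obtain ⟨C1, h1⟩ := h1
    obtain ⟨C2, h2⟩ := h2
    refine ⟨C1 * C2, fun x hx => ?_⟩
    rw [abs_mul, pow_add, mul_mul_mul_comm]
    push_cast
    exact mul_le_mul (h1 x hx) (h2 x hx) (by positivity) (by positivity)
  | add _ _ h1 h2 =>
    obtain ⟨C1, h1⟩ := h1
    obtain ⟨C2, h2⟩ := h2
    refine ⟨C1 + C2, fun x hx => ?_⟩
    push_cast
    refine le_trans ?_ (add_le_add (h1 x hx) (h2 x hx))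
    rw [← add_mul]
    gcongr
    exact abs_add_le _ _

theorem HomCoef.pderiv {n : ℕ} {g : Plane → ℝ} (h : HomCoef n g) (i : Fin 2) :
    ∃ g', HomCoef (n + 1) g' ∧ ∀ x ≠ 0, pderiv i g x = g' x := by
  induction h with
  | const c =>
    -- The derivative of a constant must be presented in degree one, hence as zero times a
    -- generator.
    refine ⟨_, (HomCoef.const 0).mul (HomCoef.coord 0), fun x _ => ?_⟩
    simp [DoublyWeighted.pderiv]
  | coord j =>
    refine ⟨_, ((HomCoef.const (if j = i then 1 else 0)).mul
      (((HomCoef.coord 0).mul (HomCoef.coord 0)).add ((HomCoef.coord 1).mul (HomCoef.coord 1)))).add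
      ((HomCoef.const (-2)).mul ((HomCoef.coord j).mul (HomCoef.coord i))), fun x hx => ?_⟩
    exact pderiv_coord j i hx
  | @mul n k f g hf hg h1 h2 =>
    obtain ⟨f', hf', e1⟩ := h1
    obtain ⟨g', hg', e2⟩ := h2
    have a1 := hf'.mul hg
    have a2 := hf.mul hg'
    rw [show n + 1 + k = n + k + 1 by ring] at a1
    rw [← add_assoc] at a2
    refine ⟨_, a1.add a2, fun x hx => ?_⟩
    rw [pderiv_mul_of_differentiableAt i (hf.smoothOff.differentiableAt hx)
      (hg.smoothOff.differentiableAt hx), e1 x hx, e2 x hx]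
  | add hf hg h1 h2 =>
    obtain ⟨f', hf', e1⟩ := h1
    obtain ⟨g', hg', e2⟩ := h2
    refine ⟨_, hf'.add hg', fun x hx => ?_⟩
    rw [pderiv_add_of_differentiableAt i (hf.smoothOff.differentiableAt hx)
      (hg.smoothOff.differentiableAt hx), e1 x hx, e2 x hx]

/-- One partial derivative of g·V^{(j)}(log |x|) gives (∂_i g)V^{(j)} + g·(x_i/|x|²)V^{(j+1)}. Both
terms have the same shape with the degree of the coefficient raised by one, so induction on the word
closes, with a constant independent of V. -/
theorem exists_wordDeriv_lift_le (w : List (Fin 2)) {n : ℕ} {g : Plane → ℝ} (hg : HomCoef n g)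
    (j : ℕ) : ∃ C : ℝ≥0, ∀ V : ℝ → ℝ, ContDiff ℝ ∞ V → ∀ x ≠ 0,
      |wordDeriv w (fun x => g x * lift (iteratedDeriv j V) x) x| * ‖x‖ ^ (n + w.length)
        ≤ C * ∑ l ∈ Finset.range (j + w.length + 1), |iteratedDeriv l V (Real.log ‖x‖)| := by
  induction w generalizing n g j with
  | nil =>
    obtain ⟨C, hC⟩ := hg.bound
    refine ⟨C, fun V hV x hx => ?_⟩
    have h1 : |iteratedDeriv j V (Real.log ‖x‖)|
        ≤ ∑ l ∈ Finset.range (j + 1), |iteratedDeriv l V (Real.log ‖x‖)| :=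
      Finset.single_le_sum (f := fun l => |iteratedDeriv l V (Real.log ‖x‖)|)
        (fun _ _ => abs_nonneg _) (Finset.mem_range.2 (by omega))
    simp only [wordDeriv, List.length_nil, add_zero]
    rw [lift_apply _ hx, abs_mul, mul_right_comm]
    exact mul_le_mul (hC x hx) h1 (abs_nonneg _) C.2
  | cons i w ih =>
    obtain ⟨g', hg', e⟩ := hg.pderiv i
    obtain ⟨C1, h1⟩ := ih hg' j
    obtain ⟨C2, h2⟩ := ih (hg.mul (HomCoef.coord i)) (j + 1)
    refine ⟨C1 + C2, fun V hV x hx => ?_⟩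
    have hVj := contDiff_iteratedDeriv_infty hV
    have e1 : ∀ x ≠ 0, pderiv i (fun x => g x * lift (iteratedDeriv j V) x) x
        = g' x * lift (iteratedDeriv j V) x
          + (g x * (x i / ‖x‖ ^ 2)) * lift (iteratedDeriv (j + 1) V) x := by
      intro x hx
      rw [pderiv_mul_of_differentiableAt i (hg.smoothOff.differentiableAt hx)
        ((lift_smoothOff (hVj j)).differentiableAt hx), e x hx, pderiv_lift (hVj j) i hx,
        ← iteratedDeriv_succ]
      ring
    have e2 := wordDeriv_congr_off w e1 x hx
    rw [wordDeriv_add w (hg'.smoothOff.mul (lift_smoothOff (hVj j)))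
      ((hg.mul (HomCoef.coord i)).smoothOff.mul (lift_smoothOff (hVj (j + 1)))) x hx] at e2
    change |wordDeriv w (pderiv i fun x => g x * lift (iteratedDeriv j V) x) x| * _ ≤ _
    rw [e2]
    have h1' := h1 V hV x hx
    have h2' := h2 V hV x hx
    simp only [List.length_cons]
    rw [show n + 1 + w.length = n + (w.length + 1) by ring] at h1' h2'
    rw [show j + 1 + w.length + 1 = j + (w.length + 1) + 1 by ring] at h2'
    have hsub : ∑ l ∈ Finset.range (j + w.length + 1), |iteratedDeriv l V (Real.log ‖x‖)|
        ≤ ∑ l ∈ Finset.range (j + (w.length + 1) + 1), |iteratedDeriv l V (Real.log ‖x‖)| :=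
      Finset.sum_le_sum_of_subset_of_nonneg (Finset.range_subset_range.2 (by omega))
        fun _ _ _ => abs_nonneg _
    push_cast
    rw [add_mul]
    refine le_trans ?_ (add_le_add (h1'.trans (mul_le_mul_of_nonneg_left hsub C1.2)) h2')
    rw [← add_mul]
    gcongr
    exact abs_add_le _ _

theorem exists_multiDeriv_lift_le (α : ℕ × ℕ) : ∃ C : ℝ≥0, ∀ V : ℝ → ℝ, ContDiff ℝ ∞ V →
    ∀ x ≠ 0, |multiDeriv α (lift V) x| * ‖x‖ ^ (α.1 + α.2)
      ≤ C * ∑ l ∈ Finset.range (α.1 + α.2 + 1), |iteratedDeriv l V (Real.log ‖x‖)| := by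
  obtain ⟨C, hC⟩ := exists_wordDeriv_lift_le (List.replicate α.2 1 ++ List.replicate α.1 0)
    (HomCoef.const 1) 0
  refine ⟨C, fun V hV x hx => ?_⟩
  have h := hC V hV x hx
  simp only [one_mul, iteratedDeriv_zero, List.length_append, List.length_replicate, zero_add] at h
  rw [multiDeriv_eq_wordDeriv, add_comm α.1]
  exact h

/-- Compact support in t = log |x| places the support in an annulus, so the lift vanishes near the
origin and no smoothness question arises there. -/
theorem lift_contDiff {V : ℝ → ℝ} (hV : ContDiff ℝ ∞ V) (cV : HasCompactSupport V) :
    ContDiff ℝ ∞ (lift V) := by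
  rw [contDiff_iff_contDiffAt]
  intro x
  by_cases hx : x = 0
  · subst hx
    obtain ⟨R, hR, h⟩ := exists_support_bound cV
    have : lift V =ᶠ[nhds 0] fun _ => 0 := by
      filter_upwards [Metric.ball_mem_nhds (0 : Plane) (Real.exp_pos (-R))] with y hy
      by_cases hy0 : y = 0
      · exact if_pos hy0
      · rw [lift_apply _ hy0]
        rw [mem_ball_zero_iff] at hy
        have h1 : Real.log ‖y‖ ≤ -R :=
          (Real.log_le_iff_le_exp (norm_pos_iff.2 hy0)).2 hy.le
        exact h _ (by rw [abs_of_nonpos] <;> linarith)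
    exact contDiffAt_const.congr_of_eventuallyEq this
  · exact lift_smoothOff hV x hx

theorem lift_hasCompactSupport {V : ℝ → ℝ} (cV : HasCompactSupport V) :
    HasCompactSupport (lift V) := by
  obtain ⟨R, hR, h⟩ := exists_support_bound cV
  refine HasCompactSupport.intro (isCompact_closedBall (0 : Plane) (Real.exp R)) fun x hx => ?_
  rw [mem_closedBall_zero_iff, not_le] at hx
  have hx0 : x ≠ 0 := by
    rintro rfl
    rw [norm_zero] at hx
    exact absurd hx (Real.exp_pos R).not_gt
  rw [lift_apply _ hx0]
  have h1 : R ≤ Real.log ‖x‖ := (Real.le_log_iff_exp_le (norm_pos_iff.2 hx0)).2 hx.le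
  exact h _ (h1.trans (le_abs_self _))

theorem pderiv_pderiv_lift {V : ℝ → ℝ} (hV : ContDiff ℝ ∞ V) (i j : Fin 2) {x : Plane}
    (hx : x ≠ 0) : pderiv j (pderiv i (lift V)) x
      = ((if i = j then 1 else 0) / ‖x‖ ^ 2 - 2 * (x i * x j) / ‖x‖ ^ 4) * lift (deriv V) x
        + x i * x j / ‖x‖ ^ 4 * lift (iteratedDeriv 2 V) x := by
  have h1 := pderiv_congr_off (fun x hx => pderiv_lift hV i hx) j x hx
  have hV' : ContDiff ℝ ∞ (deriv V) := (contDiff_infty_iff_deriv.1 hV).2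
  rw [h1, pderiv_mul_of_differentiableAt j ((coord_smoothOff i).differentiableAt hx)
    ((lift_smoothOff hV').differentiableAt hx), pderiv_coord i j hx, pderiv_lift hV' j hx,
    show iteratedDeriv 2 V = deriv (deriv V) by rw [iteratedDeriv_succ, iteratedDeriv_one]]
  have h3 : x 0 / ‖x‖ ^ 2 * (x 0 / ‖x‖ ^ 2) + x 1 / ‖x‖ ^ 2 * (x 1 / ‖x‖ ^ 2) = 1 / ‖x‖ ^ 2 := by
    have := norm_sq_plane x
    have hn : ‖x‖ ≠ 0 := by simpa using hx
    field_simp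
    linarith
  have hn : ‖x‖ ≠ 0 := by simpa using hx
  rw [h3]
  field_simp
  ring

/-- For u = V(log r) the radial derivatives are V'/r and (V'' - V')/r², so the first-order terms
cancel and r^{-2}(V'' - V) - V remains. The right-hand side is arranged like `deltaOneSubId`. -/
theorem lift_bessel {V : ℝ → ℝ} (hV : ContDiff ℝ ∞ V) {x : Plane} (hx : x ≠ 0) :
    lift (bessel V) x
      = (x 0 ^ 2 / ‖x‖ ^ 2) * multiDeriv (2, 0) (lift V) x
        + 2 * (x 0 * x 1 / ‖x‖ ^ 2) * multiDeriv (1, 1) (lift V) x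
        + (x 1 ^ 2 / ‖x‖ ^ 2) * multiDeriv (0, 2) (lift V) x
        + (1 / ‖x‖) * ((x 0 / ‖x‖) * multiDeriv (1, 0) (lift V) x
          + (x 1 / ‖x‖) * multiDeriv (0, 1) (lift V) x)
        - (1 / ‖x‖ ^ 2) * multiDeriv (0, 0) (lift V) x - multiDeriv (0, 0) (lift V) x := by
  have e20 : multiDeriv (2, 0) (lift V) x = pderiv 0 (pderiv 0 (lift V)) x := rfl
  have e11 : multiDeriv (1, 1) (lift V) x = pderiv 0 (pderiv 1 (lift V)) x := rfl
  have e02 : multiDeriv (0, 2) (lift V) x = pderiv 1 (pderiv 1 (lift V)) x := rfl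
  have e10 : multiDeriv (1, 0) (lift V) x = pderiv 0 (lift V) x := rfl
  have e01 : multiDeriv (0, 1) (lift V) x = pderiv 1 (lift V) x := rfl
  have e00 : multiDeriv (0, 0) (lift V) x = lift V x := rfl
  rw [e20, e11, e02, e10, e01, e00, pderiv_pderiv_lift hV 0 0 hx, pderiv_pderiv_lift hV 1 0 hx,
    pderiv_pderiv_lift hV 1 1 hx, pderiv_lift hV 0 hx, pderiv_lift hV 1 hx]
  have hn : 0 < ‖x‖ := norm_pos_iff.2 hx
  have hs := norm_sq_plane x
  have h2 : Real.exp (-2 * Real.log ‖x‖) = (‖x‖ ^ 2)⁻¹ := by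
    rw [← Real.exp_log hn, Real.log_exp, ← Real.exp_nat_mul, ← Real.exp_neg]
    congr 1; push_cast; ring
  simp only [lift_apply _ hx, bessel, h2]
  set r := ‖x‖
  set A := iteratedDeriv 2 V (Real.log r)
  set B := deriv V (Real.log r)
  set D := V (Real.log r)
  simp only [if_true, if_neg (show ¬ (1 : Fin 2) = 0 by decide)]
  have hr : r ≠ 0 := hn.ne'
  field_simp
  have h1 : x 1 ^ 2 = r ^ 2 - x 0 ^ 2 := by linarith
  rw [h1]
  linear_combination (-2 * x 0 ^ 2 * (A - 2 * B)) * h1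

/-! ### Polar coordinates and the weights in the plane -/

/-- Polar coordinates followed by r = e^t, under which r dr becomes e^{2t} dt. -/
theorem lintegral_norm_plane {G : ℝ → ℝ≥0∞} (hG : Measurable G) :
    ∫⁻ x : Plane, G ‖x‖ = (volume : Measure Plane).toSphere Set.univ
      * ∫⁻ t, ENNReal.ofReal (Real.exp t ^ 2) * G (Real.exp t) := by
  have hd : Module.finrank ℝ Plane - 1 = 1 := by simp
  calc ∫⁻ x : Plane, G ‖x‖
      = ∫⁻ x : ({(0)}ᶜ : Set Plane), G ‖x.1‖ ∂((volume : Measure Plane).comap (↑)) := by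
        rw [lintegral_subtype_comap (measurableSet_singleton _).compl fun x => G ‖x‖,
          restrict_compl_singleton]
    _ = ∫⁻ x, G x.2 ∂(volume : Measure Plane).toSphere.prod (.volumeIoiPow 1) := by
        have h := ((volume : Measure Plane).measurePreserving_homeomorphUnitSphereProd).lintegral_comp
          (f := fun x => G x.2) (by fun_prop)
        rw [hd] at h
        rw [← h]
        simp
    _ = (volume : Measure Plane).toSphere Set.univ
        * ∫⁻ y : Set.Ioi (0 : ℝ), G y ∂.volumeIoiPow 1 := by
        have h := lintegral_prod_mul (μ := (volume : Measure Plane).toSphere)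
          (ν := Measure.volumeIoiPow 1) (f := fun _ => 1) (g := fun y => G y) (by fun_prop)
          (by fun_prop)
        simpa using h
    _ = _ := by
        congr 1
        rw [Measure.volumeIoiPow, lintegral_withDensity_eq_lintegral_mul _ (by fun_prop)
          (by fun_prop)]
        simp only [Pi.mul_apply, pow_one]
        rw [lintegral_subtype_comap measurableSet_Ioi fun y : ℝ => ENNReal.ofReal y * G y,
          ← Real.range_exp, ← Set.image_univ,
          lintegral_image_eq_lintegral_abs_deriv_mul MeasurableSet.univ
            (fun t _ => (Real.hasDerivAt_exp t).hasDerivWithinAt) Real.exp_injective.injOn,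
          Measure.restrict_univ]
        refine lintegral_congr fun t => ?_
        rw [← mul_assoc, Real.abs_exp, ← ENNReal.ofReal_mul (Real.exp_pos t).le, pow_two]

theorem ae_ne_zero_plane : ∀ᵐ x : Plane, x ≠ 0 := by
  rw [ae_iff]; simp

/-- The weight `m` in the variable `t = log |x|`. -/
def mLog (χ : Plane → ℝ) (t : ℝ) : ℝ := m χ (EuclideanSpace.single 0 (Real.exp t))

section Weights

variable {χ : Plane → ℝ}

theorem m_eq_of_norm_eq (hχ : IsCutoff χ) {x y : Plane} (h : ‖x‖ = ‖y‖) : m χ x = m χ y := by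
  rw [m, m, hχ.radial x y h, h]

theorem mLog_log (hχ : IsCutoff χ) {x : Plane} (hx : x ≠ 0) :
    mLog χ (Real.log ‖x‖) = m χ x := by
  refine m_eq_of_norm_eq hχ ?_
  rw [PiLp.norm_single, Real.norm_eq_abs, Real.abs_exp, Real.exp_log (norm_pos_iff.2 hx)]

theorem logWeight_mLog (hχ : IsCutoff χ) : LogWeight (mLog χ) := by
  have hn : ∀ t, ‖(EuclideanSpace.single 0 (Real.exp t) : Plane)‖ = Real.exp t := fun t => by
    rw [PiLp.norm_single, Real.norm_eq_abs, Real.abs_exp]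
  have key : ∀ t, mLog χ t ≤ Real.exp t ∧ mLog χ t ≤ 2 ∧ min 1 (Real.exp t) ≤ mLog χ t := by
    intro t
    have h1 := hχ.mem_Icc (EuclideanSpace.single 0 (Real.exp t))
    have h2 := hχ.eq_zero (EuclideanSpace.single 0 (Real.exp t))
    have h3 := hχ.eq_one (EuclideanSpace.single 0 (Real.exp t))
    have hX := Real.exp_pos t
    rw [hn] at h2 h3
    unfold mLog m
    rw [hn]
    set c := χ (EuclideanSpace.single 0 (Real.exp t))
    set X := Real.exp t
    obtain ⟨c0, c1⟩ := h1
    rcases lt_or_ge X 1 with h | h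
    · rw [h2 h, min_eq_right h.le]; simp; linarith
    rcases lt_or_ge 2 X with h' | h'
    · rw [h3 h', min_eq_left h]; simp; linarith
    · rw [min_eq_left h]
      refine ⟨by nlinarith, by nlinarith, by nlinarith⟩
  refine ⟨?_, fun t => (key t).1, fun t => (key t).2.1, fun t => (key t).2.2⟩
  have hc : Continuous χ := hχ.smooth.continuous
  have hs : Continuous fun t : ℝ => (EuclideanSpace.single 0 (Real.exp t) : Plane) := by
    refine (PiLp.continuous_toLp 2 _).comp (continuous_pi fun i => ?_)
    by_cases h : i = 0
    · subst h; simpa using Real.continuous_exp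
    · simpa [Pi.single_apply, h] using continuous_const
  unfold mLog m
  exact Continuous.measurable (by fun_prop)

theorem m_pos (hχ : IsCutoff χ) {x : Plane} (hx : x ≠ 0) : 0 < m χ x := by
  rw [← mLog_log hχ hx]; exact (logWeight_mLog hχ).pos _

theorem m_continuous (hχ : IsCutoff χ) : Continuous (m χ) := by
  have := hχ.smooth.continuous
  unfold m
  fun_prop

theorem bracket_pos (x : Plane) : 0 < bracket x := Real.sqrt_pos.2 (by positivity)

theorem bracket_continuous : Continuous bracket := by
  unfold bracket; fun_prop

/-- The density `m^τ ⟨x⟩^γ`. -/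
def dens (χ : Plane → ℝ) (γ τ : ℝ) (x : Plane) : ℝ := m χ x ^ τ * bracket x ^ γ

theorem dens_pos (hχ : IsCutoff χ) (γ τ : ℝ) {x : Plane} (hx : x ≠ 0) : 0 < dens χ γ τ x :=
  mul_pos (Real.rpow_pos_of_pos (m_pos hχ hx) _) (Real.rpow_pos_of_pos (bracket_pos x) _)

theorem dens_measurable (hχ : IsCutoff χ) (γ τ : ℝ) : Measurable (dens χ γ τ) := by
  have h1 := (m_continuous hχ).measurable
  have h2 := bracket_continuous.measurable
  unfold dens
  fun_prop

theorem dens_continuousAt (hχ : IsCutoff χ) (γ τ : ℝ) {x : Plane} (hx : x ≠ 0) :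
    ContinuousAt (dens χ γ τ) x :=
  ((m_continuous hχ).continuousAt.rpow_const (Or.inl (m_pos hχ hx).ne')).mul
    (bracket_continuous.continuousAt.rpow_const (Or.inl (bracket_pos x).ne'))

theorem lintegral_weighted (hχ : IsCutoff χ) (γ τ : ℝ) (f : Plane → ℝ≥0∞) :
    ∫⁻ x, f x ∂weighted χ γ τ = ∫⁻ x, ENNReal.ofReal (dens χ γ τ x ^ 2) * f x :=
  lintegral_withDensity_eq_lintegral_mul_non_measurable _
    (((dens_measurable hχ γ τ).pow_const 2).ennreal_ofReal)
    (Filter.Eventually.of_forall fun _ => ENNReal.ofReal_lt_top) f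

/-- The density is positive off the origin, so every weighted measure has the null sets of Lebesgue
measure. Almost everywhere statements can therefore pass between the weights attached to different
derivatives. -/
theorem ae_weighted_iff (hχ : IsCutoff χ) (γ τ : ℝ) {p : Plane → Prop} :
    (∀ᵐ x ∂weighted χ γ τ, p x) ↔ ∀ᵐ x, p x := by
  have h0 : ∀ᵐ x : Plane, ENNReal.ofReal (dens χ γ τ x ^ 2) ≠ 0 := by
    filter_upwards [ae_ne_zero_plane] with x hx
    have := dens_pos hχ γ τ hx
    simp only [ne_eq, ENNReal.ofReal_eq_zero, not_le]
    positivity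
  change (∀ᵐ x ∂volume.withDensity fun x => ENNReal.ofReal (dens χ γ τ x ^ 2), p x) ↔ _
  rw [ae_withDensity_iff (((dens_measurable hχ γ τ).pow_const 2).ennreal_ofReal)]
  constructor
  · intro h
    filter_upwards [h, h0] with x h1 h2 using h1 h2
  · intro h
    filter_upwards [h] with x h1 _ using h1

theorem ae_weighted (hχ : IsCutoff χ) (γ τ : ℝ) :
    ae (weighted χ γ τ) = ae (volume : Measure Plane) := by
  ext s
  exact ae_weighted_iff hχ γ τ

theorem aestronglyMeasurable_weighted_iff (hχ : IsCutoff χ) (γ τ : ℝ) {f : Plane → ℝ} :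
    AEStronglyMeasurable f (weighted χ γ τ) ↔ AEStronglyMeasurable f volume := by
  have h1 : weighted χ γ τ ≪ volume := withDensity_absolutelyContinuous _ _
  have h2 : (volume : Measure Plane) ≪ weighted χ γ τ :=
    Measure.ae_le_iff_absolutelyContinuous.1 (ae_weighted hχ γ τ).ge
  exact ⟨fun h => h.mono_ac h2, fun h => h.mono_ac h1⟩

theorem eLpNorm_weighted (hχ : IsCutoff χ) (γ τ : ℝ) (f : Plane → ℝ) :
    eLpNorm f 2 (weighted χ γ τ) = eLpNorm (fun x => dens χ γ τ x * f x) 2 volume := by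
  rw [eLpNorm_eq_lintegral_rpow_enorm_toReal (by norm_num) (by norm_num),
    eLpNorm_eq_lintegral_rpow_enorm_toReal (by norm_num) (by norm_num), lintegral_weighted hχ]
  congr 1
  refine lintegral_congr fun x => ?_
  rw [enorm_mul, ENNReal.mul_rpow_of_nonneg _ _ (by norm_num), Real.enorm_eq_ofReal_abs (dens χ γ τ x),
    ENNReal.ofReal_rpow_of_nonneg (abs_nonneg _) (by norm_num)]
  congr 2
  simp

/-- The polar coordinates constant, the square root of the length of the unit circle. -/
def polarConst : ℝ≥0∞ := (volume : Measure Plane).toSphere Set.univ ^ (1 / 2 : ℝ)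

theorem polarConst_ne_top : polarConst ≠ ⊤ :=
  ENNReal.rpow_ne_top_of_nonneg (by norm_num) (measure_ne_top _ _)

theorem polarConst_ne_zero : polarConst ≠ 0 := by
  unfold polarConst
  simp [Real.pi_pos]

/-- The square root of the Jacobian e^{2t} is the factor e^t in `wt`; the integral over angles
contributes only `polarConst`. -/
theorem eLpNorm_radial (hχ : IsCutoff χ) (γ τ : ℝ) {F : Plane → ℝ} {f : ℝ → ℝ}
    (hf : Measurable f) (h : ∀ x ≠ 0, F x = f (Real.log ‖x‖)) :
    eLpNorm F 2 (weighted χ γ τ) = polarConst * nrm (mLog χ) γ τ f := by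
  rw [eLpNorm_weighted hχ, nrm, eLpNorm_eq_lintegral_rpow_enorm_toReal (by norm_num) (by norm_num),
    eLpNorm_eq_lintegral_rpow_enorm_toReal (by norm_num) (by norm_num), polarConst]
  simp only [ENNReal.toReal_ofNat]
  rw [← ENNReal.mul_rpow_of_nonneg _ _ (by norm_num)]
  congr 1
  set K : ℝ → ℝ := fun t => mLog χ t ^ τ * Real.sqrt (1 + Real.exp t ^ 2) ^ γ * f t with hK
  have hKm : Measurable K := by
    have := (logWeight_mLog hχ).meas
    fun_prop
  have e1 : ∀ x : Plane, x ≠ 0 → dens χ γ τ x * F x = K (Real.log ‖x‖) := by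
    intro x hx
    simp only [hK]
    rw [h x hx, dens, bracket, mLog_log hχ hx, Real.exp_log (norm_pos_iff.2 hx)]
  calc ∫⁻ x : Plane, ‖dens χ γ τ x * F x‖ₑ ^ (2 : ℝ)
      = ∫⁻ x : Plane, ‖K (Real.log ‖x‖)‖ₑ ^ (2 : ℝ) :=
        lintegral_congr_ae (ae_ne_zero_plane.mono fun x hx => by simp only [e1 x hx])
    _ = _ := by
        rw [lintegral_norm_plane (G := fun r => ‖K (Real.log r)‖ₑ ^ (2 : ℝ)) (by fun_prop)]
        congr 1
        refine lintegral_congr fun t => ?_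
        have e2 : wt (mLog χ) γ τ t * f t = Real.exp t * K t := by
          simp only [hK, wt]; ring
        rw [Real.log_exp, e2, enorm_mul (Real.exp t), ENNReal.mul_rpow_of_nonneg _ _ (by norm_num),
          Real.enorm_eq_ofReal_abs (Real.exp t), Real.abs_exp,
          ENNReal.ofReal_rpow_of_nonneg (Real.exp_pos t).le (by norm_num)]
        simp

theorem exp_neg_mul_log_norm {x : Plane} (hx : x ≠ 0) (k : ℕ) :
    Real.exp (-(k * Real.log ‖x‖)) = (‖x‖ ^ k)⁻¹ := by
  rw [Real.exp_neg, Real.exp_nat_mul, Real.exp_log (norm_pos_iff.2 hx)]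

theorem dens_shift_le (hχ : IsCutoff χ) (γ τ : ℝ) {x : Plane} (hx : x ≠ 0) {j k : ℕ} (h : j ≤ k) :
    dens χ γ (τ + k) x * (‖x‖ ^ k)⁻¹ ≤ dens χ γ (τ + j) x * (‖x‖ ^ j)⁻¹ := by
  have h1 := (logWeight_mLog hχ).shift_le τ (Real.log ‖x‖) h
  rw [mLog_log hχ hx, exp_neg_mul_log_norm hx, exp_neg_mul_log_norm hx] at h1
  have h2 := mul_le_mul_of_nonneg_right h1 (Real.rpow_nonneg (bracket_pos x).le γ)
  unfold dens
  calc _ = m χ x ^ (τ + k) * (‖x‖ ^ k)⁻¹ * bracket x ^ γ := by ring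
    _ ≤ _ := h2
    _ = _ := by ring

/-- One half of the norm equivalence. The pointwise bound puts |x|^{-|α|} in front of every
derivative of V of order l ≤ |α|, and `dens_shift_le` trades this for the weight of order l. -/
theorem eLpNorm_multiDeriv_lift_le (hχ : IsCutoff χ) (γ σ : ℝ) (α : ℕ × ℕ) :
    ∃ C : ℝ≥0, ∀ V : ℝ → ℝ, ContDiff ℝ ∞ V →
      eLpNorm (multiDeriv α (lift V)) 2 (weighted χ γ (σ + ((α.1 + α.2 : ℕ) : ℝ)))
        ≤ C * (polarConst * sobNorm (mLog χ) γ (α.1 + α.2) σ V) := by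
  obtain ⟨C, hC⟩ := exists_multiDeriv_lift_le α
  refine ⟨C, fun V hV => ?_⟩
  set k := α.1 + α.2 with hk
  have hm : ∀ l : ℕ, Measurable fun x : Plane =>
      Real.exp (-(l * Real.log ‖x‖)) * iteratedDeriv l V (Real.log ‖x‖) := fun l => by
    have := iteratedDeriv_measurable hV l
    fun_prop
  rw [eLpNorm_weighted hχ]
  have h1 := eLpNorm_le_mul_sum (μ := (volume : Measure Plane)) (Finset.range (k + 1)) C
    (F := fun x => dens χ γ (σ + k) x * multiDeriv α (lift V) x)
    (G := fun l x => dens χ γ (σ + l) x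
      * (Real.exp (-(l * Real.log ‖x‖)) * iteratedDeriv l V (Real.log ‖x‖)))
    (fun l _ => ((dens_measurable hχ γ _).mul (hm l)).aestronglyMeasurable)
    (ae_ne_zero_plane.mono fun x hx => ?_)
  · refine h1.trans ?_
    gcongr
    rw [sobNorm, Finset.mul_sum]
    refine Finset.sum_le_sum fun l _ => ?_
    rw [← eLpNorm_weighted hχ, eLpNorm_radial hχ γ _ (sobTerm_measurable hV l) fun x hx => rfl]
  · have h2 := hC V hV x hx
    have hn : 0 < ‖x‖ := norm_pos_iff.2 hx
    have hd := dens_pos hχ γ (σ + k) hx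
    rw [← le_div_iff₀ (by positivity)] at h2
    rw [abs_mul, abs_of_pos hd]
    calc dens χ γ (σ + k) x * |multiDeriv α (lift V) x|
        ≤ dens χ γ (σ + k) x
          * (C * (∑ l ∈ Finset.range (k + 1), |iteratedDeriv l V (Real.log ‖x‖)|) / ‖x‖ ^ k) := by
          gcongr
      _ = C * ∑ l ∈ Finset.range (k + 1),
          (dens χ γ (σ + k) x * (‖x‖ ^ k)⁻¹) * |iteratedDeriv l V (Real.log ‖x‖)| := by
          rw [← Finset.mul_sum]; ring
      _ ≤ _ := by
          refine mul_le_mul_of_nonneg_left (Finset.sum_le_sum fun l hl => ?_) C.2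
          have hl' : l ≤ k := by have := Finset.mem_range.1 hl; omega
          rw [abs_mul, abs_mul, abs_of_pos (dens_pos hχ γ _ hx), Real.abs_exp,
            exp_neg_mul_log_norm hx, ← mul_assoc]
          exact mul_le_mul_of_nonneg_right (dens_shift_le hχ γ σ hx hl') (abs_nonneg _)

end Weights

/-! ### Circle means -/

/-- The point with polar coordinates `(r, θ)`. -/
def polarPt (r θ : ℝ) : Plane := !₂[r * Real.cos θ, r * Real.sin θ]

theorem norm_polarPt {r : ℝ} (hr : 0 ≤ r) (θ : ℝ) : ‖polarPt r θ‖ = r := by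
  have h : ‖polarPt r θ‖ ^ 2 = r ^ 2 := by
    rw [norm_sq_plane]
    simp only [polarPt, PiLp.toLp_apply, Matrix.cons_val_zero, Matrix.cons_val_one]
    linear_combination r ^ 2 * Real.cos_sq_add_sin_sq θ
  exact (pow_left_inj₀ (norm_nonneg _) hr two_ne_zero).1 h

theorem polarPt_continuous : Continuous fun p : ℝ × ℝ => polarPt p.1 p.2 := by
  refine (PiLp.continuous_toLp 2 _).comp (continuous_pi fun i => ?_)
  fin_cases i
  · exact (by fun_prop : Continuous fun p : ℝ × ℝ => p.1 * Real.cos p.2)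
  · exact (by fun_prop : Continuous fun p : ℝ × ℝ => p.1 * Real.sin p.2)

/-- The mean of `φ` over the circle of radius `e^t`. -/
def circMean (φ : Plane → ℝ) (t : ℝ) : ℝ :=
  (2 * Real.pi)⁻¹ * ∫ θ in (0)..(2 * Real.pi), φ (polarPt (Real.exp t) θ)

/-- The Euler operator `x · ∇`. -/
def euler (φ : Plane → ℝ) (x : Plane) : ℝ := x 0 * pderiv 0 φ x + x 1 * pderiv 1 φ x

theorem euler_contDiff {φ : Plane → ℝ} (h : ContDiff ℝ ∞ φ) : ContDiff ℝ ∞ (euler φ) := by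
  have h0 := pderiv_smooth 0 h
  have h1 := pderiv_smooth 1 h
  unfold euler
  fun_prop

theorem pderiv_hasCompactSupport (i : Fin 2) {φ : Plane → ℝ} (c : HasCompactSupport φ) :
    HasCompactSupport (pderiv i φ) :=
  c.fderiv_apply ℝ (EuclideanSpace.single i 1)

theorem euler_hasCompactSupport {φ : Plane → ℝ} (c : HasCompactSupport φ) :
    HasCompactSupport (euler φ) :=
  ((pderiv_hasCompactSupport 0 c).mul_left).add ((pderiv_hasCompactSupport 1 c).mul_left)

theorem euler_eq_fderiv (φ : Plane → ℝ) (x : Plane) : euler φ x = fderiv ℝ φ x x := by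
  have e : x = x 0 • EuclideanSpace.single 0 (1 : ℝ) + x 1 • EuclideanSpace.single 1 (1 : ℝ) := by
    ext i
    fin_cases i <;> simp
  have h : fderiv ℝ φ x x = fderiv ℝ φ x
      (x 0 • EuclideanSpace.single 0 (1 : ℝ) + x 1 • EuclideanSpace.single 1 (1 : ℝ)) :=
    congrArg _ e
  rw [h, map_add, map_smul, map_smul]
  rfl

/-- Along the ray t ↦ e^t(cos θ, sin θ) the derivative of φ is x·∇φ, which is bounded by compact
support, so differentiation under the integral is allowed. -/
theorem hasDerivAt_circMean {φ : Plane → ℝ} (h : ContDiff ℝ ∞ φ) (c : HasCompactSupport φ)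
    (t : ℝ) : HasDerivAt (circMean φ) (circMean (euler φ) t) t := by
  obtain ⟨B, hB⟩ := (euler_contDiff h).continuous.bounded_above_of_compact_support
    (euler_hasCompactSupport c)
  have hpc : ∀ s, Continuous fun θ => polarPt (Real.exp s) θ := fun s =>
    polarPt_continuous.comp (by fun_prop : Continuous fun θ : ℝ => (Real.exp s, θ))
  have hd : ∀ θ s, HasDerivAt (fun s => φ (polarPt (Real.exp s) θ))
      (euler φ (polarPt (Real.exp s) θ)) s := by
    intro θ s
    have e : ∀ r, polarPt r θ = r • polarPt 1 θ := by
      intro r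
      ext i
      fin_cases i <;> simp [polarPt]
    have h1 : HasDerivAt (fun s => polarPt (Real.exp s) θ) (polarPt (Real.exp s) θ) s := by
      rw [e (Real.exp s)]
      simp_rw [e (Real.exp _)]
      exact (Real.hasDerivAt_exp s).smul_const _
    rw [euler_eq_fderiv]
    exact ((h.differentiable (by simp) _).hasFDerivAt).comp_hasDerivAt s h1
  have key := intervalIntegral.hasDerivAt_integral_of_dominated_loc_of_deriv_le
    (μ := volume) (a := 0) (b := 2 * Real.pi) (s := Set.univ) (x₀ := t)
    (F := fun s θ => φ (polarPt (Real.exp s) θ))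
    (F' := fun s θ => euler φ (polarPt (Real.exp s) θ)) (bound := fun _ => B) Filter.univ_mem
    (Filter.Eventually.of_forall fun s => (h.continuous.comp (hpc s)).aestronglyMeasurable)
    ((h.continuous.comp (hpc t)).intervalIntegrable _ _)
    ((euler_contDiff h).continuous.comp (hpc t)).aestronglyMeasurable
    (Filter.Eventually.of_forall fun θ _ s _ => hB _)
    intervalIntegrable_const
    (Filter.Eventually.of_forall fun θ _ s _ => hd θ s)
  exact key.2.const_mul _

theorem euler_iterate_contDiff {φ : Plane → ℝ} (h : ContDiff ℝ ∞ φ) (k : ℕ) :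
    ContDiff ℝ ∞ (euler^[k] φ) := by
  induction k generalizing φ with
  | zero => exact h
  | succ k ih => exact ih (euler_contDiff h)

theorem iteratedDeriv_circMean (k : ℕ) {φ : Plane → ℝ} (h : ContDiff ℝ ∞ φ)
    (c : HasCompactSupport φ) : iteratedDeriv k (circMean φ) = circMean (euler^[k] φ) := by
  induction k generalizing φ with
  | zero => simp
  | succ k ih =>
    rw [iteratedDeriv_succ', funext fun t => (hasDerivAt_circMean h c t).deriv,
      ih (euler_contDiff h) (euler_hasCompactSupport c)]
    rfl

theorem circMean_contDiff {φ : Plane → ℝ} (h : ContDiff ℝ ∞ φ) (c : HasCompactSupport φ) :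
    ContDiff ℝ ∞ (circMean φ) := by
  rw [contDiff_infty]
  intro n
  induction n generalizing φ with
  | zero =>
    rw [Nat.cast_zero, contDiff_zero]
    exact continuous_iff_continuousAt.2 fun t => (hasDerivAt_circMean h c t).continuousAt
  | succ n ih =>
    push_cast
    rw [contDiff_succ_iff_deriv, funext fun t => (hasDerivAt_circMean h c t).deriv]
    exact ⟨fun t => (hasDerivAt_circMean h c t).differentiableAt, fun h => absurd h (by simp),
      ih (euler_contDiff h) (euler_hasCompactSupport c)⟩

theorem circMean_sub {φ ψ : Plane → ℝ} (h : Continuous φ) (h' : Continuous ψ) :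
    circMean (φ - ψ) = circMean φ - circMean ψ := by
  funext t
  have hpc : Continuous fun θ => polarPt (Real.exp t) θ :=
    polarPt_continuous.comp (by fun_prop : Continuous fun θ : ℝ => (Real.exp t, θ))
  simp only [circMean, Pi.sub_apply]
  have i1 : IntervalIntegrable (fun θ => φ (polarPt (Real.exp t) θ)) volume 0 (2 * Real.pi) :=
    (h.comp hpc).intervalIntegrable _ _
  have i2 : IntervalIntegrable (fun θ => ψ (polarPt (Real.exp t) θ)) volume 0 (2 * Real.pi) :=
    (h'.comp hpc).intervalIntegrable _ _
  rw [intervalIntegral.integral_sub i1 i2, mul_sub]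

theorem pderiv_comm {φ : Plane → ℝ} (h : ContDiff ℝ ∞ φ) (i j : Fin 2) :
    pderiv i (pderiv j φ) = pderiv j (pderiv i φ) := by
  funext x
  have hd : DifferentiableAt ℝ (fderiv ℝ φ) x :=
    (h.fderiv_right (m := ∞) le_rfl).differentiable (by simp) x
  have e : ∀ i j, pderiv i (pderiv j φ) x
      = fderiv ℝ (fderiv ℝ φ) x (EuclideanSpace.single i 1) (EuclideanSpace.single j 1) := by
    intro i j
    have : pderiv j φ = fun y => fderiv ℝ φ y (EuclideanSpace.single j 1) := rfl
    rw [this, pderiv, fderiv_clm_apply hd (differentiableAt_const _)]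
    simp
  rw [e, e]
  exact (h.contDiffAt.isSymmSndFDerivAt
    (by simp only [minSmoothness_of_isRCLikeNormedField]; exact WithTop.coe_le_coe.2 le_top)).eq _ _

theorem pderiv_one_iterate {φ : Plane → ℝ} (h : ContDiff ℝ ∞ φ) (a : ℕ) :
    pderiv 1 ((pderiv 0)^[a] φ) = (pderiv 0)^[a] (pderiv 1 φ) := by
  induction a generalizing φ with
  | zero => rfl
  | succ a ih =>
    simp only [Function.iterate_succ, Function.comp_apply]
    rw [ih (pderiv_smooth 0 h), pderiv_comm h]

theorem pderiv_zero_multiDeriv (a b : ℕ) (φ : Plane → ℝ) :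
    pderiv 0 (multiDeriv (a, b) φ) = multiDeriv (a + 1, b) φ := by
  simp only [multiDeriv]
  rw [Function.iterate_succ_apply']

theorem pderiv_one_multiDeriv (a b : ℕ) {φ : Plane → ℝ} (h : ContDiff ℝ ∞ φ) :
    pderiv 1 (multiDeriv (a, b) φ) = multiDeriv (a, b + 1) φ := by
  simp only [multiDeriv]
  rw [pderiv_one_iterate (iter_smooth 1 b h), Function.iterate_succ_apply' (pderiv 1)]

theorem multiDeriv_smooth (α : ℕ × ℕ) {φ : Plane → ℝ} (h : ContDiff ℝ ∞ φ) :
    ContDiff ℝ ∞ (multiDeriv α φ) := iter_smooth 0 _ (iter_smooth 1 _ h)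

theorem euler_add {f g : Plane → ℝ} (hf : ContDiff ℝ ∞ f) (hg : ContDiff ℝ ∞ g) :
    euler (f + g) = euler f + euler g := by
  funext x
  simp only [euler, pderiv_add _ hf hg, Pi.add_apply]
  ring

theorem euler_smul (c : ℝ) {f : Plane → ℝ} (hf : ContDiff ℝ ∞ f) :
    euler (c • f) = c • euler f := by
  funext x
  simp only [euler, pderiv_smul _ c hf, Pi.smul_apply, smul_eq_mul]
  ring

theorem euler_iterate_add (k : ℕ) {f g : Plane → ℝ} (hf : ContDiff ℝ ∞ f)
    (hg : ContDiff ℝ ∞ g) : euler^[k] (f + g) = euler^[k] f + euler^[k] g := by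
  induction k generalizing f g with
  | zero => rfl
  | succ k ih =>
    simp only [Function.iterate_succ, Function.comp_apply]
    rw [euler_add hf hg, ih (euler_contDiff hf) (euler_contDiff hg)]

theorem euler_iterate_smul (k : ℕ) (c : ℝ) {f : Plane → ℝ} (hf : ContDiff ℝ ∞ f) :
    euler^[k] (c • f) = c • euler^[k] f := by
  induction k generalizing f with
  | zero => rfl
  | succ k ih =>
    simp only [Function.iterate_succ, Function.comp_apply]
    rw [euler_smul c hf, ih (euler_contDiff hf)]

/-- The function `x^α D^α φ`. -/
def monDeriv (a b : ℕ) (φ : Plane → ℝ) (x : Plane) : ℝ :=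
  x 0 ^ a * x 1 ^ b * multiDeriv (a, b) φ x

theorem monDeriv_contDiff (a b : ℕ) {φ : Plane → ℝ} (h : ContDiff ℝ ∞ φ) :
    ContDiff ℝ ∞ (monDeriv a b φ) := by
  have := multiDeriv_smooth (a, b) h
  unfold monDeriv
  fun_prop

/-- The monomial x^α is homogeneous of degree a + b, which gives the first term; the other two come
from differentiating D^αφ. The family x^αD^αφ is thus stable under x·∇. -/
theorem euler_monDeriv (a b : ℕ) {φ : Plane → ℝ} (h : ContDiff ℝ ∞ φ) :
    euler (monDeriv a b φ)
      = ((a + b : ℝ) • monDeriv a b φ + monDeriv (a + 1) b φ) + monDeriv a (b + 1) φ := by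
  funext x
  have hm := (multiDeriv_smooth (a, b) h).differentiable (by simp) x
  have h0 : HasFDerivAt (fun x : Plane => x 0) (EuclideanSpace.proj (𝕜 := ℝ) 0) x :=
    (EuclideanSpace.proj (𝕜 := ℝ) 0).hasFDerivAt
  have h1 : HasFDerivAt (fun x : Plane => x 1) (EuclideanSpace.proj (𝕜 := ℝ) 1) x :=
    (EuclideanSpace.proj (𝕜 := ℝ) 1).hasFDerivAt
  have hp := (h0.pow a).mul (h1.pow b)
  have hpd : DifferentiableAt ℝ (fun x : Plane => x 0 ^ a * x 1 ^ b) x := hp.differentiableAt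
  have e : ∀ i, pderiv i (monDeriv a b φ) x
      = pderiv i (fun x : Plane => x 0 ^ a * x 1 ^ b) x * multiDeriv (a, b) φ x
        + x 0 ^ a * x 1 ^ b * pderiv i (multiDeriv (a, b) φ) x := fun i =>
    pderiv_mul_of_differentiableAt i hpd hm
  have e0 : pderiv 0 (fun x : Plane => x 0 ^ a * x 1 ^ b) x = a * x 0 ^ (a - 1) * x 1 ^ b := by
    have hf : fderiv ℝ (fun x : Plane => x 0 ^ a * x 1 ^ b) x = _ := hp.fderiv
    rw [pderiv, hf]
    simp
    ring
  have e1 : pderiv 1 (fun x : Plane => x 0 ^ a * x 1 ^ b) x = b * x 0 ^ a * x 1 ^ (b - 1) := by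
    have hf : fderiv ℝ (fun x : Plane => x 0 ^ a * x 1 ^ b) x = _ := hp.fderiv
    rw [pderiv, hf]
    simp
    ring
  have p0 : x 0 * (a * x 0 ^ (a - 1)) = a * x 0 ^ a := by
    cases a with
    | zero => simp
    | succ a => rw [Nat.add_sub_cancel, pow_succ]; ring
  have p1 : x 1 * (b * x 1 ^ (b - 1)) = b * x 1 ^ b := by
    cases b with
    | zero => simp
    | succ b => rw [Nat.add_sub_cancel, pow_succ]; ring
  simp only [euler, e, e0, e1, pderiv_zero_multiDeriv, pderiv_one_multiDeriv a b h, monDeriv,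
    Pi.add_apply, Pi.smul_apply, smul_eq_mul]
  linear_combination (x 1 ^ b * multiDeriv (a, b) φ x) * p0
    + (x 0 ^ a * multiDeriv (a, b) φ x) * p1

/-- The multi-indices of order at most `s`. -/
def indices (s : ℕ) : Finset (ℕ × ℕ) :=
  (Finset.range (s + 1) ×ˢ Finset.range (s + 1)).filter fun α => α.1 + α.2 ≤ s

theorem mem_indices {s : ℕ} {α : ℕ × ℕ} : α ∈ indices s ↔ α.1 + α.2 ≤ s := by
  simp only [indices, Finset.mem_filter, Finset.mem_product, Finset.mem_range]
  omega

/-- Iterating `euler_monDeriv` raises the order of α by at most one each time, and |x^α| ≤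
|x|^{|α|}. The case a = b = 0 is the one needed; general a, b make the induction work. -/
theorem exists_euler_monDeriv_le (k a b : ℕ) : ∃ C : ℝ≥0, ∀ φ : Plane → ℝ, ContDiff ℝ ∞ φ →
    ∀ x, |(euler^[k] (monDeriv a b φ)) x|
      ≤ C * ∑ α ∈ indices (k + a + b), ‖x‖ ^ (α.1 + α.2) * |multiDeriv α φ x| := by
  induction k generalizing a b with
  | zero =>
    refine ⟨1, fun φ _ x => ?_⟩
    have h1 : ‖x‖ ^ (a + b) * |multiDeriv (a, b) φ x|
        ≤ ∑ α ∈ indices (0 + a + b), ‖x‖ ^ (α.1 + α.2) * |multiDeriv α φ x| :=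
      Finset.single_le_sum (f := fun α : ℕ × ℕ => ‖x‖ ^ (α.1 + α.2) * |multiDeriv α φ x|)
        (fun _ _ => by positivity) (mem_indices.2 (by simp) : (a, b) ∈ indices (0 + a + b))
    rw [NNReal.coe_one, one_mul]
    refine le_trans ?_ h1
    simp only [Function.iterate_zero, id, monDeriv]
    rw [abs_mul, abs_mul, abs_pow, abs_pow, pow_add]
    gcongr <;> exact abs_coord_le x _
  | succ k ih =>
    obtain ⟨C1, h1⟩ := ih a b
    obtain ⟨C2, h2⟩ := ih (a + 1) b
    obtain ⟨C3, h3⟩ := ih a (b + 1)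
    refine ⟨(a + b) * C1 + C2 + C3, fun φ hφ x => ?_⟩
    have s0 := monDeriv_contDiff a b hφ
    have s1 := monDeriv_contDiff (a + 1) b hφ
    have s2 := monDeriv_contDiff a (b + 1) hφ
    have s0' : ContDiff ℝ ∞ ((a + b : ℝ) • monDeriv a b φ) :=
      contDiff_const.smul s0
    have s01 : ContDiff ℝ ∞ ((a + b : ℝ) • monDeriv a b φ + monDeriv (a + 1) b φ) := s0'.add s1
    rw [Function.iterate_succ_apply, euler_monDeriv a b hφ, euler_iterate_add k s01 s2,
      euler_iterate_add k s0' s1, euler_iterate_smul k _ s0]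
    simp only [Pi.add_apply, Pi.smul_apply, smul_eq_mul]
    have h1 := h1 φ hφ x
    have h2 := h2 φ hφ x
    have h3 := h3 φ hφ x
    rw [show k + (a + 1) + b = k + 1 + a + b by ring] at h2
    rw [show k + a + (b + 1) = k + 1 + a + b by ring] at h3
    set S := ∑ α ∈ indices (k + 1 + a + b), ‖x‖ ^ (α.1 + α.2) * |multiDeriv α φ x| with hS
    have hsub : ∑ α ∈ indices (k + a + b), ‖x‖ ^ (α.1 + α.2) * |multiDeriv α φ x| ≤ S :=
      Finset.sum_le_sum_of_subset_of_nonneg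
        (fun α hα => mem_indices.2 (by have := mem_indices.1 hα; omega))
        fun _ _ _ => by positivity
    have h1' := h1.trans (mul_le_mul_of_nonneg_left hsub C1.coe_nonneg)
    have hab : (0 : ℝ) ≤ a + b := by positivity
    refine (abs_add_three _ _ _).trans ?_
    rw [abs_mul, abs_of_nonneg hab]
    push_cast
    have := mul_le_mul_of_nonneg_left h1' hab
    nlinarith

theorem exists_euler_iterate_le (k : ℕ) : ∃ C : ℝ≥0, ∀ φ : Plane → ℝ, ContDiff ℝ ∞ φ →
    ∀ x, |(euler^[k] φ) x| ≤ C * ∑ α ∈ indices k, ‖x‖ ^ (α.1 + α.2) * |multiDeriv α φ x| := by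
  obtain ⟨C, hC⟩ := exists_euler_monDeriv_le k 0 0
  refine ⟨C, fun φ hφ x => ?_⟩
  have h := hC φ hφ x
  have e : monDeriv 0 0 φ = φ := by
    funext y; simp [monDeriv, multiDeriv]
  rwa [e] at h

theorem lintegral_plane_eq {g : Plane → ℝ≥0∞} (hg : Measurable g) :
    ∫⁻ x, g x = ∫⁻ r in Set.Ioi (0 : ℝ), ∫⁻ θ in Set.Ioo (-Real.pi) Real.pi,
      ENNReal.ofReal r * g (polarPt r θ) := by
  have h1 := (PiLp.volume_preserving_toLp (Fin 2)).lintegral_comp hg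
  have hm : Measurable fun p : ℝ × ℝ => g !₂[p.1, p.2] := by
    refine hg.comp ((PiLp.continuous_toLp 2 _).comp (continuous_pi fun i => ?_)).measurable
    fin_cases i
    · exact continuous_fst
    · exact continuous_snd
  have h2 := (volume_preserving_finTwoArrow ℝ).lintegral_comp hm
  have h3 : ∀ y : Fin 2 → ℝ, g !₂[(MeasurableEquiv.finTwoArrow y).1,
      (MeasurableEquiv.finTwoArrow y).2] = g (WithLp.toLp 2 y) := by
    intro y
    congr 2
    funext i
    fin_cases i <;> rfl
  simp only [h3] at h2
  have h4 := lintegral_comp_polarCoord_symm fun p : ℝ × ℝ => g !₂[p.1, p.2]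
  rw [← h1, h2, ← h4, polarCoord_target, Measure.volume_eq_prod, ← Measure.prod_restrict,
    lintegral_prod _ ?_]
  · rfl
  · exact (measurable_fst.ennreal_ofReal.mul
      (hm.comp continuous_polarCoord_symm.measurable)).aemeasurable

theorem ae_ae_polarPt {p : Plane → Prop} (h : ∀ᵐ x, p x) :
    ∀ᵐ r ∂(volume.restrict (Set.Ioi (0 : ℝ))),
      ∀ᵐ θ ∂(volume.restrict (Set.Ioo (-Real.pi) Real.pi)), p (polarPt r θ) := by
  obtain ⟨N, hN, mN, nN⟩ := exists_measurable_superset_of_null (ae_iff.1 h)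
  have hg : Measurable (N.indicator fun _ : Plane => (1 : ℝ≥0∞)) := measurable_const.indicator mN
  have h0 := lintegral_plane_eq hg
  rw [lintegral_indicator_const mN, nN, mul_zero] at h0
  have hpm := hg.comp polarPt_continuous.measurable
  have hm : Measurable fun p : ℝ × ℝ =>
      ENNReal.ofReal p.1 * N.indicator (fun _ => (1 : ℝ≥0∞)) (polarPt p.1 p.2) :=
    measurable_fst.ennreal_ofReal.mul hpm
  have h1 := (lintegral_eq_zero_iff hm.lintegral_prod_right').1 h0.symm
  filter_upwards [h1, ae_restrict_mem measurableSet_Ioi] with r hr hr0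
  have h2 := (lintegral_eq_zero_iff (hm.comp measurable_prodMk_left)).1 hr
  filter_upwards [h2] with θ hθ
  by_contra hp
  have hmem : polarPt r θ ∈ N := hN hp
  have hr0' : 0 < r := hr0
  simp [hmem, hr0'.not_ge] at hθ

theorem circMean_log {φ : Plane → ℝ} {r : ℝ} (hr : 0 < r) :
    circMean φ (Real.log r)
      = (2 * Real.pi)⁻¹ * ∫ θ in (-Real.pi)..Real.pi, φ (polarPt r θ) := by
  have hp : Function.Periodic (fun θ => φ (polarPt r θ)) (2 * Real.pi) := fun θ => by
    simp [polarPt]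
  have := hp.intervalIntegral_add_eq 0 (-Real.pi)
  rw [circMean, Real.exp_log hr]
  rw [zero_add, show -Real.pi + 2 * Real.pi = Real.pi by ring] at this
  rw [this]

/-- The cross term ∫(f - c) vanishes because c is the mean, so passing from f to c cannot increase
the squared distance to a constant b. -/
theorem lintegral_mean_sub_le {f : ℝ → ℝ} (hf : Continuous f) {c : ℝ}
    (hc : c = (2 * Real.pi)⁻¹ * ∫ θ in (-Real.pi)..Real.pi, f θ) (b : ℝ) :
    ∫⁻ _ in Set.Ioo (-Real.pi) Real.pi, ‖c - b‖ₑ ^ 2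
      ≤ ∫⁻ θ in Set.Ioo (-Real.pi) Real.pi, ‖f θ - b‖ₑ ^ 2 := by
  have hpi := Real.pi_pos
  have e : ∀ y : ℝ, ‖y‖ₑ ^ 2 = ENNReal.ofReal (y ^ 2) := fun y => by
    rw [Real.enorm_eq_ofReal_abs, ← ENNReal.ofReal_pow (abs_nonneg _), sq_abs]
  have key : ∀ g : ℝ → ℝ, Continuous g → ∫⁻ θ in Set.Ioo (-Real.pi) Real.pi, ‖g θ‖ₑ ^ 2
      = ENNReal.ofReal (∫ θ in (-Real.pi)..Real.pi, g θ ^ 2) := by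
    intro g hg
    rw [intervalIntegral.integral_of_le (by linarith), restrict_Ioo_eq_restrict_Ioc]
    simp only [e]
    refine (ofReal_integral_eq_lintegral_ofReal ?_ ?_).symm
    · exact ((hg.pow 2).intervalIntegrable (-Real.pi) Real.pi).1
    · exact Filter.Eventually.of_forall fun θ => sq_nonneg _
  rw [key _ continuous_const, key (fun θ => f θ - b) (hf.sub continuous_const)]
  refine ENNReal.ofReal_le_ofReal ?_
  have i1 : IntervalIntegrable (fun θ => (f θ - b) ^ 2) volume (-Real.pi) Real.pi :=
    ((hf.sub continuous_const).pow 2).intervalIntegrable _ _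
  have i2 : IntervalIntegrable (fun θ => 2 * (c - b) * (f θ - c)) volume (-Real.pi) Real.pi :=
    (continuous_const.mul (hf.sub continuous_const)).intervalIntegrable _ _
  have i3 : IntervalIntegrable (fun _ => (c - b) ^ 2) volume (-Real.pi) Real.pi :=
    intervalIntegrable_const
  have h0 : ∫ θ in (-Real.pi)..Real.pi, 2 * (c - b) * (f θ - c) = 0 := by
    rw [intervalIntegral.integral_const_mul,
      intervalIntegral.integral_sub (hf.intervalIntegrable _ _) intervalIntegrable_const,
      intervalIntegral.integral_const, smul_eq_mul]
    have : ∫ θ in (-Real.pi)..Real.pi, f θ = 2 * Real.pi * c := by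
      rw [hc]; field_simp
    rw [this]; ring
  calc ∫ _ in (-Real.pi)..Real.pi, (c - b) ^ 2
      = ∫ θ in (-Real.pi)..Real.pi, ((c - b) ^ 2 + 2 * (c - b) * (f θ - c)) := by
        rw [intervalIntegral.integral_add i3 i2, h0, add_zero]
    _ ≤ _ := intervalIntegral.integral_mono_on (by linarith) (i3.add i2) i1 fun θ _ => by
        nlinarith [sq_nonneg (f θ - c)]

theorem circMean_measurable {φ : Plane → ℝ} (h : Continuous φ) : Measurable (circMean φ) := by
  have hc : Continuous fun p : ℝ × ℝ => φ (polarPt (Real.exp p.1) p.2) :=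
    h.comp (polarPt_continuous.comp (by fun_prop : Continuous fun p : ℝ × ℝ =>
      (Real.exp p.1, p.2)))
  unfold circMean
  exact (continuous_const.mul
    (intervalIntegral.continuous_parametric_intervalIntegral_of_continuous' hc _ _)).measurable

/-- On almost every circle G is almost everywhere the constant v(r) and κ is constant, so the
one-circle inequality applies. With G = 0 it bounds circle means; with G the limit function it gives
convergence of the means. -/
theorem lintegral_circMean_sub_le {κ : Plane → ℝ≥0∞} (hκ : Measurable κ)
    (rκ : ∀ x y : Plane, ‖x‖ = ‖y‖ → κ x = κ y) {φ G : Plane → ℝ} (hφ : Continuous φ)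
    (hG : AEStronglyMeasurable G) {v : ℝ → ℝ} (hv : G =ᵐ[volume] fun x => v ‖x‖) :
    ∫⁻ x, κ x * ‖circMean φ (Real.log ‖x‖) - G x‖ₑ ^ 2 ≤ ∫⁻ x, κ x * ‖φ x - G x‖ₑ ^ 2 := by
  -- The profile v is not assumed measurable, so the integrals are split in polar coordinates with a
  -- measurable representative of G.
  obtain ⟨G', mG, hG'⟩ := hG
  have hv' : G' =ᵐ[volume] fun x => v ‖x‖ := hG'.symm.trans hv
  rw [lintegral_congr_ae (hG'.mono fun x hx => by simp only [hx] :
      (fun x => κ x * ‖circMean φ (Real.log ‖x‖) - G x‖ₑ ^ 2) =ᵐ[volume]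
        fun x => κ x * ‖circMean φ (Real.log ‖x‖) - G' x‖ₑ ^ 2),
    lintegral_congr_ae (hG'.mono fun x hx => by simp only [hx] :
      (fun x => κ x * ‖φ x - G x‖ₑ ^ 2) =ᵐ[volume] fun x => κ x * ‖φ x - G' x‖ₑ ^ 2)]
  have mG' := mG.measurable
  have mφ := hφ.measurable
  have mc := circMean_measurable hφ
  rw [lintegral_plane_eq (by fun_prop), lintegral_plane_eq (by fun_prop)]
  refine lintegral_mono_ae ?_
  filter_upwards [ae_ae_polarPt hv', ae_restrict_mem measurableSet_Ioi] with r hr hr0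
  have hr0' : 0 < r := hr0
  have hk : ∀ θ, κ (polarPt r θ) = κ (polarPt r 0) := fun θ =>
    rκ _ _ (by rw [norm_polarPt hr0'.le, norm_polarPt hr0'.le])
  have hpc : Continuous fun θ => φ (polarPt r θ) :=
    hφ.comp (polarPt_continuous.comp (by fun_prop : Continuous fun θ : ℝ => (r, θ)))
  simp only [norm_polarPt hr0'.le] at hr
  calc ∫⁻ θ in Set.Ioo (-Real.pi) Real.pi, ENNReal.ofReal r * (κ (polarPt r θ)
        * ‖circMean φ (Real.log ‖polarPt r θ‖) - G' (polarPt r θ)‖ₑ ^ 2)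
      = ∫⁻ θ in Set.Ioo (-Real.pi) Real.pi, ENNReal.ofReal r * κ (polarPt r 0)
        * ‖circMean φ (Real.log r) - v r‖ₑ ^ 2 := by
        refine lintegral_congr_ae (hr.mono fun θ hθ => ?_)
        simp only [hθ, hk θ, norm_polarPt hr0'.le, mul_assoc]
    _ = ENNReal.ofReal r * κ (polarPt r 0) * ∫⁻ θ in Set.Ioo (-Real.pi) Real.pi,
        ‖circMean φ (Real.log r) - v r‖ₑ ^ 2 := by
        rw [lintegral_const_mul _ (by fun_prop)]
    _ ≤ ENNReal.ofReal r * κ (polarPt r 0) * ∫⁻ θ in Set.Ioo (-Real.pi) Real.pi,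
        ‖φ (polarPt r θ) - v r‖ₑ ^ 2 := by
        exact mul_le_mul_right (lintegral_mean_sub_le hpc (circMean_log hr0') _) _
    _ = ∫⁻ θ in Set.Ioo (-Real.pi) Real.pi, ENNReal.ofReal r * κ (polarPt r 0)
        * ‖φ (polarPt r θ) - v r‖ₑ ^ 2 := by
        rw [lintegral_const_mul]
        exact (hpc.measurable.sub_const _).enorm.pow_const 2
    _ = _ := by
        refine lintegral_congr_ae (hr.mono fun θ hθ => ?_)
        simp only [hθ, hk θ, mul_assoc]

section Norms

variable {χ : Plane → ℝ}

theorem eLpNorm_weighted_eq_lintegral (hχ : IsCutoff χ) (γ τ : ℝ) (f : Plane → ℝ) :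
    eLpNorm f 2 (weighted χ γ τ)
      = (∫⁻ x, ENNReal.ofReal (dens χ γ τ x ^ 2) * ‖f x‖ₑ ^ 2) ^ (1 / 2 : ℝ) := by
  rw [eLpNorm_eq_lintegral_rpow_enorm_toReal (by norm_num) (by norm_num), lintegral_weighted hχ]
  simp

theorem dens_eq_of_norm_eq (hχ : IsCutoff χ) (γ τ : ℝ) {x y : Plane} (h : ‖x‖ = ‖y‖) :
    dens χ γ τ x = dens χ γ τ y := by
  rw [dens, dens, m_eq_of_norm_eq hχ h, bracket, bracket, h]

/-- The radial factor ρ is |x|^{-k} when derivatives are estimated and 1 when convergence is proved.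
-/
theorem eLpNorm_circMean_sub_le (hχ : IsCutoff χ) (γ τ : ℝ) {ρ : Plane → ℝ} (hρ : Measurable ρ)
    (rρ : ∀ x y : Plane, ‖x‖ = ‖y‖ → ρ x = ρ y) {φ G : Plane → ℝ} (hφ : Continuous φ)
    (hG : AEStronglyMeasurable G) {v : ℝ → ℝ} (hv : G =ᵐ[volume] fun x => v ‖x‖) :
    eLpNorm (fun x => ρ x * (circMean φ (Real.log ‖x‖) - G x)) 2 (weighted χ γ τ)
      ≤ eLpNorm (fun x => ρ x * (φ x - G x)) 2 (weighted χ γ τ) := by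
  rw [eLpNorm_weighted_eq_lintegral hχ, eLpNorm_weighted_eq_lintegral hχ]
  refine ENNReal.rpow_le_rpow ?_ (by norm_num)
  simp only [enorm_mul, mul_pow, ← mul_assoc]
  refine lintegral_circMean_sub_le ?_ (fun x y h => ?_) hφ hG hv
  · have := dens_measurable hχ γ τ
    fun_prop
  · rw [dens_eq_of_norm_eq hχ γ τ h, rρ x y h]

/-- The k-th t-derivative of a circle mean is the circle mean of (x·∇)^kφ. Averaging is a
contraction, and (x·∇)^kφ is bounded by the terms |x|^{|α|}|D^αφ| with |α| ≤ k. No symmetry of φ is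
needed. -/
theorem sobNorm_circMean_le (hχ : IsCutoff χ) (γ σ : ℝ) (s : ℕ) :
    ∃ C : ℝ≥0, ∀ φ : Plane → ℝ, ContDiff ℝ ∞ φ → HasCompactSupport φ →
      polarConst * sobNorm (mLog χ) γ s σ (circMean φ) ≤ C * ∑ α ∈ indices s,
        eLpNorm (multiDeriv α φ) 2 (weighted χ γ (σ + ((α.1 + α.2 : ℕ) : ℝ))) := by
  choose C hC using exists_euler_iterate_le
  refine ⟨∑ k ∈ Finset.range (s + 1), C k, fun φ hφ cφ => ?_⟩
  rw [sobNorm, Finset.mul_sum, ENNReal.ofNNReal_finsetSum, Finset.sum_mul]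
  refine Finset.sum_le_sum fun k hk => ?_
  have hks : k ≤ s := by have := Finset.mem_range.1 hk; omega
  have hψ := euler_iterate_contDiff hφ k
  have step1 : polarConst * nrm (mLog χ) γ (σ + k)
      (fun t => Real.exp (-(k * t)) * iteratedDeriv k (circMean φ) t)
      = eLpNorm (fun x => (‖x‖ ^ k)⁻¹ * (circMean (euler^[k] φ) (Real.log ‖x‖) - 0)) 2
        (weighted χ γ (σ + k)) := by
    refine (eLpNorm_radial hχ γ _ ?_ fun x hx => ?_).symm
    · have := iteratedDeriv_measurable (circMean_contDiff hφ cφ) k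
      fun_prop
    · simp only [iteratedDeriv_circMean k hφ cφ, exp_neg_mul_log_norm hx, sub_zero]
  have step2 := eLpNorm_circMean_sub_le hχ γ (σ + k) (ρ := fun x => (‖x‖ ^ k)⁻¹) (by fun_prop)
    (fun x y h => by simp only [h]) hψ.continuous (G := fun _ => 0) aestronglyMeasurable_const
    (v := fun _ => 0) (Filter.EventuallyEq.refl _ _)
  rw [step1]
  refine step2.trans ?_
  simp only [sub_zero]
  rw [eLpNorm_weighted hχ]
  have step3 := eLpNorm_le_mul_sum (μ := (volume : Measure Plane)) (indices k) (C k)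
    (F := fun x => dens χ γ (σ + k) x * ((‖x‖ ^ k)⁻¹ * (euler^[k] φ) x))
    (G := fun α x => dens χ γ (σ + ((α.1 + α.2 : ℕ) : ℝ)) x * multiDeriv α φ x)
    (fun α _ => ((dens_measurable hχ γ _).mul
      (multiDeriv_smooth α hφ).continuous.measurable).aestronglyMeasurable)
    (ae_ne_zero_plane.mono fun x hx => ?_)
  · refine step3.trans ?_
    simp only [← eLpNorm_weighted hχ]
    gcongr
    exact fun α hα => mem_indices.2 ((mem_indices.1 hα).trans hks)
  · have hn : 0 < ‖x‖ := norm_pos_iff.2 hx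
    have hd := dens_pos hχ γ (σ + k) hx
    rw [abs_mul, abs_mul, abs_of_pos hd, abs_of_pos (by positivity)]
    calc dens χ γ (σ + k) x * ((‖x‖ ^ k)⁻¹ * |(euler^[k] φ) x|)
        ≤ dens χ γ (σ + k) x * ((‖x‖ ^ k)⁻¹
          * (C k * ∑ α ∈ indices k, ‖x‖ ^ (α.1 + α.2) * |multiDeriv α φ x|)) := by
          gcongr
          exact hC k φ hφ x
      _ = C k * ∑ α ∈ indices k, (dens χ γ (σ + k) x * (‖x‖ ^ k)⁻¹) * ‖x‖ ^ (α.1 + α.2)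
          * |multiDeriv α φ x| := by
          simp only [Finset.mul_sum]
          exact Finset.sum_congr rfl fun α _ => by ring
      _ ≤ _ := by
          refine mul_le_mul_of_nonneg_left (Finset.sum_le_sum fun α hα => ?_) (C k).2
          have hp : 0 < ‖x‖ ^ (α.1 + α.2) := by positivity
          rw [abs_mul, abs_of_pos (dens_pos hχ γ _ hx)]
          refine mul_le_mul_of_nonneg_right ?_ (abs_nonneg _)
          have := mul_le_mul_of_nonneg_right (dens_shift_le hχ γ σ hx (mem_indices.1 hα)) hp.le
          rwa [mul_assoc (dens χ γ (σ + ((α.1 + α.2 : ℕ) : ℝ)) x), inv_mul_cancel₀ hp.ne', mul_one] at this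

theorem circMean_lift {V : ℝ → ℝ} : circMean (lift V) = V := by
  funext t
  have h : ∀ θ, lift V (polarPt (Real.exp t) θ) = V t := fun θ => by
    have hn := norm_polarPt (Real.exp_pos t).le θ
    rw [lift_apply V (norm_pos_iff.1 (hn.symm.subst (Real.exp_pos t))), hn, Real.log_exp]
  simp only [circMean, h, intervalIntegral.integral_const, smul_eq_mul, sub_zero]
  have := Real.pi_pos
  field_simp

end Norms

/-! ### Closing up the graph of an operator -/

section Graph

variable {E F : Type*} [NormedAddCommGroup E] [NormedSpace ℝ E]
  [NormedAddCommGroup F] [NormedSpace ℝ F]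

theorem norm_le_on_topologicalClosure (Z : Submodule ℝ (E × F)) {C : ℝ}
    (h : ∀ z ∈ Z, ‖z.2‖ ≤ C * ‖z.1‖) : ∀ z ∈ Z.topologicalClosure, ‖z.2‖ ≤ C * ‖z.1‖ := by
  have hc : IsClosed {z : E × F | ‖z.2‖ ≤ C * ‖z.1‖} :=
    isClosed_le (by fun_prop) (by fun_prop)
  exact fun z hz => closure_minimal (fun z hz => h z hz) hc hz

variable [CompleteSpace E] [CompleteSpace F]

/-- The bound makes the first projection antilipschitz on the complete space given by the closure of
Z. Its range is therefore closed, and it contains the image of Z, hence also the closure of that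
image. -/
theorem map_fst_topologicalClosure (Z : Submodule ℝ (E × F)) {C : ℝ≥0}
    (h : ∀ z ∈ Z, ‖z.2‖ ≤ C * ‖z.1‖) {x : E}
    (hx : x ∈ (Z.map (LinearMap.fst ℝ E F)).topologicalClosure) :
    ∃ y, (x, y) ∈ Z.topologicalClosure := by
  have hb := norm_le_on_topologicalClosure Z h
  set g : Z.topologicalClosure →L[ℝ] E :=
    (ContinuousLinearMap.fst ℝ E F).comp Z.topologicalClosure.subtypeL with hg
  have hK : AntilipschitzWith (max 1 C) g := by
    refine g.antilipschitz_of_bound fun z => ?_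
    have h1 := hb z.1 z.2
    have h2 : (1 : ℝ) * ‖z.1.1‖ ≤ max 1 C * ‖z.1.1‖ := by gcongr; exact le_max_left _ _
    have h3 : (C : ℝ) * ‖z.1.1‖ ≤ max 1 C * ‖z.1.1‖ := by gcongr; exact le_max_right _ _
    change max ‖z.1.1‖ ‖z.1.2‖ ≤ ((max 1 C : ℝ≥0) : ℝ) * ‖z.1.1‖
    exact max_le (by linarith) (by linarith)
  have : CompleteSpace Z.topologicalClosure :=
    Z.isClosed_topologicalClosure.completeSpace_coe
  have hcl := hK.isClosed_range g.uniformContinuous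
  have hsub : closure (Z.map (LinearMap.fst ℝ E F) : Set E) ⊆ Set.range g := by
    refine closure_minimal ?_ hcl
    rintro _ ⟨z, hz, rfl⟩
    exact ⟨⟨z, Z.le_topologicalClosure hz⟩, rfl⟩
  obtain ⟨z, rfl⟩ := hsub hx
  exact ⟨z.1.2, z.2⟩

/-- A subspace whose two coordinates control each other closes up to the graph of a continuous
linear equivalence. -/
theorem exists_equiv_of_graph (Z : Submodule ℝ (E × F)) {C C' : ℝ≥0}
    (h1 : ∀ z ∈ Z, ‖z.2‖ ≤ C * ‖z.1‖) (h2 : ∀ z ∈ Z, ‖z.1‖ ≤ C' * ‖z.2‖)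
    {A : Submodule ℝ E} {B : Submodule ℝ F}
    (hA : A = (Z.map (LinearMap.fst ℝ E F)).topologicalClosure)
    (hB : B = (Z.map (LinearMap.snd ℝ E F)).topologicalClosure) :
    ∃ T : A ≃L[ℝ] B, ∀ u : A, ((u : E), (T u : F)) ∈ Z.topologicalClosure := by
  have b1 := norm_le_on_topologicalClosure Z h1
  have b2 : ∀ z ∈ Z.topologicalClosure, ‖z.1‖ ≤ C' * ‖z.2‖ := by
    have hc : IsClosed {z : E × F | ‖z.1‖ ≤ C' * ‖z.2‖} :=
      isClosed_le (by fun_prop) (by fun_prop)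
    exact fun z hz => closure_minimal (fun z hz => h2 z hz) hc hz
  have m1 : ∀ z ∈ Z.topologicalClosure, z.1 ∈ A := by
    intro z hz
    rw [hA]
    exact map_mem_closure (f := Prod.fst) continuous_fst hz fun w hw => ⟨w, hw, rfl⟩
  have m2 : ∀ z ∈ Z.topologicalClosure, z.2 ∈ B := by
    intro z hz
    rw [hB]
    exact map_mem_closure (f := Prod.snd) continuous_snd hz fun w hw => ⟨w, hw, rfl⟩
  have e1 : ∀ x ∈ A, ∃ y, (x, y) ∈ Z.topologicalClosure := fun x hx =>
    map_fst_topologicalClosure Z h1 (hA ▸ hx)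
  have e2 : ∀ y ∈ B, ∃ x, (x, y) ∈ Z.topologicalClosure := by
    intro y hy
    -- Surjectivity onto the second factor is the previous lemma applied to the graph with its
    -- coordinates exchanged.
    set S : E × F →L[ℝ] F × E := (ContinuousLinearEquiv.prodComm ℝ E F : E × F →L[ℝ] F × E)
    have hy' : y ∈ ((Z.map (S : E × F →ₗ[ℝ] F × E)).map (LinearMap.fst ℝ F E)).topologicalClosure := by
      rw [hB] at hy
      rw [← Submodule.map_comp]
      exact hy
    obtain ⟨x, hx⟩ := map_fst_topologicalClosure (Z.map (S : E × F →ₗ[ℝ] F × E)) (C := C')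
      (by rintro _ ⟨z, hz, rfl⟩; exact h2 z hz) hy'
    refine ⟨x, map_mem_closure (f := Prod.swap) (t := (Z : Set (E × F))) continuous_swap hx ?_⟩
    rintro _ ⟨z, hz, rfl⟩
    exact hz
  set p1 : Z.topologicalClosure →ₗ[ℝ] A :=
    ((LinearMap.fst ℝ E F).comp Z.topologicalClosure.subtype).codRestrict A fun z => m1 z.1 z.2
  set p2 : Z.topologicalClosure →ₗ[ℝ] B :=
    ((LinearMap.snd ℝ E F).comp Z.topologicalClosure.subtype).codRestrict B fun z => m2 z.1 z.2
  have bij1 : Function.Bijective p1 := by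
    refine ⟨(injective_iff_map_eq_zero p1).2 fun z hz => ?_, fun x => ?_⟩
    · have hz1 : z.1.1 = 0 := congrArg Subtype.val hz
      have hz2 := b1 z.1 z.2
      rw [hz1, norm_zero, mul_zero, norm_le_zero_iff] at hz2
      exact Subtype.ext (Prod.ext hz1 hz2)
    · obtain ⟨y, hy⟩ := e1 x.1 x.2
      exact ⟨⟨_, hy⟩, rfl⟩
  have bij2 : Function.Bijective p2 := by
    refine ⟨(injective_iff_map_eq_zero p2).2 fun z hz => ?_, fun x => ?_⟩
    · have hz1 : z.1.2 = 0 := congrArg Subtype.val hz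
      have hz2 := b2 z.1 z.2
      rw [hz1, norm_zero, mul_zero, norm_le_zero_iff] at hz2
      exact Subtype.ext (Prod.ext hz2 hz1)
    · obtain ⟨y, hy⟩ := e2 x.1 x.2
      exact ⟨⟨_, hy⟩, rfl⟩
  set e := (LinearEquiv.ofBijective p1 bij1).symm.trans (LinearEquiv.ofBijective p2 bij2)
  have he : ∀ u : A, ((u : E), (e u : F)) ∈ Z.topologicalClosure := by
    intro u
    have h := ((LinearEquiv.ofBijective p1 bij1).symm u).2
    have h' : (((LinearEquiv.ofBijective p1 bij1).symm u).1.1 : E) = u :=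
      congrArg Subtype.val ((LinearEquiv.ofBijective p1 bij1).apply_symm_apply u)
    rw [← h']
    exact h
  refine ⟨e.toContinuousLinearEquivOfBounds C C' (fun u => b1 _ (he u)) (fun w => ?_), he⟩
  have := b2 _ (he (e.symm w))
  simpa using this

end Graph

/-! ### Jets of test functions and equivalence of norms -/

section Jets

variable {χ : Plane → ℝ} {s : ℕ} {γ σ : ℝ}

/-- The components of `U` are the derivatives of `φ`. -/
def IsJet (U : Jets χ s γ σ) (φ : Plane → ℝ) : Prop :=
  ∀ α : MultiIndex s,
    (U α : Plane → ℝ) =ᵐ[weighted χ γ (σ + (α.order : ℝ))] multiDeriv α.1 φ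

theorem enorm_jets (U : Jets χ s γ σ) :
    ‖U‖ₑ = ∑ α, eLpNorm (U α : Plane → ℝ) 2 (weighted χ γ (σ + (α.order : ℝ))) := by
  simp only [← Lp.enorm_def]
  rw [enorm_eq_nnnorm, PiLp.nnnorm_eq_of_L1, ENNReal.ofNNReal_finsetSum]
  rfl

theorem enorm_apply_le (U : Jets χ s γ σ) (α : MultiIndex s) : ‖U α‖ₑ ≤ ‖U‖ₑ := by
  rw [enorm_jets, Lp.enorm_def]
  exact Finset.single_le_sum
    (f := fun α : MultiIndex s => eLpNorm (U α : Plane → ℝ) 2 (weighted χ γ (σ + (α.order : ℝ))))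
    (fun _ _ => zero_le) (Finset.mem_univ α)

theorem IsJet.enorm_eq {U : Jets χ s γ σ} {φ : Plane → ℝ} (h : IsJet U φ) :
    ‖U‖ₑ = ∑ α ∈ indices s,
      eLpNorm (multiDeriv α φ) 2 (weighted χ γ (σ + ((α.1 + α.2 : ℕ) : ℝ))) := by
  rw [enorm_jets, Finset.sum_subtype (indices s) fun _ => mem_indices]
  exact Finset.sum_congr rfl fun α _ => eLpNorm_congr_ae (h α)

theorem multiDeriv_sub (α : ℕ × ℕ) {φ ψ : Plane → ℝ} (h : ContDiff ℝ ∞ φ)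
    (k : ContDiff ℝ ∞ ψ) : multiDeriv α (φ - ψ) = multiDeriv α φ - multiDeriv α ψ := by
  have e : φ - ψ = φ + (-1 : ℝ) • ψ := by simp [sub_eq_add_neg]
  have k' : ContDiff ℝ ∞ ((-1 : ℝ) • ψ) := contDiff_const.smul k
  rw [e, multiDeriv_add α h k', multiDeriv_smul α _ k]
  simp [sub_eq_add_neg]

theorem IsJet.sub {U W : Jets χ s γ σ} {φ ψ : Plane → ℝ} (hU : IsJet U φ) (hW : IsJet W ψ)
    (h : ContDiff ℝ ∞ φ) (k : ContDiff ℝ ∞ ψ) : IsJet (U - W) (φ - ψ) := fun α => by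
  rw [multiDeriv_sub _ h k]
  exact (Lp.coeFn_sub (U α) (W α)).trans ((hU α).sub (hW α))

theorem IsJet.add {U W : Jets χ s γ σ} {φ ψ : Plane → ℝ} (hU : IsJet U φ) (hW : IsJet W ψ)
    (h : ContDiff ℝ ∞ φ) (k : ContDiff ℝ ∞ ψ) : IsJet (U + W) (φ + ψ) := fun α => by
  rw [multiDeriv_add _ h k]
  exact (Lp.coeFn_add (U α) (W α)).trans ((hU α).add (hW α))

theorem IsJet.smul {U : Jets χ s γ σ} {φ : Plane → ℝ} (c : ℝ) (hU : IsJet U φ)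
    (h : ContDiff ℝ ∞ φ) : IsJet (c • U) (c • φ) := fun α => by
  rw [multiDeriv_smul _ c h]
  exact (Lp.coeFn_smul c (U α)).trans ((hU α).const_smul c)

theorem IsJet.zero : IsJet (0 : Jets χ s γ σ) 0 := fun α => by
  have h0 : multiDeriv α.1 (0 : Plane → ℝ) = 0 := by
    have := multiDeriv_smul α.1 0 (φ := (0 : Plane → ℝ)) contDiff_const
    simpa using this
  rw [h0]
  exact Lp.coeFn_zero _ _ _

theorem lift_add (V W : ℝ → ℝ) : lift (V + W) = lift V + lift W := by
  funext x
  by_cases h : x = 0 <;> simp [lift, h]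

theorem lift_sub (V W : ℝ → ℝ) : lift (V - W) = lift V - lift W := by
  funext x
  by_cases h : x = 0 <;> simp [lift, h]

theorem lift_smul (c : ℝ) (V : ℝ → ℝ) : lift (c • V) = c • lift V := by
  funext x
  by_cases h : x = 0 <;> simp [lift, h]

theorem sobNorm_mono {M : ℝ → ℝ} {γ σ : ℝ} {k s : ℕ} (h : k ≤ s) (V : ℝ → ℝ) :
    sobNorm M γ k σ V ≤ sobNorm M γ s σ V :=
  Finset.sum_le_sum_of_subset (Finset.range_mono (by omega))

theorem exists_sum_multiDeriv_lift_le (hχ : IsCutoff χ) (γ σ : ℝ) (s : ℕ) :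
    ∃ C : ℝ≥0, ∀ V : ℝ → ℝ, ContDiff ℝ ∞ V → ∑ α ∈ indices s,
      eLpNorm (multiDeriv α (lift V)) 2 (weighted χ γ (σ + ((α.1 + α.2 : ℕ) : ℝ)))
        ≤ C * sobNorm (mLog χ) γ s σ V := by
  choose C hC using eLpNorm_multiDeriv_lift_le hχ γ σ
  refine ⟨∑ α ∈ indices s, C α * polarConst.toNNReal, fun V hV => ?_⟩
  rw [ENNReal.ofNNReal_finsetSum, Finset.sum_mul]
  refine Finset.sum_le_sum fun α hα => (hC α V hV).trans ?_
  rw [ENNReal.coe_mul, ENNReal.coe_toNNReal polarConst_ne_top, mul_assoc]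
  gcongr
  exact sobNorm_mono (mem_indices.1 hα) V

theorem exists_enorm_lift_le (hχ : IsCutoff χ) (γ σ : ℝ) (s : ℕ) :
    ∃ C : ℝ≥0, ∀ (V : ℝ → ℝ) (U : Jets χ s γ σ), ContDiff ℝ ∞ V → IsJet U (lift V) →
      ‖U‖ₑ ≤ C * sobNorm (mLog χ) γ s σ V := by
  obtain ⟨C, hC⟩ := exists_sum_multiDeriv_lift_le hχ γ σ s
  exact ⟨C, fun V U hV hU => hU.enorm_eq.trans_le (hC V hV)⟩

theorem exists_sobNorm_circMean_le (hχ : IsCutoff χ) (γ σ : ℝ) (s : ℕ) :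
    ∃ C : ℝ≥0, ∀ (φ : Plane → ℝ) (U : Jets χ s γ σ), ContDiff ℝ ∞ φ → HasCompactSupport φ →
      IsJet U φ → sobNorm (mLog χ) γ s σ (circMean φ) ≤ C * ‖U‖ₑ := by
  obtain ⟨C, hC⟩ := sobNorm_circMean_le hχ γ σ s
  refine ⟨polarConst.toNNReal⁻¹ * C, fun φ U hφ cφ hU => ?_⟩
  have h := hC φ hφ cφ
  rw [← hU.enorm_eq] at h
  have h0 : polarConst.toNNReal ≠ 0 := by
    rw [ne_eq, ENNReal.toNNReal_eq_zero_iff, not_or]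
    exact ⟨polarConst_ne_zero, polarConst_ne_top⟩
  rw [ENNReal.coe_mul, ENNReal.coe_inv h0, ENNReal.coe_toNNReal polarConst_ne_top, mul_assoc]
  calc _ = polarConst⁻¹ * (polarConst * sobNorm (mLog χ) γ s σ (circMean φ)) := by
        rw [← mul_assoc, ENNReal.inv_mul_cancel polarConst_ne_zero polarConst_ne_top, one_mul]
    _ ≤ _ := by gcongr

/-- The other half of the norm equivalence: circle means fix radial functions, so the bound for
means of arbitrary test functions specializes to lifts. -/
theorem exists_sobNorm_le_enorm_lift (hχ : IsCutoff χ) (γ σ : ℝ) (s : ℕ) :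
    ∃ C : ℝ≥0, ∀ (V : ℝ → ℝ) (U : Jets χ s γ σ), ContDiff ℝ ∞ V → HasCompactSupport V →
      IsJet U (lift V) → sobNorm (mLog χ) γ s σ V ≤ C * ‖U‖ₑ := by
  obtain ⟨C, hC⟩ := exists_sobNorm_circMean_le hχ γ σ s
  refine ⟨C, fun V U hV cV hU => ?_⟩
  have := hC (lift V) U (lift_contDiff hV cV) (lift_hasCompactSupport cV) hU
  rwa [circMean_lift] at this

theorem exists_isJet_lift (hχ : IsCutoff χ) {V : ℝ → ℝ} (hV : ContDiff ℝ ∞ V)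
    (cV : HasCompactSupport V) (fV : sobNorm (mLog χ) γ s σ V < ⊤) :
    ∃ U : Jets χ s γ σ, IsJet U (lift V) := by
  obtain ⟨C, hC⟩ := exists_sum_multiDeriv_lift_le hχ γ σ s
  have h := (hC V hV).trans_lt (ENNReal.mul_lt_top ENNReal.coe_lt_top fV)
  have hm : ∀ α : MultiIndex s,
      MemLp (multiDeriv α.1 (lift V)) 2 (weighted χ γ (σ + (α.order : ℝ))) := fun α =>
    ⟨(multiDeriv_smooth _ (lift_contDiff hV cV)).continuous.aestronglyMeasurable,
      (Finset.single_le_sum (f := fun α : ℕ × ℕ => eLpNorm (multiDeriv α (lift V)) 2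
        (weighted χ γ (σ + ((α.1 + α.2 : ℕ) : ℝ)))) (fun _ _ => zero_le)
        (mem_indices.2 α.2)).trans_lt h⟩
  exact ⟨WithLp.toLp 1 fun α => (hm α).toLp _, fun α => (hm α).coeFn_toLp⟩

/-- L² convergence gives an almost everywhere convergent subsequence for one component; finitely
many successive extractions serve all components in S. -/
theorem exists_subseq_tendsto_ae {U : ℕ → Jets χ s γ σ} {U' : Jets χ s γ σ}
    (hU : Filter.Tendsto U Filter.atTop (nhds U')) (S : Finset (MultiIndex s)) :
    ∃ ns : ℕ → ℕ, StrictMono ns ∧ ∀ α ∈ S, ∀ᵐ x ∂weighted χ γ (σ + (α.order : ℝ)),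
      Filter.Tendsto (fun i => (U (ns i) α : Plane → ℝ) x) Filter.atTop
        (nhds ((U' α : Plane → ℝ) x)) := by
  classical
  induction S using Finset.induction_on with
  | empty => exact ⟨id, strictMono_id, by simp⟩
  | insert β S _ ih =>
    obtain ⟨ns, hns, h⟩ := ih
    have h1 : Filter.Tendsto (fun i => U (ns i) β) Filter.atTop (nhds (U' β)) :=
      (((PiLp.continuous_apply 1 _ β).tendsto U').comp hU).comp hns.tendsto_atTop
    obtain ⟨ms, hms, h2⟩ := (tendstoInMeasure_of_tendsto_Lp h1).exists_seq_tendsto_ae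
    refine ⟨ns ∘ ms, hns.comp hms, fun α hα => ?_⟩
    rcases Finset.mem_insert.1 hα with rfl | hα
    · exact h2
    · filter_upwards [h α hα] with x hx using hx.comp hms.tendsto_atTop

end Jets

/-! ### An element is determined by its underlying function -/

/-- Test functions on the punctured plane. -/
structure IsTestOff (ψ : Plane → ℝ) : Prop where
  smooth : ContDiff ℝ ∞ ψ
  compact : HasCompactSupport ψ
  tsupport_subset : tsupport ψ ⊆ {0}ᶜ

theorem IsTestOff.neg_pderiv {ψ : Plane → ℝ} (h : IsTestOff ψ) (i : Fin 2) :
    IsTestOff (-pderiv i ψ) := by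
  refine ⟨(pderiv_smooth i h.smooth).neg, (pderiv_hasCompactSupport i h.compact).neg, ?_⟩
  have h1 : Function.support (-pderiv i ψ) ⊆ Function.support (fderiv ℝ ψ) := by
    intro x hx hx'
    apply hx
    simp [pderiv, show fderiv ℝ ψ x = 0 from hx']
  exact ((closure_mono h1).trans (tsupport_fderiv_subset ℝ)).trans h.tsupport_subset

theorem integral_mul_pderiv (i : Fin 2) {ψ φ : Plane → ℝ} (hψ : IsTestOff ψ)
    (hφ : ContDiff ℝ ∞ φ) : ∫ x, ψ x * pderiv i φ x = ∫ x, (-pderiv i ψ) x * φ x := by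
  have c1 := hψ.smooth.continuous
  have c2 := hφ.continuous
  have c3 := (pderiv_smooth i hψ.smooth).continuous
  have c4 := (pderiv_smooth i hφ).continuous
  have h := integral_mul_fderiv_eq_neg_fderiv_mul_of_integrable (μ := (volume : Measure Plane))
    (f := ψ) (g := φ) (v := EuclideanSpace.single i 1)
    ((c3.mul c2).integrable_of_hasCompactSupport
      (pderiv_hasCompactSupport i hψ.compact).mul_right)
    ((c1.mul c4).integrable_of_hasCompactSupport hψ.compact.mul_right)
    ((c1.mul c2).integrable_of_hasCompactSupport hψ.compact.mul_right)
    (fun x _ => hψ.smooth.differentiable (by simp) x)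
    (fun x _ => hφ.differentiable (by simp) x)
  refine h.trans ?_
  rw [← integral_neg]
  refine integral_congr_ae (Filter.Eventually.of_forall fun x => ?_)
  simp [pderiv]

theorem exists_adjoint_iterate (i : Fin 2) (n : ℕ) {ψ : Plane → ℝ} (hψ : IsTestOff ψ) :
    ∃ ψ', IsTestOff ψ' ∧ ∀ φ : Plane → ℝ, ContDiff ℝ ∞ φ →
      ∫ x, ψ x * ((pderiv i)^[n] φ) x = ∫ x, ψ' x * φ x := by
  induction n with
  | zero => exact ⟨ψ, hψ, fun _ _ => rfl⟩
  | succ n ih =>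
    obtain ⟨ψ', h', hi⟩ := ih
    refine ⟨_, h'.neg_pderiv i, fun φ hφ => ?_⟩
    rw [Function.iterate_succ_apply, hi _ (pderiv_smooth i hφ), integral_mul_pderiv i h' hφ]

theorem exists_adjoint_multiDeriv (α : ℕ × ℕ) {ψ : Plane → ℝ} (hψ : IsTestOff ψ) :
    ∃ ψ', IsTestOff ψ' ∧ ∀ φ : Plane → ℝ, ContDiff ℝ ∞ φ →
      ∫ x, ψ x * multiDeriv α φ x = ∫ x, ψ' x * φ x := by
  obtain ⟨ψ1, h1, e1⟩ := exists_adjoint_iterate 0 α.1 hψ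
  obtain ⟨ψ2, h2, e2⟩ := exists_adjoint_iterate 1 α.2 h1
  exact ⟨ψ2, h2, fun φ hφ => (e1 _ (iter_smooth 1 _ hφ)).trans (e2 φ hφ)⟩

section Uniqueness

variable {χ : Plane → ℝ} {s : ℕ} {γ σ : ℝ}

/-- This is the vector representing f ↦ ∫ψf dx in the inner product of the weighted space. Since ψ
vanishes near the origin, the behaviour of the weight there does no harm. -/
theorem IsTestOff.memLp_div (hχ : IsCutoff χ) (γ τ : ℝ) {ψ : Plane → ℝ} (hψ : IsTestOff ψ) :
    MemLp (fun x => ψ x / dens χ γ τ x ^ 2) 2 (weighted χ γ τ) := by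
  have hc : Continuous fun x => ψ x / dens χ γ τ x := by
    refine continuous_iff_continuousAt.2 fun x => ?_
    by_cases hx : x = 0
    · have h0 : ψ =ᶠ[nhds x] 0 :=
        notMem_tsupport_iff_eventuallyEq.1 fun h => hψ.tsupport_subset h hx
      refine (continuousAt_const (y := (0 : ℝ))).congr (h0.mono fun y hy => ?_)
      simp [hy]
    · exact hψ.smooth.continuous.continuousAt.div (dens_continuousAt hχ γ τ hx)
        (dens_pos hχ γ τ hx).ne'
  have hm : MemLp (fun x => ψ x / dens χ γ τ x) 2 volume :=
    hc.memLp_of_hasCompactSupport (hψ.compact.mul_right (f' := fun x => (dens χ γ τ x)⁻¹))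
  refine ⟨?_, ?_⟩
  · rw [aestronglyMeasurable_weighted_iff hχ]
    exact (hψ.smooth.continuous.measurable.div
      ((dens_measurable hχ γ τ).pow_const 2)).aestronglyMeasurable
  · rw [eLpNorm_weighted hχ]
    refine (eLpNorm_congr_ae ?_).trans_lt hm.2
    filter_upwards [ae_ne_zero_plane] with x hx
    have := (dens_pos hχ γ τ hx).ne'
    field_simp

theorem integral_weighted (hχ : IsCutoff χ) (γ τ : ℝ) (f : Plane → ℝ) :
    ∫ x, f x ∂weighted χ γ τ = ∫ x, dens χ γ τ x ^ 2 * f x := by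
  refine (integral_withDensity_eq_integral_toReal_smul
    (((dens_measurable hχ γ τ).pow_const 2).ennreal_ofReal)
    (Filter.Eventually.of_forall fun _ => ENNReal.ofReal_lt_top) f).trans ?_
  refine integral_congr_ae (Filter.Eventually.of_forall fun x => ?_)
  simp only [smul_eq_mul, ENNReal.toReal_ofReal (sq_nonneg _)]

theorem IsTestOff.continuous_integral (hχ : IsCutoff χ) (γ τ : ℝ) {ψ : Plane → ℝ}
    (hψ : IsTestOff ψ) :
    Continuous fun f : Lp ℝ 2 (weighted χ γ τ) => ∫ x, ψ x * (f : Plane → ℝ) x := by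
  have hm := hψ.memLp_div hχ γ τ
  have e : ∀ f : Lp ℝ 2 (weighted χ γ τ),
      ∫ x, ψ x * (f : Plane → ℝ) x = inner ℝ (hm.toLp _) f := by
    intro f
    rw [L2.inner_def, integral_weighted hχ]
    refine integral_congr_ae ?_
    have h1 := hm.coeFn_toLp
    rw [Filter.EventuallyEq, ae_weighted_iff hχ] at h1
    filter_upwards [ae_ne_zero_plane, h1] with x hx h1
    have := (dens_pos hχ γ τ hx).ne'
    rw [h1, real_inner_eq_re_inner, RCLike.inner_apply]
    simp
    field_simp
  simp only [e]
  exact continuous_const.inner continuous_id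

/-- Off the origin the weight is continuous and positive, so f is locally integrable there and the
fundamental lemma of the calculus of variations applies; the origin itself is a null set. -/
theorem eq_zero_of_integral_test (hχ : IsCutoff χ) (γ τ : ℝ) (f : Lp ℝ 2 (weighted χ γ τ))
    (h : ∀ ψ, IsTestOff ψ → ∫ x, ψ x * (f : Plane → ℝ) x = 0) : f = 0 := by
  have hopen : IsOpen ({0}ᶜ : Set Plane) := isOpen_compl_singleton
  have hloc : LocallyIntegrableOn (f : Plane → ℝ) ({0}ᶜ : Set Plane) volume := by
    have h1 : MemLp (fun x => dens χ γ τ x * (f : Plane → ℝ) x) 2 volume := by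
      have h2 := Lp.memLp f
      refine ⟨((dens_measurable hχ γ τ).aestronglyMeasurable).mul
        ((aestronglyMeasurable_weighted_iff hχ γ τ).1 h2.1), ?_⟩
      rw [← eLpNorm_weighted hχ]
      exact h2.2
    have h3 := ((h1.locallyIntegrable (by norm_num)).locallyIntegrableOn ({0}ᶜ : Set Plane))
      |>.continuousOn_mul (g := fun x => (dens χ γ τ x)⁻¹) (fun x hx =>
        ((dens_continuousAt hχ γ τ hx).inv₀ (dens_pos hχ γ τ hx).ne').continuousWithinAt)
        hopen.isLocallyClosed
    intro x hx
    obtain ⟨t, ht, hi⟩ := h3 x hx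
    refine ⟨t, ht, hi.congr (ae_restrict_of_ae ?_)⟩
    filter_upwards [ae_ne_zero_plane] with y hy
    rw [inv_mul_cancel_left₀ (dens_pos hχ γ τ hy).ne']
  have h0 := hopen.ae_eq_zero_of_integral_contDiff_smul_eq_zero hloc
    fun g h1 h2 h3 => h g ⟨h1, h2, h3⟩
  refine Lp.ext ?_
  refine Filter.EventuallyEq.trans ?_ (Lp.coeFn_zero _ _ _).symm
  rw [Filter.EventuallyEq, ae_weighted_iff hχ]
  filter_upwards [h0, ae_ne_zero_plane] with x hx hx0 using hx hx0

/-- The components of an element of the completion are weak derivatives of its function on the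
punctured plane: integration by parts holds for test functions, and both sides are continuous in the
jet. Hence nothing nonzero in the completion lies over the zero function. -/
theorem eq_zero_of_toFun_eq_zero (hχ : IsCutoff χ) {U : Jets χ s γ σ} (hU : U ∈ H χ s γ σ)
    (h0 : toFun U =ᵐ[volume] 0) : U = 0 := by
  have key : ∀ α : MultiIndex s, U α = 0 := by
    intro α
    refine eq_zero_of_integral_test hχ _ _ _ fun ψ hψ => ?_
    obtain ⟨ψ', hψ', e⟩ := exists_adjoint_multiDeriv α.1 hψ
    have hc : IsClosed {W : Jets χ s γ σ | ∫ x, ψ x * (W α : Plane → ℝ) x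
        = ∫ x, ψ' x * toFun W x} := by
      refine isClosed_eq ?_ ?_
      · exact (hψ.continuous_integral hχ γ _).comp (PiLp.continuous_apply 1 _ α)
      · exact (hψ'.continuous_integral hχ γ _).comp
          (PiLp.continuous_apply 1 _ (⟨(0, 0), Nat.zero_le s⟩ : MultiIndex s))
    have hsub : closure (testJets χ s γ σ : Set (Jets χ s γ σ)) ⊆
        {W : Jets χ s γ σ | ∫ x, ψ x * (W α : Plane → ℝ) x = ∫ x, ψ' x * toFun W x} := by
      refine closure_minimal ?_ hc
      rintro W ⟨φ, hφ, -, hW⟩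
      have h1 := hW α
      have h2 := hW ⟨(0, 0), Nat.zero_le s⟩
      rw [Filter.EventuallyEq, ae_weighted_iff hχ] at h1 h2
      have h1' : ∫ x, ψ x * (W α : Plane → ℝ) x = ∫ x, ψ x * multiDeriv α.1 φ x :=
        integral_congr_ae (h1.mono fun x hx => by simp only [hx])
      have h2' : ∫ x, ψ' x * toFun W x = ∫ x, ψ' x * φ x :=
        integral_congr_ae (h2.mono fun x hx => by
          simp only [toFun, wderiv, hx]; rfl)
      exact h1'.trans ((e φ hφ).trans h2'.symm)
    have h3 := hsub hU
    refine Eq.trans h3 ?_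
    rw [integral_congr_ae (h0.mono fun x hx => by simp only [hx, Pi.zero_apply, mul_zero] :
      (fun x => ψ' x * toFun U x) =ᵐ[volume] fun _ => 0)]
    simp
  ext1 α
  exact key α

end Uniqueness

/-! ### Density of radial test functions supported off the origin -/

section Radial

variable {χ : Plane → ℝ} {s : ℕ} {γ σ : ℝ}

theorem eLpNorm_toFun_le (U : Jets χ s γ σ) :
    eLpNorm (toFun U) 2 (weighted χ γ (σ + ((0 : ℕ) : ℝ))) ≤ ‖U‖ₑ := by
  have h := enorm_apply_le U ⟨(0, 0), Nat.zero_le s⟩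
  rw [Lp.enorm_def] at h
  exact h

theorem toFun_sub (hχ : IsCutoff χ) (U W : Jets χ s γ σ) :
    toFun (U - W) =ᵐ[volume] toFun U - toFun W := by
  have h := Lp.coeFn_sub (U ⟨(0, 0), Nat.zero_le s⟩) (W ⟨(0, 0), Nat.zero_le s⟩)
  rw [Filter.EventuallyEq, ae_weighted_iff hχ] at h
  exact h

theorem IsJet.ae_eq (hχ : IsCutoff χ) {U : Jets χ s γ σ} {φ : Plane → ℝ} (h : IsJet U φ)
    (α : MultiIndex s) : ∀ᵐ x, (U α : Plane → ℝ) x = multiDeriv α.1 φ x := by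
  rw [← ae_weighted_iff hχ]
  exact h α

theorem IsJet.toFun_ae_eq (hχ : IsCutoff χ) {U : Jets χ s γ σ} {φ : Plane → ℝ}
    (h : IsJet U φ) : toFun U =ᵐ[volume] φ :=
  h.ae_eq hχ ⟨(0, 0), Nat.zero_le s⟩

theorem aestronglyMeasurable_toFun (hχ : IsCutoff χ) (U : Jets χ s γ σ) :
    AEStronglyMeasurable (toFun U) volume :=
  (aestronglyMeasurable_weighted_iff hχ _ _).1 (Lp.aestronglyMeasurable _)

theorem eLpNorm_weighted_congr (hχ : IsCutoff χ) (γ τ : ℝ) {f g : Plane → ℝ}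
    (h : f =ᵐ[volume] g) : eLpNorm f 2 (weighted χ γ τ) = eLpNorm g 2 (weighted χ γ τ) := by
  refine eLpNorm_congr_ae ?_
  rw [Filter.EventuallyEq, ae_weighted_iff hχ]
  exact h

/-- The families of derivatives of the lifts of test functions. -/
def radJets (χ : Plane → ℝ) (s : ℕ) (γ σ : ℝ) : Submodule ℝ (Jets χ s γ σ) where
  carrier := {U | ∃ V : ℝ → ℝ, ContDiff ℝ ∞ V ∧ HasCompactSupport V ∧ IsJet U (lift V)}
  add_mem' := by
    rintro U W ⟨V, hV, cV, h⟩ ⟨V', hV', cV', h'⟩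
    refine ⟨V + V', hV.add hV', cV.add cV', ?_⟩
    rw [lift_add]
    exact h.add h' (lift_contDiff hV cV) (lift_contDiff hV' cV')
  zero_mem' := by
    refine ⟨0, contDiff_const, HasCompactSupport.zero, ?_⟩
    have h0 : lift 0 = 0 := by
      funext x
      simp [lift]
    rw [h0]
    exact IsJet.zero
  smul_mem' := by
    rintro c U ⟨V, hV, cV, h⟩
    refine ⟨c • V, contDiff_const.smul hV, cV.smul_left (f := fun _ => c), ?_⟩
    rw [lift_smul]
    exact h.smul c (lift_contDiff hV cV)

theorem radJets_le_testJets : radJets χ s γ σ ≤ testJets χ s γ σ := by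
  rintro U ⟨V, hV, cV, h⟩
  exact ⟨lift V, lift_contDiff hV cV, lift_hasCompactSupport cV, h⟩

theorem closure_radJets_le_Hr (hχ : IsCutoff χ) :
    (radJets χ s γ σ).topologicalClosure ≤ Hr χ s γ σ := by
  intro U hU
  refine ⟨Submodule.topologicalClosure_mono radJets_le_testJets hU, ?_⟩
  obtain ⟨Un, hUn, hlim⟩ := mem_closure_iff_seq_limit.1 hU
  choose V hV cV jV using hUn
  obtain ⟨ns, -, h⟩ := exists_subseq_tendsto_ae hlim {⟨(0, 0), Nat.zero_le s⟩}
  have h := h _ (Finset.mem_singleton_self _)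
  rw [ae_weighted_iff hχ] at h
  have h2 : ∀ᵐ x, ∀ n, toFun (Un n) x = lift (V n) x :=
    ae_all_iff.2 fun n => (jV n).toFun_ae_eq hχ
  -- The profile is the pointwise limit along the subsequence where it exists, with a junk value
  -- elsewhere; for almost every x the limit exists at r = |x|.
  refine ⟨fun r => Classical.epsilon fun l : ℝ =>
    Filter.Tendsto (fun i => V (ns i) (Real.log r)) Filter.atTop (nhds l), ?_⟩
  rw [Filter.EventuallyEq, ae_weighted_iff hχ]
  filter_upwards [h, h2, ae_ne_zero_plane] with x hx h2 hx0
  have h3 : Filter.Tendsto (fun i => V (ns i) (Real.log ‖x‖)) Filter.atTop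
      (nhds (toFun U x)) := hx.congr fun i => (h2 (ns i)).trans (lift_apply _ hx0)
  exact tendsto_nhds_unique h3 (Classical.epsilon_spec (p := fun l : ℝ =>
    Filter.Tendsto (fun i => V (ns i) (Real.log ‖x‖)) Filter.atTop (nhds l)) ⟨_, h3⟩)

/-- Approximate u by test functions, replace these by their circle means, and truncate the means in
log r. The norm comparisons make the resulting lifts a Cauchy sequence, and its limit has the same
underlying function as u. -/
theorem Hr_le_closure_radJets (hχ : IsCutoff χ)
    (hfin : ∀ V : ℝ → ℝ, ContDiff ℝ ∞ V → HasCompactSupport V →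
      sobNorm (mLog χ) γ s σ V < ⊤) :
    Hr χ s γ σ ≤ (radJets χ s γ σ).topologicalClosure := by
  rintro U ⟨hU, v, hv⟩
  rw [Filter.EventuallyEq, ae_weighted_iff hχ] at hv
  obtain ⟨Un, hUn, hlim⟩ := mem_closure_iff_seq_limit.1 hU
  choose φ hφ cφ jφ using hUn
  obtain ⟨C1, hC1⟩ := exists_sobNorm_circMean_le hχ γ σ s
  obtain ⟨C2, hC2⟩ := exists_enorm_lift_le hχ γ σ s
  have hM := logWeight_mLog hχ
  have sV : ∀ n, ContDiff ℝ ∞ (circMean (φ n)) := fun n => circMean_contDiff (hφ n) (cφ n)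
  -- At n = 0 the bound is ⊤ and carries no information; only the limit matters.
  have hW : ∀ n : ℕ, ∃ W : ℝ → ℝ, ContDiff ℝ ∞ W ∧ HasCompactSupport W ∧
      sobNorm (mLog χ) γ s σ (W - circMean (φ n)) ≤ ((n : ℝ≥0∞))⁻¹ := by
    intro n
    obtain ⟨W, h1, h2, h3⟩ := exists_tendsto_sobNorm hM γ σ s (sV n)
      ((hC1 _ _ (hφ n) (cφ n) (jφ n)).trans_lt
        (ENNReal.mul_lt_top ENNReal.coe_lt_top enorm_lt_top))
    have hpos : (0 : ℝ≥0∞) < ((n : ℝ≥0∞))⁻¹ := ENNReal.inv_pos.2 (ENNReal.natCast_ne_top n)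
    obtain ⟨k, hk⟩ := (h3.eventually_lt_const hpos).exists
    exact ⟨W k, h1 k, h2 k, hk.le⟩
  choose W sW cW eW using hW
  choose U' jU' using fun n => exists_isJet_lift (s := s) (γ := γ) (σ := σ) hχ (sW n) (cW n)
    (hfin _ (sW n) (cW n))
  have hinv := ENNReal.tendsto_inv_nat_nhds_zero
  have hUc : Filter.Tendsto (fun p : ℕ × ℕ => ‖Un p.1 - Un p.2‖ₑ) Filter.atTop (nhds 0) := by
    have h := ENNReal.tendsto_ofReal (cauchySeq_iff_tendsto_dist_atTop_0.1 hlim.cauchySeq)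
    rw [ENNReal.ofReal_zero] at h
    refine h.congr fun p => ?_
    rw [← edist_dist, edist_eq_enorm_sub]
  have hbound : ∀ p : ℕ × ℕ, edist (U' p.1) (U' p.2)
      ≤ C2 * (((p.1 : ℝ≥0∞))⁻¹ + (C1 * ‖Un p.1 - Un p.2‖ₑ + ((p.2 : ℝ≥0∞))⁻¹)) := by
    rintro ⟨n, k⟩
    have j1 := (jU' n).sub (jU' k) (lift_contDiff (sW n) (cW n)) (lift_contDiff (sW k) (cW k))
    rw [← lift_sub] at j1
    rw [edist_eq_enorm_sub]
    refine (hC2 (W n - W k) _ ((sW n).sub (sW k)) j1).trans ?_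
    have j2 := IsJet.sub (jφ n) (jφ k) (hφ n) (hφ k)
    have b2 := hC1 (φ n - φ k) _ ((hφ n).sub (hφ k)) ((cφ n).sub (cφ k)) j2
    rw [circMean_sub (hφ n).continuous (hφ k).continuous] at b2
    -- Two truncation errors and the difference of means, which is the mean of the difference and
    -- hence controlled by the Cauchy sequence of jets.
    have e : W n - W k = (W n - circMean (φ n)) + ((circMean (φ n) - circMean (φ k))
        + -(W k - circMean (φ k))) := by abel
    have s1 : ContDiff ℝ ∞ (W n - circMean (φ n)) := (sW n).sub (sV n)
    have s2 : ContDiff ℝ ∞ (circMean (φ n) - circMean (φ k)) := (sV n).sub (sV k)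
    have s3 : ContDiff ℝ ∞ (-(W k - circMean (φ k))) := ((sW k).sub (sV k)).neg
    rw [e]
    gcongr
    refine (sobNorm_add_le hM s1 (s2.add s3)).trans (add_le_add (eW n) ?_)
    refine (sobNorm_add_le hM s2 s3).trans (add_le_add b2 ?_)
    rw [sobNorm_neg]
    exact eW k
  have hcauchy : CauchySeq U' := by
    rw [cauchySeq_iff_tendsto_dist_atTop_0]
    have hb : Filter.Tendsto (fun p : ℕ × ℕ => (C2 : ℝ≥0∞)
        * (((p.1 : ℝ≥0∞))⁻¹ + (C1 * ‖Un p.1 - Un p.2‖ₑ + ((p.2 : ℝ≥0∞))⁻¹)))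
        Filter.atTop (nhds 0) := by
      rw [← Filter.prod_atTop_atTop_eq] at hUc ⊢
      have t1 := hinv.comp (Filter.tendsto_fst (f := Filter.atTop (α := ℕ))
        (g := Filter.atTop (α := ℕ)))
      have t2 := hinv.comp (Filter.tendsto_snd (f := Filter.atTop (α := ℕ))
        (g := Filter.atTop (α := ℕ)))
      have t3 := ENNReal.Tendsto.const_mul (a := (C1 : ℝ≥0∞)) hUc (Or.inr ENNReal.coe_ne_top)
      have t4 := ENNReal.Tendsto.const_mul (a := (C2 : ℝ≥0∞)) (t1.add (t3.add t2))
        (Or.inr ENNReal.coe_ne_top)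
      simpa using t4
    have h := (ENNReal.tendsto_toReal ENNReal.zero_ne_top).comp
      (tendsto_of_tendsto_of_tendsto_of_le_of_le tendsto_const_nhds hb
        (fun _ => zero_le) hbound)
    simpa [Function.comp_def, dist_edist] using h
  obtain ⟨L, hL⟩ := cauchySeq_tendsto_of_complete hcauchy
  have hLmem : L ∈ (radJets χ s γ σ).topologicalClosure :=
    mem_closure_of_tendsto hL (Filter.Eventually.of_forall fun n =>
      (⟨W n, sW n, cW n, jU' n⟩ : U' n ∈ radJets χ s γ σ))
  -- The means have been compared with u only at the level of functions. Uniqueness upgrades this to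
  -- equality of the full jets.
  suffices h : L - U = 0 by rwa [← sub_eq_zero.1 h]
  refine eq_zero_of_toFun_eq_zero hχ
    (sub_mem (Submodule.topologicalClosure_mono radJets_le_testJets hLmem) hU) ?_
  set μ := weighted χ γ (σ + ((0 : ℕ) : ℝ)) with hμ
  have mL := aestronglyMeasurable_toFun hχ L
  have mU := aestronglyMeasurable_toFun hχ U
  have aesm : ∀ {f : Plane → ℝ}, AEStronglyMeasurable f volume → AEStronglyMeasurable f μ :=
    fun h => (aestronglyMeasurable_weighted_iff hχ _ _).2 h
  have hle : ∀ n, eLpNorm (toFun (L - U)) 2 μ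
      ≤ ‖U' n - L‖ₑ + (polarConst * ((n : ℝ≥0∞))⁻¹ + ‖Un n - U‖ₑ) := by
    intro n
    set A : Plane → ℝ := fun x => circMean (φ n) (Real.log ‖x‖) with hA
    have mW : AEStronglyMeasurable (lift (W n)) volume :=
      (lift_contDiff (sW n) (cW n)).continuous.aestronglyMeasurable
    have mA : AEStronglyMeasurable A volume := by
      have := (sV n).continuous.measurable
      exact (this.comp (Real.measurable_log.comp measurable_norm)).aestronglyMeasurable
    have m' := aestronglyMeasurable_toFun hχ (U' n - L)
    have e : toFun (L - U) =ᵐ[volume]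
        -toFun (U' n - L) + ((lift (W n) - A) + (A - toFun U)) := by
      filter_upwards [toFun_sub hχ L U, toFun_sub hχ (U' n) L, (jU' n).toFun_ae_eq hχ]
        with x h1 h2 h3
      simp only [Pi.add_apply, Pi.neg_apply, Pi.sub_apply, h1, h2, h3]
      ring
    rw [eLpNorm_weighted_congr hχ _ _ e]
    refine (eLpNorm_add_le (aesm m'.neg) (aesm ((mW.sub mA).add (mA.sub mU))) (by norm_num)).trans
      (add_le_add ?_ ((eLpNorm_add_le (aesm (mW.sub mA)) (aesm (mA.sub mU)) (by norm_num)).trans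
        (add_le_add ?_ ?_)))
    · rw [eLpNorm_neg]
      exact eLpNorm_toFun_le _
    · have h1 := eLpNorm_radial hχ γ (σ + ((0 : ℕ) : ℝ)) (F := lift (W n) - A)
        (f := fun t => Real.exp (-((0 : ℕ) * t)) * iteratedDeriv 0 (W n - circMean (φ n)) t)
        (sobTerm_measurable ((sW n).sub (sV n)) 0) (fun x hx => by
          simp [hA, lift_apply _ hx])
      rw [h1]
      gcongr
      exact (nrm_le_sobNorm (Nat.zero_le s) _).trans (eW n)
    · have h1 := eLpNorm_circMean_sub_le hχ γ (σ + ((0 : ℕ) : ℝ)) (ρ := fun _ => 1)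
        measurable_const (fun _ _ _ => rfl) (hφ n).continuous mU hv
      simp only [one_mul] at h1
      refine h1.trans (le_trans (le_of_eq ?_) (eLpNorm_toFun_le (Un n - U)))
      refine eLpNorm_weighted_congr hχ _ _ ?_
      filter_upwards [toFun_sub hχ (Un n) U, (show IsJet (Un n) (φ n) from jφ n).toFun_ae_eq hχ]
        with x h1 h2
      rw [h1, Pi.sub_apply, h2]
  have hz : eLpNorm (toFun (L - U)) 2 μ = 0 := by
    have t : ∀ {F : ℕ → Jets χ s γ σ} {G}, Filter.Tendsto F Filter.atTop (nhds G) →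
        Filter.Tendsto (fun n => ‖F n - G‖ₑ) Filter.atTop (nhds 0) := fun h => by
      simpa [edist_eq_enorm_sub] using tendsto_iff_edist_tendsto_0.1 h
    have t1 := ENNReal.Tendsto.const_mul (a := polarConst) hinv (Or.inr polarConst_ne_top)
    have t2 := (t hL).add (t1.add (t hlim))
    simp only [mul_zero, add_zero] at t2
    exact le_antisymm (ge_of_tendsto' t2 hle) zero_le
  rw [eLpNorm_eq_zero_iff (aesm (aestronglyMeasurable_toFun hχ _)) (by norm_num),
    Filter.EventuallyEq, ae_weighted_iff hχ] at hz
  exact hz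

end Radial

/-! ### The graph of the operator on lifts -/

section Graph

variable {χ : Plane → ℝ} {γ σ : ℝ}

theorem bessel_smul (c : ℝ) {V : ℝ → ℝ} (hV : ContDiff ℝ ∞ V) :
    bessel (c • V) = c • bessel V := by
  funext t
  have h := iteratedDeriv_const_smul (contDiffAt_of_contDiff_infty hV 2 t) c
  simp only [bessel, h, Pi.smul_apply, smul_eq_mul]
  ring

/-- Pairs of the derivatives of a radial test function and of its image under `Δ₁ - Id`. -/
def besselGraph (χ : Plane → ℝ) (s : ℕ) (γ σ : ℝ) :
    Submodule ℝ (Jets χ (s + 2) γ σ × Jets χ s γ (σ + 2)) where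
  carrier := {z | ∃ V : ℝ → ℝ, ContDiff ℝ ∞ V ∧ HasCompactSupport V ∧ IsJet z.1 (lift V) ∧
    IsJet z.2 (lift (bessel V))}
  add_mem' := by
    rintro z w ⟨V, hV, cV, h, k⟩ ⟨V', hV', cV', h', k'⟩
    refine ⟨V + V', hV.add hV', cV.add cV', ?_, ?_⟩
    · rw [lift_add]
      exact h.add h' (lift_contDiff hV cV) (lift_contDiff hV' cV')
    · rw [bessel_add hV hV', lift_add]
      exact k.add k' (lift_contDiff (bessel_contDiff hV) (bessel_hasCompactSupport cV))
        (lift_contDiff (bessel_contDiff hV') (bessel_hasCompactSupport cV'))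
  zero_mem' := by
    have h0 : lift 0 = 0 := by
      funext x
      simp [lift]
    have b0 : bessel 0 = 0 := by
      have := bessel_smul 0 (V := 0) contDiff_const
      simpa using this
    refine ⟨0, contDiff_const, HasCompactSupport.zero, ?_, ?_⟩
    · rw [h0]
      exact IsJet.zero
    · rw [b0, h0]
      exact IsJet.zero
  smul_mem' := by
    rintro c z ⟨V, hV, cV, h, k⟩
    refine ⟨c • V, contDiff_const.smul hV, cV.smul_left (f := fun _ => c), ?_, ?_⟩
    · rw [lift_smul]
      exact h.smul c (lift_contDiff hV cV)
    · rw [bessel_smul c hV, lift_smul]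
      exact k.smul c (lift_contDiff (bessel_contDiff hV) (bessel_hasCompactSupport cV))

theorem norm_le_of_enorm_le {E F : Type*} [SeminormedAddCommGroup E] [SeminormedAddCommGroup F]
    {x : E} {y : F} {C : ℝ≥0} (h : ‖x‖ₑ ≤ C * ‖y‖ₑ) : ‖x‖ ≤ C * ‖y‖ := by
  have h1 : ((‖x‖₊ : ℝ≥0) : ℝ≥0∞) ≤ ((C * ‖y‖₊ : ℝ≥0) : ℝ≥0∞) := by
    rw [ENNReal.coe_mul]
    exact h
  exact_mod_cast ENNReal.coe_le_coe.1 h1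

theorem exists_norm_snd_le_on_besselGraph (hχ : IsCutoff χ) (γ σ : ℝ) (s : ℕ) :
    ∃ C : ℝ≥0, ∀ z ∈ besselGraph χ s γ σ, ‖z.2‖ ≤ C * ‖z.1‖ := by
  obtain ⟨C1, h1⟩ := exists_sobNorm_le_enorm_lift hχ γ σ (s + 2)
  obtain ⟨C2, h2⟩ := exists_enorm_lift_le hχ γ (σ + 2) s
  obtain ⟨C3, h3⟩ := sobNorm_bessel_le (logWeight_mLog hχ) γ σ s
  refine ⟨C2 * (C3 * C1), ?_⟩
  rintro z ⟨V, hV, cV, j1, j2⟩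
  refine norm_le_of_enorm_le ((h2 _ _ (bessel_contDiff hV) j2).trans ?_)
  push_cast
  rw [mul_assoc, mul_assoc]
  gcongr
  refine (h3 V hV).trans ?_
  gcongr
  exact h1 V _ hV cV j1

/-- The a priori estimate, carried to the plane by the norm equivalence on both sides. -/
theorem exists_norm_fst_le_on_besselGraph (hχ : IsCutoff χ) (γ : ℝ)
    (hσ : σ ∈ Set.Ioo (-2 : ℝ) 0) (s : ℕ) :
    ∃ C : ℝ≥0, ∀ z ∈ besselGraph χ s γ σ, ‖z.1‖ ≤ C * ‖z.2‖ := by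
  obtain ⟨C1, h1⟩ := exists_sobNorm_le_enorm_lift hχ γ (σ + 2) s
  obtain ⟨C2, h2⟩ := exists_enorm_lift_le hχ γ σ (s + 2)
  obtain ⟨C3, h3⟩ := sobNorm_le_bessel (logWeight_mLog hχ) γ hσ s
  refine ⟨C2 * (C3 * C1), ?_⟩
  rintro z ⟨V, hV, cV, j1, j2⟩
  refine norm_le_of_enorm_le ((h2 _ _ hV j1).trans ?_)
  push_cast
  rw [mul_assoc, mul_assoc]
  gcongr
  refine (h3 V hV cV).trans ?_
  gcongr
  exact h1 _ _ (bessel_contDiff hV) (bessel_hasCompactSupport cV) j2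

theorem sobNorm_lt_top_of_hasCompactSupport {M : ℝ → ℝ} (hM : LogWeight M) (γ : ℝ)
    (hσ : σ ∈ Set.Ioo (-2 : ℝ) 0) (s : ℕ) {V : ℝ → ℝ} (hV : ContDiff ℝ ∞ V)
    (cV : HasCompactSupport V) : sobNorm M γ s σ V < ⊤ :=
  sobNorm_lt_top_of_rapidDecay hM γ hσ s hV fun k => RapidDecay.of_hasCompactSupport
    (contDiff_iteratedDeriv_infty hV k).continuous (iteratedDeriv_hasCompactSupport cV k)

/-- The decay criterion for finite norms requires an exponent in (-2,0), and σ + 2 lies outside.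
Writing F as `bessel V` with V rapidly decaying transfers finiteness from exponent σ by boundedness.
-/
theorem sobNorm_add_two_lt_top {M : ℝ → ℝ} (hM : LogWeight M) (γ : ℝ)
    (hσ : σ ∈ Set.Ioo (-2 : ℝ) 0) (s : ℕ) {F : ℝ → ℝ} (hF : ContDiff ℝ ∞ F)
    (cF : HasCompactSupport F) : sobNorm M γ s (σ + 2) F < ⊤ := by
  obtain ⟨V, hV, rfl, dV⟩ := exists_bessel_eq hF cF
  obtain ⟨C, hC⟩ := sobNorm_bessel_le hM γ σ s
  exact (hC V hV).trans_lt (ENNReal.mul_lt_top ENNReal.coe_lt_top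
    (sobNorm_lt_top_of_rapidDecay hM γ hσ (s + 2) hV dV))

theorem bessel_sub {V W : ℝ → ℝ} (hV : ContDiff ℝ ∞ V) (hW : ContDiff ℝ ∞ W) :
    bessel (V - W) = bessel V - bessel W := by
  have hW' : ContDiff ℝ ∞ (-W) := hW.neg
  rw [sub_eq_add_neg, bessel_add hV hW', bessel_neg, sub_eq_add_neg]

theorem exists_mem_besselGraph (hχ : IsCutoff χ) (γ : ℝ) (hσ : σ ∈ Set.Ioo (-2 : ℝ) 0) (s : ℕ)
    {V : ℝ → ℝ} (hV : ContDiff ℝ ∞ V) (cV : HasCompactSupport V) :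
    ∃ z ∈ besselGraph χ s γ σ, IsJet z.1 (lift V) ∧ IsJet z.2 (lift (bessel V)) := by
  have hM := logWeight_mLog hχ
  have sB := bessel_contDiff hV
  have cB := bessel_hasCompactSupport cV
  obtain ⟨U, hU⟩ := exists_isJet_lift (γ := γ) hχ hV cV
    (sobNorm_lt_top_of_hasCompactSupport hM γ hσ (s + 2) hV cV)
  obtain ⟨W, hW⟩ := exists_isJet_lift (γ := γ) hχ sB cB (sobNorm_add_two_lt_top hM γ hσ s sB cB)
  exact ⟨(U, W), ⟨V, hV, cV, hU, hW⟩, hU, hW⟩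

theorem map_fst_besselGraph (hχ : IsCutoff χ) (hσ : σ ∈ Set.Ioo (-2 : ℝ) 0) (s : ℕ) :
    (besselGraph χ s γ σ).map (LinearMap.fst ℝ _ _) = radJets χ (s + 2) γ σ := by
  ext U
  constructor
  · rintro ⟨z, ⟨V, hV, cV, j1, -⟩, rfl⟩
    exact ⟨V, hV, cV, j1⟩
  · rintro ⟨V, hV, cV, j⟩
    obtain ⟨z, hz, j1, -⟩ := exists_mem_besselGraph hχ γ hσ s hV cV
    refine ⟨z, hz, ?_⟩
    change z.1 = U
    ext1 α
    exact Lp.ext ((j1 α).trans (j α).symm)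

/-- The range is dense: the solution V of `bessel V = F` need not have compact support, but its
truncations do, and by boundedness their images converge to F. -/
theorem closure_map_snd_besselGraph (hχ : IsCutoff χ) (hσ : σ ∈ Set.Ioo (-2 : ℝ) 0) (s : ℕ) :
    ((besselGraph χ s γ σ).map (LinearMap.snd ℝ _ _)).topologicalClosure
      = (radJets χ s γ (σ + 2)).topologicalClosure := by
  have hM := logWeight_mLog hχ
  refine le_antisymm (Submodule.topologicalClosure_mono ?_)
    (Submodule.topologicalClosure_minimal _ ?_ (Submodule.isClosed_topologicalClosure _))
  · rintro _ ⟨z, ⟨V, hV, cV, -, j2⟩, rfl⟩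
    exact ⟨bessel V, bessel_contDiff hV, bessel_hasCompactSupport cV, j2⟩
  · rintro U ⟨F, hF, cF, j⟩
    obtain ⟨V, hV, hVF, dV⟩ := exists_bessel_eq hF cF
    obtain ⟨W, sW, cW, hW⟩ := exists_tendsto_sobNorm hM γ σ (s + 2) hV
      (sobNorm_lt_top_of_rapidDecay hM γ hσ (s + 2) hV dV)
    obtain ⟨C2, h2⟩ := exists_enorm_lift_le hχ γ (σ + 2) s
    obtain ⟨C3, h3⟩ := sobNorm_bessel_le hM γ σ s
    choose z hz _ jz using fun n => exists_mem_besselGraph hχ γ hσ s (sW n) (cW n)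
    have hb : ∀ n, edist (z n).2 U ≤ C2 * (C3 * sobNorm (mLog χ) γ (s + 2) σ (W n - V)) := by
      intro n
      have sB := bessel_contDiff (sW n)
      have j' := IsJet.sub (jz n) j (lift_contDiff sB (bessel_hasCompactSupport (cW n)))
        (lift_contDiff hF cF)
      rw [← lift_sub, ← hVF, ← bessel_sub (sW n) hV] at j'
      rw [edist_eq_enorm_sub]
      have sWV : ContDiff ℝ ∞ (W n - V) := (sW n).sub hV
      refine (h2 _ _ (bessel_contDiff sWV) j').trans ?_
      gcongr
      exact h3 _ sWV
    have t := ENNReal.Tendsto.const_mul (a := (C2 : ℝ≥0∞))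
      (ENNReal.Tendsto.const_mul (a := (C3 : ℝ≥0∞)) hW (Or.inr ENNReal.coe_ne_top))
      (Or.inr ENNReal.coe_ne_top)
    simp only [mul_zero] at t
    have hlim : Filter.Tendsto (fun n => (z n).2) Filter.atTop (nhds U) :=
      tendsto_iff_edist_tendsto_0.2 (tendsto_of_tendsto_of_tendsto_of_le_of_le
        tendsto_const_nhds t (fun _ => zero_le) hb)
    exact mem_closure_of_tendsto hlim (Filter.Eventually.of_forall fun n => ⟨z n, hz n, rfl⟩)

/-- On lifts the identity holds at every x ≠ 0 by `lift_bessel`, with coefficients independent of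
the approximating function. Almost everywhere convergence of all components involved carries it to
the closure. -/
theorem toFun_ae_eq_deltaOneSubId (hχ : IsCutoff χ) {s : ℕ} (hs : 2 ≤ s + 2)
    {z : Jets χ (s + 2) γ σ × Jets χ s γ (σ + 2)}
    (hz : z ∈ (besselGraph χ s γ σ).topologicalClosure) :
    toFun z.2 =ᵐ[volume] deltaOneSubId hs z.1 := by
  obtain ⟨w, hw, hlim⟩ := mem_closure_iff_seq_limit.1 hz
  choose V hV cV j1 j2 using hw
  have l1 := (continuous_fst.tendsto z).comp hlim
  have l2 := (continuous_snd.tendsto z).comp hlim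
  obtain ⟨ns, hns, h1⟩ := exists_subseq_tendsto_ae l1 Finset.univ
  -- Extracted from the first subsequence, so that source and image converge along the same indices.
  obtain ⟨ms, hms, h2⟩ := exists_subseq_tendsto_ae (l2.comp hns.tendsto_atTop) Finset.univ
  have a1 : ∀ α : MultiIndex (s + 2), ∀ᵐ x, Filter.Tendsto
      (fun i => multiDeriv α.1 (lift (V (ns (ms i)))) x) Filter.atTop
        (nhds ((z.1 α : Plane → ℝ) x)) := by
    intro α
    have h := h1 α (Finset.mem_univ _)
    rw [ae_weighted_iff hχ] at h
    filter_upwards [h, ae_all_iff.2 fun n => IsJet.ae_eq hχ (j1 n) α] with x hx e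
    exact (hx.comp hms.tendsto_atTop).congr fun i => e _
  have a2 : ∀ᵐ x, Filter.Tendsto (fun i => lift (bessel (V (ns (ms i)))) x) Filter.atTop
      (nhds (toFun z.2 x)) := by
    have h := h2 ⟨(0, 0), Nat.zero_le s⟩ (Finset.mem_univ _)
    rw [ae_weighted_iff hχ] at h
    filter_upwards [h, ae_all_iff.2 fun n => IsJet.toFun_ae_eq hχ (j2 n)] with x hx e
    exact hx.congr fun i => e _
  filter_upwards [a1 ⟨(2, 0), by omega⟩, a1 ⟨(1, 1), by omega⟩, a1 ⟨(0, 2), by omega⟩,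
    a1 ⟨(1, 0), by omega⟩, a1 ⟨(0, 1), by omega⟩, a1 ⟨(0, 0), by omega⟩, a2, ae_ne_zero_plane]
    with x h20 h11 h02 h10 h01 h00 hb hx
  refine tendsto_nhds_unique hb ?_
  simp only [fun n => lift_bessel (hV n) hx]
  exact ((((h20.const_mul _).add (h11.const_mul _)).add (h02.const_mul _)).add
    (((h10.const_mul _).add (h01.const_mul _)).const_mul _)).sub (h00.const_mul _) |>.sub h00

end Graph

end DoublyWeighted

end

/-! ### Conclusion -/

theorem mainTheorem3 (χ : DoublyWeighted.Plane → ℝ) (hχ : DoublyWeighted.IsCutoff χ)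
    (γ σ : ℝ) (hσ : σ ∈ Set.Ioo (-2 : ℝ) 0) (s : ℕ) (hs : 2 ≤ s) :
    ∃ T : DoublyWeighted.Hr χ s γ σ ≃L[ℝ] DoublyWeighted.Hr χ (s - 2) γ (σ + 2),
      ∀ u : DoublyWeighted.Hr χ s γ σ,
        DoublyWeighted.toFun (T u).1 =ᵐ[MeasureTheory.volume]
          DoublyWeighted.deltaOneSubId hs u.1 := by
  open DoublyWeighted in
  obtain ⟨s, rfl⟩ := Nat.exists_eq_add_of_le' hs
  rw [Nat.add_sub_cancel]
  have hM := logWeight_mLog hχ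
  obtain ⟨C, h1⟩ := exists_norm_snd_le_on_besselGraph hχ γ σ s
  obtain ⟨C', h2⟩ := exists_norm_fst_le_on_besselGraph hχ γ hσ s
  -- This equality and the next identify domain and target with the closures of the two projections
  -- of the graph, as `exists_equiv_of_graph` requires.
  have hA : Hr χ (s + 2) γ σ
      = ((besselGraph χ s γ σ).map (LinearMap.fst ℝ _ _)).topologicalClosure := by
    rw [map_fst_besselGraph hχ hσ]
    exact le_antisymm (Hr_le_closure_radJets hχ fun V hV cV =>
      sobNorm_lt_top_of_hasCompactSupport hM γ hσ _ hV cV) (closure_radJets_le_Hr hχ)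
  have hB : Hr χ s γ (σ + 2)
      = ((besselGraph χ s γ σ).map (LinearMap.snd ℝ _ _)).topologicalClosure := by
    rw [closure_map_snd_besselGraph hχ hσ]
    exact le_antisymm (Hr_le_closure_radJets hχ fun V hV cV =>
      sobNorm_add_two_lt_top hM γ hσ _ hV cV) (closure_radJets_le_Hr hχ)
  obtain ⟨T, hT⟩ := exists_equiv_of_graph (besselGraph χ s γ σ) h1 h2 hA hB
  exact ⟨T, fun u => toFun_ae_eq_deltaOneSubId hχ hs (hT u)⟩
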